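/- **Setting.** Let $p$ be a prime, $e\ge 1$ an integer and $q=p^e$. Let $X$ be a Noetherian regular $F$-finite $\mathbf F_p$-scheme ($F$-finite means that the Frobenius endomorphism is finite), and let $f\in\Gamma(X,\mathcal O_X)$. For an integer $m\ge 0$ let $\mathcal D_X^{(m)}=\mathcal End_{\mathcal O_X^{p^m}}(\mathcal O_X)$, and let $\mathcal D_X=\bigcup_m\mathcal D_X^{(m)}$ be the sheaf of differential operators on $X$. *Unit Frobenius modules.* An lfgu $F^e$-module on $X$ is a quasi-coherent $\mathcal O_X$-module $\mathscr M$ with an additive endomorphism $\phi$ satisfying $\phi(ax)=a^q\phi(x)$, such that the linearization $F_q^*\mathscr M\to\mathscr M$, $a\otimes x\mapsto a\phi(x)$, is an isomorphism, and such that $\mathscr M$ is locally finitely generated as an $\mathcal O_X[F^e]$-module. For $n\ge0$ let $\varphi_n\colon F_q^{n*}\mathscr M\to\mathscr M$, $a\otimes x\mapsto a\phi^n(x)$, be the resulting isomorphism, and for a submodule $M\subset\mathscr M$ regard $F_q^{n*}M$ as a submodule of $\mathscr M$ through $\varphi_n$. The sheaf $\mathcal D_X$ acts on $\mathscr M$: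 an $\mathcal O_X^{q^n}$-linear operator $P$ acts as $\varphi_n\circ(P\otimes\mathrm{id})\circ\varphi_n^{-1}$. A root of $\mathscr M$ is a coherent $\mathcal O_X$-submodule $M\subset\mathscr M$ with $M\subset F_q^*M$ and $\mathscr M=\bigcup_{n\ge0}F_q^{n*}M$. The minimal root is the root contained in every root. *Bernstein–Sato roots.* Let $\mathscr C$ be the ring of locally constant functions $\mathbf Z_p\to\mathbf F_p$. Let $\gamma_+\mathscr M=\mathscr M[t][(f-t)^{-1}]/\mathscr M[t]$. An operator $P\in\mathcal D_X$ acts on $\mathscr M[t]$ through the coefficients, a function $c\in\mathscr C$ acts on $\mathscr M[t]$ by $xt^i\mapsto c(-i-1)\,xt^i$, and both actions extend to $\gamma_+\mathscr M$ by commuting with multiplication by $(f-t)^{-p^m}$ for all large $m$. For an $\mathcal O_X$-submodule $M\subset\mathscr M$ put $N_f(M)=(\mathcal D_X\otimes_{\mathbf F_p}\mathscr C)\cdot M(f-t)^{-1}\subset\gamma_+\mathscr M$, and for $\alpha\in\mathbf Z_p$ put $N_f(M)_\alpha=N_f(M)\otimes_{\mathscr C}\mathbf F_p$, where $\mathscr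 C\to\mathbf F_p$ is evaluation at $\alpha$ (this functor is exact). Define $$\mathrm{BSR}(M,f)=\{\alpha\in\mathbf Z_p\mid N_f(fM)_\alpha\subsetneq N_f(M)_\alpha\},$$ $$\mathrm{BSR}^{(m)}(M,f)=\{n\in\mathbf Z_{\ge0}\mid \mathcal D_X^{(m)}f^{n+1}M\subsetneq\mathcal D_X^{(m)}f^nM\}.$$ **Theorem.** Let $\mathscr M$ be an lfgu $F^e$-module on $X$ and let $M\subset\mathscr M$ be a coherent $\mathcal O_X$-submodule. Consider the condition (B) there is a constant $L\ge0$ such that $\#\bigl(\mathrm{BSR}^{(em)}(M,f)\cap[0,q^m)\bigr)\le L$ for all $m\ge1$. 1. If $X$ has an open covering $X=\bigcup_iU_i$ in which each $U_i$ is of finite type over an $F$-finite field, then (B) holds. 2. Assume that (B) holds. Then the set $\mathrm{BSR}(M,f)$ is finite. If moreover $M$ is a root of $\mathscr M$, then $\mathrm{BSR}(M,f)\subset\mathbf Z_{(p)}=\mathbf Z_p\cap\mathbf Q$. If $M$ is the minimal root of $\mathscr M$, then $\mathrm{BSR}(M,f)\subset\mathbf Z_{(p)}\cap[-1,0]$.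 -/

import Mathlib

universe u

open scoped TensorProduct Polynomial
open AlgebraicGeometry CategoryTheory

namespace BSRoots

/-! ### Rings of characteristic `p` and their Frobenius endomorphisms -/

/-- `R` is an `𝔽_p`-algebra (a property of `R`; the zero ring is allowed). -/
class IsFpRing (p : ℕ) (R : Type*) [CommRing R] : Prop where
  cast_eq_zero : (p : R) = 0

section Ring

variable (p : ℕ) [Fact p.Prime] (R : Type*) [CommRing R] [IsFpRing p R]

theorem add_pow_frob {R : Type*} [CommRing R] [IsFpRing p R] (n : ℕ) (a b : R) :
    (a + b) ^ p ^ n = a ^ p ^ n + b ^ p ^ n := by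
  obtain h | h := subsingleton_or_nontrivial R
  · exact Subsingleton.elim _ _
  · have : CharP R p := by
      obtain ⟨q, hq⟩ := CharP.exists R
      have h1 : q ∣ p := (CharP.cast_eq_zero_iff R q p).1 IsFpRing.cast_eq_zero
      rcases (Nat.dvd_prime (Fact.out : p.Prime)).1 h1 with h2 | h2
      · subst h2; exact absurd h (not_nontrivial_iff_subsingleton.2 (CharP.CharOne.subsingleton))
      · exact h2 ▸ hq
    exact add_pow_char_pow ..

/-- The `p ^ n`-th Frobenius endomorphism `a ↦ a ^ (p ^ n)` of an `𝔽_p`-algebra. -/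
def frob (n : ℕ) : R →+* R where
  toFun a := a ^ p ^ n
  map_one' := one_pow _
  map_mul' a b := mul_pow a b _
  map_zero' := zero_pow (pow_ne_zero _ (Fact.out : p.Prime).ne_zero)
  map_add' := add_pow_frob p n

/-- An `𝔽_p`-algebra is `F`-finite if its Frobenius endomorphism is finite. -/
def FFiniteRing : Prop := (frob p R 1).Finite

/-- The ring `R`, regarded as an `R`-algebra through the `p ^ n`-th Frobenius endomorphism. -/
def FrobTwist (_p _n : ℕ) (R : Type*) : Type _ := R

instance (n : ℕ) : CommRing (FrobTwist p n R) := inferInstanceAs (CommRing R)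

instance (n : ℕ) : Algebra R (FrobTwist p n R) := (frob p R n : R →+* R).toAlgebra

theorem frobTwist_smul (n : ℕ) (a : R) (b : FrobTwist p n R) :
    a • b = (show FrobTwist p n R from (show R from a ^ p ^ n) * (show R from b)) := rfl

/-! ### Differential operators -/

/-- An additive endomorphism `P` of `R` (for an `𝔽_p`-algebra this is the same as an `𝔽_p`-linear
endomorphism) is a differential operator if the map `a ⊗ b ↦ a * P b` kills a power of the kernel
of the multiplication map `R ⊗ R → R`. -/
def IsDiffOp {R : Type*} [CommRing R] (P : AddMonoid.End R) : Prop :=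
  ∃ n : ℕ, ∀ z ∈ (RingHom.ker (Algebra.TensorProduct.lmul' ℤ (S := R))) ^ (n + 1),
    LinearMap.mul' ℤ R (LinearMap.lTensor R (AddMonoidHom.toIntLinearMap P) z) = 0

/-- The operators of level `m`: the endomorphisms of `R` that are linear over the subring of
`p ^ m`-th powers. -/
def IsLevel (p m : ℕ) {R : Type*} [CommRing R] (P : AddMonoid.End R) : Prop :=
  ∀ a b : R, P (a ^ p ^ m * b) = a ^ p ^ m * P b

theorem IsLevel.mono {p m n : ℕ} {R : Type*} [CommRing R] {P : AddMonoid.End R}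
    (h : IsLevel p m P) (hmn : m ≤ n) : IsLevel p n P := by
  intro a b
  obtain ⟨k, rfl⟩ := Nat.exists_eq_add_of_le hmn
  have := h (a ^ p ^ k) b
  rwa [← pow_mul, ← pow_add, add_comm k m] at this

theorem exists_isLevel_mul {p k : ℕ} [NeZero k] {R : Type*} [CommRing R] {P : AddMonoid.End R}
    (h : ∃ m, IsLevel p m P) : ∃ n, IsLevel p (k * n) P :=
  h.imp fun m hm => hm.mono (Nat.le_mul_of_pos_left m (NeZero.pos k))

theorem IsDiffOp.exists_isLevel {R : Type*} [CommRing R] [IsFpRing p R] {P : AddMonoid.End R}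
    (h : IsDiffOp P) : ∃ m, IsLevel p m P := by
  obtain ⟨n, hn⟩ := h
  refine ⟨n + 1, fun a b => ?_⟩
  have : IsFpRing p (R ⊗[ℤ] R) := ⟨by
    rw [Algebra.TensorProduct.natCast_def, IsFpRing.cast_eq_zero, TensorProduct.zero_tmul]⟩
  set J := RingHom.ker (Algebra.TensorProduct.lmul' ℤ (S := R)) with hJ
  have h1 : (a ⊗ₜ[ℤ] (1 : R) - (1 : R) ⊗ₜ[ℤ] a) ∈ J := by
    rw [hJ, RingHom.mem_ker]; simp
  have h2 : (a ⊗ₜ[ℤ] (1 : R) - (1 : R) ⊗ₜ[ℤ] a) ^ p ^ (n + 1) ∈ J ^ (n + 1) :=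
    Ideal.pow_le_pow_right
      (Nat.lt_pow_self (Fact.out : p.Prime).one_lt).le (Ideal.pow_mem_pow h1 _)
  have h3 : (a ⊗ₜ[ℤ] (1 : R) - (1 : R) ⊗ₜ[ℤ] a) ^ p ^ (n + 1)
      = (a ^ p ^ (n + 1)) ⊗ₜ[ℤ] (1 : R) - (1 : R) ⊗ₜ[ℤ] (a ^ p ^ (n + 1)) := by
    have := add_pow_frob p (n + 1) (a ⊗ₜ[ℤ] (1 : R) - (1 : R) ⊗ₜ[ℤ] a) ((1 : R) ⊗ₜ[ℤ] a)
    rw [sub_add_cancel, Algebra.TensorProduct.tmul_pow, Algebra.TensorProduct.tmul_pow,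
      one_pow] at this
    rw [this, add_sub_cancel_right]
  have h4 := hn _ (Ideal.mul_mem_right ((1 : R) ⊗ₜ[ℤ] b) _ h2)
  rw [h3, sub_mul] at h4
  simp only [Algebra.TensorProduct.tmul_mul_tmul, one_mul, mul_one, map_sub, LinearMap.lTensor_tmul,
    LinearMap.mul'_apply] at h4
  exact (sub_eq_zero.1 h4).symm

end Ring

/-! ### Unit Frobenius modules over a ring -/

section FrobModule

variable (p : ℕ) [Fact p.Prime] (k : ℕ) (R : Type*) [CommRing R] [IsFpRing p R]
  (E : Type*) [AddCommGroup E] [Module R E]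

/-- A `p ^ k`-linear additive endomorphism of an `R`-module, i.e. the action of `F ^ k` for a left
`R[F ^ k]`-module structure. -/
structure FrobEnd where
  toEnd : AddMonoid.End E
  map_smul : ∀ (a : R) (x : E), toEnd (a • x) = a ^ p ^ k • toEnd x

namespace FrobEnd

variable {p k R E}

/-- The linearization `a ⊗ x ↦ a • φ x` from the Frobenius pullback of `E` to `E`. -/
noncomputable def lin (φ : FrobEnd p k R E) : FrobTwist p k R ⊗[R] E →+ E :=
  TensorProduct.liftAddHom
    (AddMonoidHom.mk' (fun a => ((Module.toAddMonoidEnd R E) (show R from a)).comp φ.toEnd)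
      (fun a b => by
        ext x
        exact add_smul (show R from a) (show R from b) (φ.toEnd x)))
    (fun r a x => by
      change (r ^ p ^ k * (show R from a)) • φ.toEnd x = (show R from a) • φ.toEnd (r • x)
      rw [φ.map_smul, smul_smul, mul_comm])

theorem lin_tmul (φ : FrobEnd p k R E) (a : FrobTwist p k R) (x : E) :
    φ.lin (a ⊗ₜ x) = (show R from a) • φ.toEnd x := rfl

/-- The module is unit if the linearization is an isomorphism. -/
def IsUnit (φ : FrobEnd p k R E) : Prop := Function.Bijective φ.lin

/-- The iterates of the Frobenius action. -/
def iter (φ : FrobEnd p k R E) (n : ℕ) : FrobEnd p (k * n) R E where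
  toEnd := φ.toEnd ^ n
  map_smul a x := by
    induction n generalizing x with
    | zero => simp
    | succ n ih =>
      rw [pow_succ', AddMonoid.End.coe_mul, Function.comp_apply, ih, φ.map_smul, ← pow_mul,
        ← pow_add, Function.comp_apply]
      congr 3

/-- `b ⊗ x ↦ b ^ (p ^ k) ⊗ x` -/
noncomputable def twistMap (p k l m : ℕ) [Fact p.Prime] (R : Type*) [CommRing R] [IsFpRing p R]
    (E : Type*) [AddCommGroup E] [Module R E] (h : m = k + l) (a : R) :
    FrobTwist p l R ⊗[R] E →+ FrobTwist p m R ⊗[R] E :=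
  TensorProduct.liftAddHom
    (AddMonoidHom.mk' (fun b => AddMonoidHom.mk'
        (fun x => (show FrobTwist p m R from a * (show R from b) ^ p ^ k) ⊗ₜ[R] x)
        (fun x y => TensorProduct.tmul_add _ _ _))
      (fun b c => by
        ext x
        change _ ⊗ₜ[R] x = (_ ⊗ₜ[R] x + _ ⊗ₜ[R] x : FrobTwist p m R ⊗[R] E)
        rw [← TensorProduct.add_tmul]
        congr 1
        change a * (show R from _ + _) ^ p ^ k = a * (show R from b) ^ p ^ k + a * (show R from c) ^ p ^ k
        rw [← mul_add, ← add_pow_frob]))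
    (fun r b x => by
      change (_ : FrobTwist p m R) ⊗ₜ[R] x = (_ : FrobTwist p m R) ⊗ₜ[R] (r • x)
      rw [← TensorProduct.smul_tmul]
      congr 1
      change a * (r ^ p ^ l * (show R from b)) ^ p ^ k = r ^ p ^ m * (a * (show R from b) ^ p ^ k)
      subst h
      rw [mul_pow, ← pow_mul, ← pow_add, add_comm l k]
      ring)

theorem isUnit_of_comp {l m : ℕ} {φ : FrobEnd p k R E} {ψ : FrobEnd p l R E} {χ : FrobEnd p m R E}
    (hm : m = k + l) (h : ∀ x, χ.toEnd x = φ.toEnd (ψ.toEnd x)) (hφ : φ.IsUnit) (hψ : ψ.IsUnit) :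
    χ.IsUnit := by
  have hψs (r : R) (z : FrobTwist p l R ⊗[R] E) :
      ψ.lin ((show FrobTwist p l R from r) • z) = r • ψ.lin z := by
    induction z with
    | zero => rw [smul_zero, map_zero, smul_zero]
    | add x y hx hy => rw [smul_add, map_add, hx, hy, map_add, smul_add]
    | tmul b x =>
      rw [TensorProduct.smul_tmul', lin_tmul, lin_tmul, smul_smul]
      rfl
  have htw (a r : R) (z : FrobTwist p l R ⊗[R] E) :
      twistMap p k l m R E hm a ((show FrobTwist p l R from r) • z)
        = twistMap p k l m R E hm (r ^ p ^ k * a) z := by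
    induction z with
    | zero => rw [smul_zero, map_zero, map_zero]
    | add x y hx hy => rw [smul_add, map_add, hx, hy, map_add]
    | tmul b x =>
      rw [TensorProduct.smul_tmul']
      change (show FrobTwist p m R from a * (r * (show R from b)) ^ p ^ k) ⊗ₜ[R] x
        = (show FrobTwist p m R from r ^ p ^ k * a * (show R from b) ^ p ^ k) ⊗ₜ[R] x
      congr 1
      change a * (r * (show R from b)) ^ p ^ k = r ^ p ^ k * a * (show R from b) ^ p ^ k
      rw [mul_pow]; ring
  have htadd (a b : R) (z : FrobTwist p l R ⊗[R] E) :
      twistMap p k l m R E hm (a + b) z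
        = twistMap p k l m R E hm a z + twistMap p k l m R E hm b z := by
    induction z with
    | zero => simp
    | add x y hx hy => rw [map_add, hx, hy, map_add, map_add]; abel
    | tmul c x =>
      change (show FrobTwist p m R from (a + b) * (show R from c) ^ p ^ k) ⊗ₜ[R] x
        = (show FrobTwist p m R from a * (show R from c) ^ p ^ k) ⊗ₜ[R] x
          + (show FrobTwist p m R from b * (show R from c) ^ p ^ k) ⊗ₜ[R] x
      rw [← TensorProduct.add_tmul]
      congr 1
      exact add_mul a b _
  let e := AddEquiv.ofBijective ψ.lin hψ
  have he (r : R) (y : E) : e.symm (r • y) = (show FrobTwist p l R from r) • e.symm y := by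
    rw [AddEquiv.symm_apply_eq]
    change _ = ψ.lin _
    rw [hψs]
    congr 1
    exact (e.apply_symm_apply y).symm
  let g : FrobTwist p k R ⊗[R] E →+ FrobTwist p m R ⊗[R] E :=
    TensorProduct.liftAddHom
      (AddMonoidHom.mk' (fun a => (twistMap p k l m R E hm (show R from a)).comp e.symm.toAddMonoidHom)
        (fun a b => by ext x; exact htadd _ _ _))
      (fun r a x => by
        change twistMap p k l m R E hm (r ^ p ^ k * (show R from a)) (e.symm x)
          = twistMap p k l m R E hm (show R from a) (e.symm (r • x))
        rw [he, htw])
  let e' := AddEquiv.ofBijective φ.lin hφ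
  refine ⟨Function.LeftInverse.injective (g := fun y => g (e'.symm y)) (fun z => ?_), fun y => ?_⟩
  · change g (e'.symm (χ.lin z)) = z
    induction z with
    | zero => simp
    | add x y hx hy => rw [map_add, map_add, map_add, hx, hy]
    | tmul a x =>
      have h1 : e'.symm (χ.lin (a ⊗ₜ x)) = (show FrobTwist p k R from a) ⊗ₜ ψ.toEnd x := by
        rw [AddEquiv.symm_apply_eq, lin_tmul, h]
        rfl
      have h2 : e.symm (ψ.toEnd x) = (1 : FrobTwist p l R) ⊗ₜ x := by
        rw [AddEquiv.symm_apply_eq]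
        exact (one_smul R _).symm
      rw [h1]
      change twistMap p k l m R E hm (show R from a) (e.symm (ψ.toEnd x)) = _
      rw [h2]
      change (show FrobTwist p m R from (show R from a) * (1 : R) ^ p ^ k) ⊗ₜ[R] x = _
      rw [one_pow, mul_one]
  · obtain ⟨z, rfl⟩ := hφ.2 y
    induction z with
    | zero => exact ⟨0, by simp⟩
    | add x y hx hy =>
      obtain ⟨x', hx⟩ := hx
      obtain ⟨y', hy⟩ := hy
      exact ⟨x' + y', by rw [map_add, map_add, hx, hy]⟩
    | tmul a x =>
      obtain ⟨w, rfl⟩ := hψ.2 x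
      refine ⟨twistMap p k l m R E hm (show R from a) w, ?_⟩
      induction w with
      | zero => simp
      | add x y hx hy => rw [map_add, map_add, hx, hy, map_add, TensorProduct.tmul_add, map_add]
      | tmul b x =>
        change χ.lin ((show FrobTwist p m R from (show R from a) * (show R from b) ^ p ^ k) ⊗ₜ[R] x)
          = _
        rw [lin_tmul, lin_tmul, lin_tmul, φ.map_smul, smul_smul, h]

theorem isUnit_iter {φ : FrobEnd p k R E} (h : φ.IsUnit) (n : ℕ) : (φ.iter n).IsUnit := by
  induction n with
  | zero =>
    refine ⟨Function.LeftInverse.injective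
      (g := fun y => (1 : FrobTwist p (k * 0) R) ⊗ₜ[R] y) (fun z => ?_), fun y => ?_⟩
    · induction z with
      | zero => simp
      | add x y hx hy =>
        have : (1 : FrobTwist p (k * 0) R) ⊗ₜ[R] ((φ.iter 0).lin x + (φ.iter 0).lin y)
          = x + y := by rw [TensorProduct.tmul_add]; exact congrArg₂ _ hx hy
        rw [map_add]; exact this
      | tmul a x =>
        change (1 : FrobTwist p (k * 0) R) ⊗ₜ[R] ((show R from a) • x) = _
        rw [← TensorProduct.smul_tmul, frobTwist_smul]
        congr 1
        change (show R from a) ^ p ^ (k * 0) * (1 : R) = _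
        rw [mul_zero, pow_zero, pow_one, mul_one]
    · exact ⟨(1 : FrobTwist p (k * 0) R) ⊗ₜ[R] y, one_smul R y⟩
  | succ n ih =>
    refine isUnit_of_comp (φ := φ) (ψ := φ.iter n) (by ring) (fun x => ?_) h ih
    change (φ.toEnd ^ (n + 1)) x = φ.toEnd ((φ.toEnd ^ n) x)
    rw [pow_succ']
    rfl

end FrobEnd

/-- An operator of level `k`, as an `R`-linear endomorphism of the twisted `R`-module `R`. -/
def levelLin {P : AddMonoid.End R} (hP : IsLevel p k P) :
    FrobTwist p k R →ₗ[R] FrobTwist p k R where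
  toFun a := P a
  map_add' a b := map_add P a b
  map_smul' r a := hP r a

variable {p k R E}

/-- The conjugate of `P ⊗ id` under the linearization of a unit `p ^ k`-linear endomorphism. -/
noncomputable def FrobEnd.conj (φ : FrobEnd p k R E) (h : φ.IsUnit) {P : AddMonoid.End R}
    (hP : IsLevel p k P) : AddMonoid.End E :=
  φ.lin.comp (((levelLin p k R hP).rTensor E).toAddMonoidHom.comp
    (AddEquiv.ofBijective φ.lin h).symm.toAddMonoidHom)

theorem FrobEnd.conj_apply (φ : FrobEnd p k R E) (h : φ.IsUnit) {P : AddMonoid.End R}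
    (hP : IsLevel p k P) (a : R) (x : E) :
    φ.conj h hP (a • φ.toEnd x) = P a • φ.toEnd x := by
  have : (AddEquiv.ofBijective φ.lin h).symm (a • φ.toEnd x)
      = (show FrobTwist p k R from a) ⊗ₜ x := by
    rw [AddEquiv.symm_apply_eq]; rfl
  change φ.lin ((levelLin p k R hP).rTensor E
    ((AddEquiv.ofBijective φ.lin h).symm (a • φ.toEnd x))) = _
  rw [this]
  rfl

theorem FrobEnd.conj_smul (φ : FrobEnd p k R E) (h : φ.IsUnit) {P : AddMonoid.End R}
    (hP : IsLevel p k P) (a : R) (x : E) :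
    φ.conj h hP (a ^ p ^ k • x) = a ^ p ^ k • φ.conj h hP x := by
  obtain ⟨z, rfl⟩ := h.2 x
  induction z with
  | zero => simp
  | add x y hx hy => rw [map_add, smul_add, map_add, hx, hy, map_add, smul_add]
  | tmul b y =>
    rw [FrobEnd.lin_tmul, smul_smul, φ.conj_apply, φ.conj_apply, smul_smul]
    congr 1
    exact hP a b

/-- The induced action on a unit `F ^ k`-module of an operator `P` that is linear over the
`p ^ m`-th powers for some `m` (in particular of any differential operator): choose `n` such that
`P` is linear over the `p ^ (k * n)`-th powers, and transport `P ⊗ id` through the isomorphism of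
`E` with its `n`-fold Frobenius pullback. -/
noncomputable def FrobEnd.act [NeZero k] (φ : FrobEnd p k R E) (h : φ.IsUnit) (P : AddMonoid.End R)
    (hP : ∃ m, IsLevel p m P) : AddMonoid.End E :=
  (φ.iter (exists_isLevel_mul (k := k) hP).choose).conj (FrobEnd.isUnit_iter h _)
    (exists_isLevel_mul (k := k) hP).choose_spec

/-- The action does not depend on the choice of `n`: it is characterized by this formula. -/
theorem FrobEnd.act_apply [NeZero k] (φ : FrobEnd p k R E) (h : φ.IsUnit) (P : AddMonoid.End R)
    (hP : ∃ m, IsLevel p m P) (n : ℕ) (hn : IsLevel p (k * n) P) (a : R) (x : E) :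
    φ.act h P hP (a • (φ.iter n).toEnd x) = P a • (φ.iter n).toEnd x := by
  have key : ∀ n0 (h0 : IsLevel p (k * n0) P), n0 ≤ n ∨ n ≤ n0 →
      (φ.iter n0).conj (FrobEnd.isUnit_iter h _) h0 (a • (φ.iter n).toEnd x) = P a • (φ.iter n).toEnd x := by
    intro n0 h0 hle
    rcases hle with hle | hle
    · obtain ⟨j, rfl⟩ := Nat.exists_eq_add_of_le hle
      have : (φ.iter (n0 + j)).toEnd x = (φ.iter n0).toEnd ((φ.iter j).toEnd x) := by
        change (φ.toEnd ^ (n0 + j)) x = _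
        rw [pow_add]; rfl
      rw [this, FrobEnd.conj_apply]
    · obtain ⟨j, rfl⟩ := Nat.exists_eq_add_of_le hle
      obtain ⟨z, rfl⟩ := (FrobEnd.isUnit_iter h j).2 x
      induction z with
      | zero => simp
      | add x y hx hy => rw [map_add, map_add, smul_add, map_add, hx, hy, smul_add]
      | tmul b y =>
        rw [FrobEnd.lin_tmul]
        have : (φ.iter n).toEnd ((φ.iter j).toEnd y) = (φ.iter (n + j)).toEnd y := by
          change _ = (φ.toEnd ^ (n + j)) y
          rw [pow_add]; rfl
        rw [(φ.iter n).map_smul, this, smul_smul, FrobEnd.conj_apply, smul_smul]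
        congr 1
        rw [mul_comm a, hn, mul_comm]
  exact key _ _ (le_total _ _)

end FrobModule

/-! ### The ring of locally constant functions on `ℤ_p` -/

section LocConst

variable (p : ℕ) [Fact p.Prime]

/-- The ring of locally constant functions `ℤ_p → 𝔽_p`. -/
abbrev LocConst : Type := LocallyConstant ℤ_[p] (ZMod p)

theorem LocConst.exists_level {p : ℕ} [Fact p.Prime] (c : LocConst p) :
    ∃ m : ℕ, ∀ a b : ℤ_[p], (p : ℤ_[p]) ^ m ∣ a - b → c a = c b := by
  let _ : UniformSpace (ZMod p) := ⊥
  have huc : UniformContinuous c :=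
    CompactSpace.uniformContinuous_of_continuous c.isLocallyConstant.continuous
  have h1 : {q : ℤ_[p] × ℤ_[p] | c q.1 = c q.2} ∈ uniformity ℤ_[p] :=
    huc (show {q : ZMod p × ZMod p | q.1 = q.2} ∈ uniformity (ZMod p) from
      Filter.mem_principal.2 fun q hq => hq)
  obtain ⟨ε, hε, h2⟩ := Metric.mem_uniformity_dist.1 h1
  obtain ⟨m, hm⟩ := PadicInt.exists_pow_neg_lt p hε
  refine ⟨m, fun a b hab => h2 (lt_of_le_of_lt ?_ hm)⟩
  rw [dist_eq_norm, PadicInt.norm_le_pow_iff_mem_span_pow, Ideal.mem_span_singleton]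
  exact hab

/-- `𝔽_p`, regarded as a module over the ring of locally constant functions through evaluation
at `α`. -/
def EvalAt (p : ℕ) [Fact p.Prime] (_α : ℤ_[p]) : Type := ZMod p

instance (α : ℤ_[p]) : CommRing (EvalAt p α) := inferInstanceAs (CommRing (ZMod p))

noncomputable instance (α : ℤ_[p]) : Module (LocConst p) (EvalAt p α) :=
  Module.compHom (ZMod p) (LocallyConstant.evalRingHom α : LocConst p →+* ZMod p)

end LocConst

/-! ### Extending operators to a localized module -/

section LocExt

variable {A : Type*} [CommRing A] (S : Submonoid A) {N : Type*} [AddCommGroup N] [Module A N]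

/-- If `T` commutes with the `q`-th powers of the elements of `S` (`q ≥ 1`), then
`x / s = s ^ (q - 1) x / s ^ q ↦ T (s ^ (q - 1) x) / s ^ q` extends `T` to the localization. -/
noncomputable def locExt (q : ℕ) (hq : 0 < q) (T : AddMonoid.End N)
    (hT : ∀ s : S, ∀ x : N, T (s ^ q • x) = s ^ q • T x) : AddMonoid.End (LocalizedModule S N) :=
  AddMonoidHom.mk'
    (fun z => LocalizedModule.liftOn z
      (fun y => LocalizedModule.mk (T (y.2 ^ (q - 1) • y.1)) (y.2 ^ q)) (by
        rintro ⟨x, s⟩ ⟨x', s'⟩ ⟨u, hu⟩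
        obtain ⟨n, rfl⟩ : ∃ n, q = n + 1 := ⟨q - 1, by omega⟩
        rw [LocalizedModule.mk_eq]
        refine ⟨u ^ (n + 1), ?_⟩
        simp only [Nat.add_sub_cancel] at hu ⊢
        rw [← hT, ← hT, ← hT, ← hT]
        congr 1
        have h1 : u ^ (n + 1) • s' ^ (n + 1) • s ^ n • x = (u * s' * s) ^ n • u • s' • x := by
          simp only [smul_smul]; congr 1
          apply Subtype.ext; push_cast; ring
        have h2 : u ^ (n + 1) • s ^ (n + 1) • s' ^ n • x' = (u * s' * s) ^ n • u • s • x' := by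
          simp only [smul_smul]; congr 1
          apply Subtype.ext; push_cast; ring
        rw [h1, h2, hu]))
    (by
      intro z z'
      induction z, z' using LocalizedModule.induction_on₂ with
      | h x x' s s' =>
        obtain ⟨n, rfl⟩ : ∃ n, q = n + 1 := ⟨q - 1, by omega⟩
        rw [LocalizedModule.mk_add_mk, LocalizedModule.liftOn_mk, LocalizedModule.liftOn_mk,
          LocalizedModule.liftOn_mk, LocalizedModule.mk_add_mk]
        simp only [Nat.add_sub_cancel]
        have h1 : (s * s') ^ n • (s' • x + s • x')
            = s' ^ (n + 1) • s ^ n • x + s ^ (n + 1) • s' ^ n • x' := by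
          rw [smul_add]
          simp only [smul_smul]; congr 2
          · apply Subtype.ext; push_cast; ring
          · apply Subtype.ext; push_cast; ring
        rw [h1, map_add, hT, hT, mul_pow])

theorem locExt_mk (q : ℕ) (hq : 0 < q) (T : AddMonoid.End N)
    (hT : ∀ s : S, ∀ x : N, T (s ^ q • x) = s ^ q • T x) (x : N) (s : S) :
    locExt S q hq T hT (LocalizedModule.mk x s)
      = LocalizedModule.mk (T (s ^ (q - 1) • x)) (s ^ q) := rfl

end LocExt

/-! ### The graph embedding -/

section Graph

variable (p : ℕ) [Fact p.Prime] {R : Type*} [CommRing R] [IsFpRing p R]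
  {E : Type*} [AddCommGroup E] [Module R E]

/-- An additive endomorphism of the `R[t]`-module `E[t]` that is linear over the `p ^ m`-th powers
of the elements of `R[t]`. -/
def IsPolyLevel (m : ℕ) (T : AddMonoid.End (PolynomialModule R E)) : Prop :=
  ∀ (g : R[X]) (y : PolynomialModule R E), T (g ^ p ^ m • y) = g ^ p ^ m • T y

instance : IsFpRing p R[X] :=
  ⟨by rw [← map_natCast (Polynomial.C : R →+* R[X]), IsFpRing.cast_eq_zero, map_zero]⟩

variable {p} in
theorem isPolyLevel_of_gen {m : ℕ} {T : AddMonoid.End (PolynomialModule R E)}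
    (h : ∀ (a : R) (i : ℕ) (j : ℕ) (x : E),
      T (PolynomialModule.single R (i * p ^ m + j) (a ^ p ^ m • x))
        = Polynomial.monomial (i * p ^ m) (a ^ p ^ m) • T (PolynomialModule.single R j x)) :
    IsPolyLevel p m T := by
  intro g y
  induction g using Polynomial.induction_on' with
  | add g g' hg hg' => rw [add_pow_frob, add_smul, map_add, hg, hg', add_smul]
  | monomial i a =>
    rw [Polynomial.monomial_pow]
    induction y using PolynomialModule.induction_linear with
    | zero => simp
    | add y y' hy hy' => rw [smul_add, map_add, hy, hy', map_add, smul_add]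
    | single j x => rw [PolynomialModule.monomial_smul_single, h]

theorem IsPolyLevel.mono {p m n : ℕ} {T : AddMonoid.End (PolynomialModule R E)}
    (h : IsPolyLevel p m T) (hmn : m ≤ n) : IsPolyLevel p n T := by
  intro a b
  obtain ⟨k, rfl⟩ := Nat.exists_eq_add_of_le hmn
  have := h (a ^ p ^ k) b
  rwa [← pow_mul, ← pow_add, add_comm k m] at this

/-- The action on the coefficients of an additive endomorphism of `E`. -/
noncomputable def coeffEnd (T : AddMonoid.End E) : AddMonoid.End (PolynomialModule R E) :=
  (PolynomialModule.coeffAddEquiv (R := R) (M := E)).symm.toAddMonoidHom.comp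
    ((Finsupp.mapRange.addMonoidHom T).comp PolynomialModule.coeffAddEquiv.toAddMonoidHom)

theorem coeffEnd_single (T : AddMonoid.End E) (i : ℕ) (x : E) :
    coeffEnd (R := R) T (PolynomialModule.single R i x) = PolynomialModule.single R i (T x) := by
  change PolynomialModule.ofCoeff R (Finsupp.mapRange T (map_zero T) (Finsupp.single i x)) = _
  rw [Finsupp.mapRange_single]
  rfl

theorem isPolyLevel_coeffEnd {m : ℕ} {T : AddMonoid.End E}
    (h : ∀ (a : R) (x : E), T (a ^ p ^ m • x) = a ^ p ^ m • T x) :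
    IsPolyLevel p m (coeffEnd (R := R) T) := by
  apply isPolyLevel_of_gen
  intro a i j x
  rw [coeffEnd_single, coeffEnd_single, PolynomialModule.monomial_smul_single, h]

/-- The map from `𝔽_p` to an `𝔽_p`-algebra. -/
noncomputable def fpHom (R : Type*) [CommRing R] [IsFpRing p R] : ZMod p →+* R :=
  ZMod.castHom ((CharP.cast_eq_zero_iff R (ringChar R) p).1 IsFpRing.cast_eq_zero) R

/-- The operator `x t ^ i ↦ c (-i - 1) x t ^ i` attached to a locally constant function `c` on
`ℤ_p`. -/
noncomputable def locConstEnd (c : LocConst p) : AddMonoid.End (PolynomialModule R E) :=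
  (PolynomialModule.coeffAddEquiv (R := R) (M := E)).symm.toAddMonoidHom.comp
    ((Finsupp.liftAddHom fun i : ℕ => (Finsupp.singleAddHom i).comp
        (Module.toAddMonoidEnd R E (fpHom p R (c (-(i : ℤ_[p]) - 1))))).comp
      PolynomialModule.coeffAddEquiv.toAddMonoidHom)

theorem locConstEnd_single (c : LocConst p) (i : ℕ) (x : E) :
    locConstEnd p c (PolynomialModule.single R i x)
      = PolynomialModule.single R i (fpHom p R (c (-(i : ℤ_[p]) - 1)) • x) := by
  change PolynomialModule.ofCoeff R (Finsupp.liftAddHom _ (Finsupp.single i x)) = _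
  rw [Finsupp.liftAddHom_apply_single]
  rfl

variable {p} in
theorem isPolyLevel_locConstEnd {m : ℕ} {c : LocConst p}
    (h : ∀ a b : ℤ_[p], (p : ℤ_[p]) ^ m ∣ a - b → c a = c b) :
    IsPolyLevel p m (locConstEnd p c : AddMonoid.End (PolynomialModule R E)) := by
  apply isPolyLevel_of_gen
  intro a i j x
  have : c (-((i * p ^ m + j : ℕ) : ℤ_[p]) - 1) = c (-(j : ℤ_[p]) - 1) :=
    h _ _ ⟨-(i : ℤ_[p]), by push_cast; ring⟩
  rw [locConstEnd_single, locConstEnd_single, PolynomialModule.monomial_smul_single, this,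
    smul_comm]

variable (E)

/-- The multiplicative set of powers of `f - t` in `R[t]`. -/
noncomputable abbrev graphPowers (f : R) : Submonoid R[X] := Submonoid.powers (Polynomial.C f - Polynomial.X)

/-- The pushforward of `E` along the graph embedding of `f`: the quotient
`E[t][(f - t)⁻¹] / E[t]`, i.e. the tensor product of the pullback `E[t]` of `E` to the affine line
with `R[t][(f - t)⁻¹] / R[t]`. -/
def GraphModule (f : R) : Type _ :=
  LocalizedModule (graphPowers f) (PolynomialModule R E) ⧸
    LinearMap.range (LocalizedModule.mkLinearMap (graphPowers f) (PolynomialModule R E))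

noncomputable instance (f : R) : AddCommGroup (GraphModule E f) :=
  inferInstanceAs (AddCommGroup (LocalizedModule (graphPowers f) (PolynomialModule R E) ⧸
    LinearMap.range (LocalizedModule.mkLinearMap (graphPowers f) (PolynomialModule R E))))

variable {E}

/-- The class of the fraction `y / s`, with `y` in `E[t]` and `s` a power of `f - t`. -/
noncomputable def GraphModule.mk (f : R) (y : PolynomialModule R E) (s : graphPowers f) :
    GraphModule E f :=
  Submodule.Quotient.mk (LocalizedModule.mk y s)

/-- The class of `x δ₀ = x / (f - t)`. -/
noncomputable def GraphModule.delta (f : R) (x : E) : GraphModule E f :=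
  GraphModule.mk f (PolynomialModule.single R 0 x) ⟨_, Submonoid.mem_powers _⟩

/-- The operator on `E[t][(f - t)⁻¹] / E[t]` induced by an endomorphism of `E[t]` that is linear
over the `p ^ m`-th powers, i.e. that commutes with `(f - t) ^ (p ^ m)`. -/
noncomputable def graphEnd (f : R) {m : ℕ} {T : AddMonoid.End (PolynomialModule R E)}
    (hT : IsPolyLevel p m T) : AddMonoid.End (GraphModule E f) :=
  QuotientAddGroup.map _ _
    (locExt (graphPowers f) (p ^ m) (pow_pos (Fact.out : p.Prime).pos m) T
      (fun s x => hT (s : R[X]) x)) (by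
    rintro _ ⟨y, rfl⟩
    refine ⟨T y, ?_⟩
    change LocalizedModule.mk (T y) 1 = locExt _ _ _ _ _ (LocalizedModule.mk y 1)
    rw [locExt_mk, one_pow, one_pow, one_smul])

theorem graphEnd_mk (f : R) {m : ℕ} {T : AddMonoid.End (PolynomialModule R E)}
    (hT : IsPolyLevel p m T) (y : PolynomialModule R E) (s : graphPowers f) :
    graphEnd p f hT (GraphModule.mk f y s)
      = GraphModule.mk f (T (s ^ (p ^ m - 1) • y)) (s ^ p ^ m) := rfl

theorem graphEnd_mk_of_le (f : R) {m n : ℕ} {T : AddMonoid.End (PolynomialModule R E)}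
    (hT : IsPolyLevel p m T) (hmn : m ≤ n) (y : PolynomialModule R E) (s : graphPowers f) :
    graphEnd p f hT (GraphModule.mk f y s)
      = GraphModule.mk f (T (s ^ (p ^ n - 1) • y)) (s ^ p ^ n) := by
  rw [graphEnd_mk]
  obtain ⟨k, rfl⟩ := Nat.exists_eq_add_of_le hmn
  have hm : 0 < p ^ m := pow_pos (Fact.out : p.Prime).pos m
  have hk : 0 < p ^ k := pow_pos (Fact.out : p.Prime).pos k
  obtain ⟨b, hb⟩ : ∃ b, p ^ k = b + 1 := ⟨p ^ k - 1, by omega⟩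
  obtain ⟨a, ha⟩ : ∃ a, p ^ m = a + 1 := ⟨p ^ m - 1, by omega⟩
  have h1 : p ^ (m + k) - 1 = b * p ^ m + (p ^ m - 1) := by
    rw [pow_add, hb, ha, Nat.add_sub_cancel, Nat.mul_add, mul_one, ← Nat.add_assoc,
      Nat.add_sub_cancel, mul_comm]
  have h2 : s ^ p ^ (m + k) = (s ^ b) ^ p ^ m * s ^ p ^ m := by
    rw [← pow_mul, ← pow_add, pow_add p, hb]; congr 1; ring
  have h3 : T (s ^ (p ^ (m + k) - 1) • y) = (s ^ b) ^ p ^ m • T (s ^ (p ^ m - 1) • y) := by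
    rw [h1, pow_add, pow_mul, mul_smul]
    exact hT ((s ^ b : graphPowers f) : R[X]) _
  rw [h2, h3]
  exact (congrArg Submodule.Quotient.mk
    (LocalizedModule.mk_cancel_common_left (S := graphPowers f) ((s ^ b) ^ p ^ m) (s ^ p ^ m)
      (T (s ^ (p ^ m - 1) • y)))).symm

theorem GraphModule.induction (f : R) {C : GraphModule E f → Prop}
    (h : ∀ y s, C (GraphModule.mk f y s)) (z : GraphModule E f) : C z := by
  obtain ⟨w, rfl⟩ := Submodule.Quotient.mk_surjective _ z
  induction w using LocalizedModule.induction_on with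
  | h y s => exact h y s

/-- The action of a locally constant function. -/
noncomputable def locConstGraphEnd (f : R) (c : LocConst p) : AddMonoid.End (GraphModule E f) :=
  graphEnd p f (isPolyLevel_locConstEnd c.exists_level.choose_spec)

theorem locConstGraphEnd_mk (f : R) (c : LocConst p) : ∃ m, ∀ n, m ≤ n →
    IsPolyLevel p n (locConstEnd p c : AddMonoid.End (PolynomialModule R E)) ∧
    ∀ (y : PolynomialModule R E) (s : graphPowers f),
    locConstGraphEnd p f c (GraphModule.mk f y s)
      = GraphModule.mk f (locConstEnd p c (s ^ (p ^ n - 1) • y)) (s ^ p ^ n) :=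
  ⟨_, fun _ hn => ⟨(isPolyLevel_locConstEnd c.exists_level.choose_spec).mono hn,
    fun y s => graphEnd_mk_of_le p f _ hn y s⟩⟩

theorem polyEnd_ext {T T' : AddMonoid.End (PolynomialModule R E)}
    (h : ∀ i x, T (PolynomialModule.single R i x) = T' (PolynomialModule.single R i x)) :
    T = T' := by
  ext y : 1
  induction y using PolynomialModule.induction_linear with
  | zero => rw [map_zero, map_zero]
  | add y y' hy hy' => rw [map_add, map_add, hy, hy']
  | single i x => exact h i x

theorem GraphModule.mk_add (f : R) (y y' : PolynomialModule R E) (s : graphPowers f) :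
    GraphModule.mk f (y + y') s = GraphModule.mk f y s + GraphModule.mk f y' s := by
  refine (congrArg Submodule.Quotient.mk ?_ : _ =
    (Submodule.Quotient.mk (LocalizedModule.mk y s + LocalizedModule.mk y' s) : GraphModule E f))
  rw [LocalizedModule.mk_add_mk, ← smul_add, LocalizedModule.mk_cancel_common_left]

/-- The ring homomorphism through which the locally constant functions act on the graph module. -/
noncomputable def locConstHom (f : R) : LocConst p →+* AddMonoid.End (GraphModule E f) where
  toFun := locConstGraphEnd p f
  map_one' := by
    obtain ⟨m, hm⟩ := locConstGraphEnd_mk (E := E) p f 1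
    have h1 : (locConstEnd p 1 : AddMonoid.End (PolynomialModule R E)) = 1 :=
      polyEnd_ext fun i x => by
        rw [locConstEnd_single, LocallyConstant.one_apply, map_one, one_smul]; rfl
    ext z
    induction z using GraphModule.induction with
    | h y s =>
      rw [(hm m le_rfl).2, h1]
      refine congrArg Submodule.Quotient.mk ?_
      have h2 : s ^ p ^ m = s ^ (p ^ m - 1) * s := by
        rw [← pow_succ, Nat.sub_add_cancel (pow_pos (Fact.out : p.Prime).pos m)]
      rw [h2]
      exact LocalizedModule.mk_cancel_common_left _ _ _
  map_zero' := by
    obtain ⟨m, hm⟩ := locConstGraphEnd_mk (E := E) p f 0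
    have h1 : (locConstEnd p 0 : AddMonoid.End (PolynomialModule R E)) = 0 :=
      polyEnd_ext fun i x => by
        rw [locConstEnd_single, LocallyConstant.zero_apply, map_zero, zero_smul,
          PolynomialModule.single_zero]; rfl
    ext z
    induction z using GraphModule.induction with
    | h y s =>
      rw [(hm m le_rfl).2, h1]
      exact congrArg Submodule.Quotient.mk (LocalizedModule.zero_mk _)
  map_add' c d := by
    obtain ⟨m, hm⟩ := locConstGraphEnd_mk (E := E) p f c
    obtain ⟨m', hm'⟩ := locConstGraphEnd_mk (E := E) p f d
    obtain ⟨m'', hm''⟩ := locConstGraphEnd_mk (E := E) p f (c + d)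
    have h1 : (locConstEnd p (c + d) : AddMonoid.End (PolynomialModule R E))
        = locConstEnd p c + locConstEnd p d :=
      polyEnd_ext fun i x => by
        change _ = locConstEnd p c _ + locConstEnd p d _
        rw [locConstEnd_single, locConstEnd_single, locConstEnd_single,
          LocallyConstant.add_apply, map_add, add_smul, PolynomialModule.single_add]
    ext z
    induction z using GraphModule.induction with
    | h y s =>
      change _ = locConstGraphEnd p f c _ + locConstGraphEnd p f d _
      rw [(hm (m + m' + m'') (by omega)).2, (hm' (m + m' + m'') (by omega)).2, (hm'' (m + m' + m'') (by omega)).2, h1]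
      exact GraphModule.mk_add f _ _ _
  map_mul' c d := by
    obtain ⟨m, hm⟩ := locConstGraphEnd_mk (E := E) p f c
    obtain ⟨m', hm'⟩ := locConstGraphEnd_mk (E := E) p f d
    obtain ⟨m'', hm''⟩ := locConstGraphEnd_mk (E := E) p f (c * d)
    have h1 : (locConstEnd p (c * d) : AddMonoid.End (PolynomialModule R E))
        = locConstEnd p c * locConstEnd p d :=
      polyEnd_ext fun i x => by
        rw [AddMonoid.End.coe_mul, Function.comp_apply, locConstEnd_single, locConstEnd_single,
          locConstEnd_single, LocallyConstant.mul_apply, map_mul, mul_smul]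
    ext z
    induction z using GraphModule.induction with
    | h y s =>
      obtain ⟨n, hn⟩ : ∃ n, n = m + m' + m'' := ⟨_, rfl⟩
      rw [AddMonoid.End.coe_mul, Function.comp_apply, (hm' n (by omega)).2,
        (hm n (by omega)).2, (hm'' n (by omega)).2, h1, AddMonoid.End.coe_mul, Function.comp_apply]
      have hq : 0 < p ^ n := pow_pos (Fact.out : p.Prime).pos n
      have h2 : (s ^ p ^ n) ^ (p ^ n - 1) = (s ^ (p ^ n - 1)) ^ p ^ n := by
        rw [← pow_mul, ← pow_mul, mul_comm]
      have h3 : (s ^ p ^ n) ^ p ^ n = (s ^ (p ^ n - 1)) ^ p ^ n * s ^ p ^ n := by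
        rw [← mul_pow, ← pow_succ, Nat.sub_add_cancel hq]
      rw [h2, h3]
      have h4 : ∀ w : PolynomialModule R E, locConstEnd p c ((s ^ (p ^ n - 1)) ^ p ^ n • w)
          = (s ^ (p ^ n - 1)) ^ p ^ n • locConstEnd p c w := fun w =>
        (hm n (by omega)).1 ((s ^ (p ^ n - 1) : graphPowers f) : R[X]) w
      rw [h4]
      exact (congrArg Submodule.Quotient.mk (LocalizedModule.mk_cancel_common_left _ _ _)).symm

noncomputable instance (f : R) : Module (LocConst p) (GraphModule E f) :=
  Module.compHom _ (locConstHom p f : LocConst p →+* AddMonoid.End (GraphModule E f))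

end Graph

/-! ### The modules `N_f(M)`, their specializations, and the finite-level modules -/

section Roots

variable {p : ℕ} [Fact p.Prime] {e : ℕ} [NeZero e] {R : Type*} [CommRing R] [IsFpRing p R]
  {E : Type*} [AddCommGroup E] [Module R E]

namespace FrobEnd

theorem act_smul (φ : FrobEnd p e R E) (h : φ.IsUnit) (P : AddMonoid.End R)
    (hP : ∃ m, IsLevel p m P) (a : R) (x : E) :
    φ.act h P hP (a ^ p ^ (e * (exists_isLevel_mul (k := e) hP).choose) • x)
      = a ^ p ^ (e * (exists_isLevel_mul (k := e) hP).choose) • φ.act h P hP x :=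
  FrobEnd.conj_smul _ _ _ _ _

/-- The action of a differential operator `P` on the graph module: on a fraction whose denominator
is a `p ^ m`-th power, with `m` large, it acts through the coefficients of the numerator. -/
noncomputable def graphAct (φ : FrobEnd p e R E) (h : φ.IsUnit) (f : R) (P : AddMonoid.End R)
    (hP : IsDiffOp P) : AddMonoid.End (GraphModule E f) :=
  graphEnd p f (isPolyLevel_coeffEnd p (φ.act_smul h P (hP.exists_isLevel p)))

/-- `N_f(M)`: the submodule of the graph module generated by `M δ₀` under the actions of
differential operators and of locally constant functions, which commute with each other. -/
noncomputable def graphSubmodule (φ : FrobEnd p e R E) (h : φ.IsUnit) (f : R)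
    (M : Submodule R E) : Submodule (LocConst p) (GraphModule E f) :=
  Submodule.span (LocConst p)
    {z | ∃ (P : AddMonoid.End R) (hP : IsDiffOp P), ∃ x ∈ M,
      z = φ.graphAct h f P hP (GraphModule.delta f x)}

theorem graphSubmodule_mono (φ : FrobEnd p e R E) (h : φ.IsUnit) (f : R) {M M' : Submodule R E}
    (hM : M ≤ M') : φ.graphSubmodule h f M ≤ φ.graphSubmodule h f M' :=
  Submodule.span_mono fun _ ⟨P, hP, x, hx, hz⟩ => ⟨P, hP, x, hM hx, hz⟩

open scoped Pointwise in
theorem smul_le (f : R) (M : Submodule R E) : f • M ≤ M := by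
  rintro _ ⟨x, hx, rfl⟩
  exact M.smul_mem f hx

open scoped Pointwise in
/-- `N_f(f M)_α → N_f(M)_α`, where `N_α` is the tensor product of `N` with `𝔽_p` over the ring of
locally constant functions, through evaluation at `α`. -/
noncomputable def specialize (φ : FrobEnd p e R E) (h : φ.IsUnit) (f : R) (M : Submodule R E)
    (α : ℤ_[p]) :
    EvalAt p α ⊗[LocConst p] φ.graphSubmodule h f (f • M) →ₗ[LocConst p]
      EvalAt p α ⊗[LocConst p] φ.graphSubmodule h f M :=
  LinearMap.lTensor _ (Submodule.inclusion (φ.graphSubmodule_mono h f (smul_le f M)))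

/-- `D ^ (m) · M`: the additive subgroup of `E` generated by the `P x` with `P` an operator of
level `m` and `x` in `M`. -/
noncomputable def levelSpan (φ : FrobEnd p e R E) (h : φ.IsUnit) (m : ℕ) (M : Submodule R E) :
    AddSubgroup E :=
  AddSubgroup.closure {z | ∃ (P : AddMonoid.End R) (hP : IsLevel p m P), ∃ x ∈ M,
    z = φ.act h P ⟨m, hP⟩ x}

end FrobEnd
end Roots

/-! ### Schemes -/

section Scheme

/-- `X` is a scheme over `𝔽_p` (a property of `X`). -/
class IsFpScheme (p : ℕ) (X : Scheme.{u}) : Prop where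
  cast_eq_zero : (p : Γ(X, ⊤)) = 0

instance (p : ℕ) (X : Scheme.{u}) [IsFpScheme p X] (U : X.Opens) : IsFpRing p Γ(X, U) :=
  ⟨by
    rw [← map_natCast (X.presheaf.map (homOfLE (le_top : U ≤ ⊤)).op).hom,
      IsFpScheme.cast_eq_zero, map_zero]⟩

/-- `X` is `F`-finite: its Frobenius endomorphism, which is the identity on the underlying space
and the Frobenius endomorphism on sections, is finite. -/
def FFiniteScheme (p : ℕ) [Fact p.Prime] (X : Scheme.{u}) [IsFpScheme p X] : Prop :=
  ∀ U : X.affineOpens, FFiniteRing p Γ(X, U)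

/-- `X` is regular. -/
def RegularScheme (X : Scheme.{u}) : Prop :=
  ∀ x : X, IsRegularLocalRing (X.presheaf.stalk x)

/-- `X` has an open covering by schemes of finite type over `F`-finite fields of characteristic
`p`. -/
def CoveredByFiniteType (p : ℕ) [Fact p.Prime] (X : Scheme.{u}) : Prop :=
  ∀ x : X, ∃ U : X.Opens, x ∈ U ∧ ∃ (k : Type u) (_ : Field k) (_ : IsFpRing p k)
    (g : U.toScheme ⟶ Spec (.of k)), FFiniteRing p k ∧ LocallyOfFiniteType g ∧ QuasiCompact g

/-- A structure of `𝒪_X[F ^ e]`-module on the `𝒪_X`-module `𝓜`: a compatible family of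
`p ^ e`-linear endomorphisms of the modules of sections. -/
structure FrobeniusModule (p : ℕ) [Fact p.Prime] (e : ℕ) {X : Scheme.{u}} [IsFpScheme p X]
    (𝓜 : X.Modules) where
  frob : ∀ U : X.Opens, FrobEnd p e Γ(X, U) Γ(𝓜, U)
  map_frob : ∀ {U V : X.Opens} (h : V ≤ U) (x : Γ(𝓜, U)),
    𝓜.presheaf.map (homOfLE h).op ((frob U).toEnd x)
      = (frob V).toEnd (𝓜.presheaf.map (homOfLE h).op x)

/-- A coherent `𝒪_X`-submodule of the quasi-coherent `𝒪_X`-module `𝓜` on a Noetherian scheme,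
given by its sections over the affine open subsets: these are finitely generated, and the
sections over a smaller affine open subset are generated by restrictions. -/
structure CoherentSubmodule {X : Scheme.{u}} (𝓜 : X.Modules) where
  sections : ∀ U : X.affineOpens, Submodule Γ(X, U) Γ(𝓜, U)
  fg : ∀ U, (sections U).FG
  span_res : ∀ {U V : X.affineOpens} (h : (V : X.Opens) ≤ U),
    Submodule.span Γ(X, V) ((fun x : Γ(𝓜, U) => 𝓜.presheaf.map (homOfLE h).op x) '' sections U)
      = sections V

variable {p : ℕ} [Fact p.Prime] {e : ℕ} {X : Scheme.{u}} [IsFpScheme p X] {𝓜 : X.Modules}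

namespace FrobeniusModule

/-- The module is unit: the morphism from the Frobenius pullback of `𝓜` to `𝓜` is an isomorphism.
For quasi-coherent `𝓜` this means that it is one on sections over every affine open subset. -/
def IsUnit (F : FrobeniusModule p e 𝓜) : Prop :=
  ∀ U : X.affineOpens, (F.frob U).IsUnit

/-- The module is locally finitely generated as an `𝒪_X[F ^ e]`-module. -/
def IsLocallyFG (F : FrobeniusModule p e 𝓜) : Prop :=
  ∀ x : X, ∃ U : X.affineOpens, x ∈ (U : X.Opens) ∧ ∃ S : Set Γ(𝓜, U), S.Finite ∧
    ∀ N : Submodule Γ(X, U) Γ(𝓜, U), S ⊆ N → (∀ y ∈ N, (F.frob U).toEnd y ∈ N) → N = ⊤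

/-- The sections over `U` of the `n`-fold Frobenius pullback of `M`, as a submodule of `𝓜`: the
`𝒪_X`-submodule generated by `F ^ (e * n) (M)`. -/
noncomputable def pullback (F : FrobeniusModule p e 𝓜) (M : CoherentSubmodule 𝓜) (n : ℕ) (U : X.affineOpens) :
    Submodule Γ(X, U) Γ(𝓜, U) :=
  Submodule.span Γ(X, U) (((F.frob U).iter n).toEnd '' M.sections U)

/-- `M` is a root of the unit module `𝓜`: it is contained in its Frobenius pullback, and `𝓜` is the
union of the iterated Frobenius pullbacks of `M`. -/
def IsRoot (F : FrobeniusModule p e 𝓜) (M : CoherentSubmodule 𝓜) : Prop :=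
  (∀ U, M.sections U ≤ F.pullback M 1 U) ∧
    ∀ (U : X.affineOpens) (x : Γ(𝓜, U)), ∃ n, x ∈ F.pullback M n U

/-- `M` is the minimal root: a root contained in every root. -/
def IsMinimalRoot (F : FrobeniusModule p e 𝓜) (M : CoherentSubmodule 𝓜) : Prop :=
  F.IsRoot M ∧ ∀ M', F.IsRoot M' → ∀ U, M.sections U ≤ M'.sections U

/-- The set of Bernstein--Sato roots of `M` with respect to `f`: the `p`-adic integers `α` such
that `N_f(f M)_α` is a proper submodule of `N_f(M)_α`, i.e. such that the (injective) map from
the first to the second is not surjective over some affine open subset. -/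
def BSR [NeZero e] (F : FrobeniusModule p e 𝓜) (hF : F.IsUnit) (M : CoherentSubmodule 𝓜)
    (f : Γ(X, ⊤)) : Set ℤ_[p] :=
  {α | ∃ U : X.affineOpens, ¬ Function.Surjective
    ((F.frob U).specialize (hF U) (X.presheaf.map (homOfLE (le_top : (U : X.Opens) ≤ ⊤)).op f)
      (M.sections U) α)}

open scoped Pointwise in
/-- The Bernstein--Sato roots of level `m`: the `n` such that `D ^ (m) f ^ (n + 1) M` is a proper
submodule of `D ^ (m) f ^ n M`. -/
def levelBSR [NeZero e] (F : FrobeniusModule p e 𝓜) (hF : F.IsUnit) (M : CoherentSubmodule 𝓜)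
    (f : Γ(X, ⊤)) (m : ℕ) : Set ℕ :=
  {n | ∃ U : X.affineOpens,
    (F.frob U).levelSpan (hF U) m
        ((X.presheaf.map (homOfLE (le_top : (U : X.Opens) ≤ ⊤)).op f) ^ (n + 1) • M.sections U)
      < (F.frob U).levelSpan (hF U) m
        ((X.presheaf.map (homOfLE (le_top : (U : X.Opens) ≤ ⊤)).op f) ^ n • M.sections U)}

/-- The number of roots of level `e * m` in `[0, p ^ (e * m))` is bounded uniformly in `m ≥ 1`. -/
def BoundedLevelBSR [NeZero e] (F : FrobeniusModule p e 𝓜) (hF : F.IsUnit)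
    (M : CoherentSubmodule 𝓜) (f : Γ(X, ⊤)) : Prop :=
  ∃ L : ℕ, ∀ m : ℕ, 1 ≤ m →
    (F.levelBSR hF M f (e * m) ∩ Set.Iio (p ^ (e * m))).encard ≤ L

end FrobeniusModule
end Scheme

end BSRoots

/-!
# Finiteness and rationality of Bernstein--Sato roots of unit Frobenius modules

Let `q = p ^ e`. Over an affine open subset with ring `R` and unit module `E`, every submodule `N` of
`E` has a Frobenius pullback `F^* N` inside `E` (`FrobEnd.pull`). By Kunz's theorem
(`projective_frobTwist`) the ring `R` is finite projective over its `q`-th powers. Hence there is a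
smallest submodule `C N` with `N ⊆ F^* (C N)` (`FrobEnd.cartierSpan`, `FrobEnd.gc_cartierSpan`), it
satisfies `C (a ^ q N) = a (C N)`, and `D ^ (e m) N = F^{m *} (C ^ m N)` (`FrobEnd.coe_levelSpan`). So the
Bernstein--Sato roots of level `e m` are the jumps of the decreasing sequence `a ↦ C ^ m (f ^ a M)`,
and everything reduces to the combinatorics of these jumps.

*Bernstein--Sato roots are limits of jumps.* If the truncation of `α` is not a jump of some level `m`,
it is not one of any higher level. The expansion of `(f - t) ^ (p ^ n - 1)` as the sum of the
`f ^ (p ^ n - 1 - i) t ^ i` identifies the component at `α` modulo `p ^ n` of `P (x δ₀)` with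
`P (f ^ a x)`, where `a` is the truncation of `α`. It follows that `N_f (f M)` and `N_f (M)` have the same
fibre at `α` (`FrobEnd.mem_limitJumps_of_not_surjective`). Finiteness is then a consequence of the
bound on the number of jumps (`finite_of_encard_le`).

*Rationality.* Removing the lowest digit in base `q` maps the jumps of level `m + 1` of `N` onto those
of level `m` of `C N`. If `C N = N`, this makes prolongation by a lowest digit a permutation of the
finite set of limits of jumps, whose elements thus have purely periodic expansions; they are rational
numbers in `[-1, 0]` (`rational_of_mem_limitJumps`). The minimal root `M` satisfies `C M = M`, because
`C M` is again a root (`FrobeniusModule.IsMinimalRoot.cartierSpan_eq`). For an arbitrary root one only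
has `C M ⊆ M`. By the theorem of Hartshorne--Speiser, Lyubeznik and Gabber (`exists_iterate_eq`) the
chain of the `C ^ n M` stabilizes, so that removing finitely many digits leads to the previous case.

*The bound for schemes of finite type.* Over an algebra of finite type over an `F`-finite field, `E` has
a finitely generated submodule `N ⊇ M` with `C N ⊆ N`, and `N` is exhausted by a gauge, an
increasing sequence of finite-dimensional spaces defined by bounding the exponents of monomials. The
generators of `C` divide the gauge by `q` up to a constant (`exists_cartierOp_mem_gauge`). So for
`a ≤ q ^ m` all the modules `C ^ m (f ^ a M)` are generated by elements of a single finite-dimensional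
space, independent of `m`, and its dimension bounds the number of jumps (`exists_encard_jumps_le`).

*Globalization.* The operation `C` commutes with restriction to affine open subsets
(`FrobeniusModule.extend_cartierSpan`). Hence it defines coherent submodules, and jumps can be
computed on a finite affine covering.
-/

set_option linter.unusedSectionVars false

namespace BSRoots

/-! ### Regular local rings and Kunz's theorem -/

section Kunz

open IsLocalRing

theorem IsFpRing.of_ringHom {p : ℕ} {R S : Type*} [CommRing R] [CommRing S] [IsFpRing p R]
    (σ : R →+* S) : IsFpRing p S :=
  ⟨by rw [← map_natCast σ, IsFpRing.cast_eq_zero, map_zero]⟩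

theorem frob_comp_ringHom {p : ℕ} [Fact p.Prime] {R S : Type*} [CommRing R] [CommRing S]
    [IsFpRing p R] [IsFpRing p S] (n : ℕ) (σ : R →+* S) :
    (frob p S n).comp σ = σ.comp (frob p R n) :=
  RingHom.ext fun a => (map_pow σ a _).symm

/-- In a Noetherian local ring of positive dimension some element of the maximal ideal lies neither
in its square nor in a minimal prime. -/
theorem exists_mem_maximalIdeal_avoiding {R : Type*} [CommRing R] [IsLocalRing R]
    [IsNoetherianRing R] (hR : ringKrullDim R ≠ 0) :
    ∃ x ∈ maximalIdeal R, x ∉ maximalIdeal R ^ 2 ∧ ∀ P ∈ minimalPrimes R, x ∉ P := by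
  classical
  have hfin : (minimalPrimes R).Finite := minimalPrimes.finite_of_isNoetherianRing R
  by_contra! H
  have hdim : ∀ P ∈ minimalPrimes R, ¬ maximalIdeal R ≤ P := by
    intro P hP hle
    apply hR
    have hPp : P.IsPrime := hP.1.1
    have hPm : P = maximalIdeal R :=
      le_antisymm (le_maximalIdeal hPp.ne_top) hle
    have : Ring.KrullDimLE 0 R := by
      refine Ring.KrullDimLE.mk₀ fun I hI => ?_
      have : I ≤ P := hPm ▸ le_maximalIdeal hI.ne_top
      have h2 : P ≤ I := hP.2 ⟨hI, bot_le⟩ this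
      rw [le_antisymm this h2, hPm]
      infer_instance
    exact ringKrullDimZero_iff_ringKrullDim_eq_zero.1 this
  have hsub : ((maximalIdeal R : Ideal R) : Set R) ⊆
      ⋃ P ∈ ((insert (maximalIdeal R ^ 2) hfin.toFinset : Finset (Ideal R)) : Set (Ideal R)),
        ((id P : Ideal R) : Set R) := by
    intro x hx
    by_cases h2 : x ∈ maximalIdeal R ^ 2
    · exact Set.mem_biUnion (by simp) h2
    · obtain ⟨P, hP, hxP⟩ := H x hx h2
      exact Set.mem_biUnion (by simp [hP]) hxP
  obtain ⟨P, hP, hle⟩ := (Ideal.subset_union_prime (maximalIdeal R ^ 2) (maximalIdeal R ^ 2)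
    (fun P hP hne _ => by
      rcases Finset.mem_insert.1 hP with h | h
      · exact absurd h hne
      · exact ((hfin.mem_toFinset.1 h).1.1 : P.IsPrime))).1 hsub
  rcases Finset.mem_insert.1 hP with h | h
  · subst h
    have h0 : maximalIdeal R = ⊥ :=
      Submodule.eq_bot_of_le_smul_of_le_jacobson_bot (maximalIdeal R) (maximalIdeal R)
        (IsNoetherian.noetherian _) (by rw [smul_eq_mul, ← pow_two]; exact hle)
        (maximalIdeal_le_jacobson _)
    obtain ⟨Q, hQ⟩ : (minimalPrimes R).Nonempty := by
      obtain ⟨Q, hQ, -⟩ := Ideal.exists_minimalPrimes_le (bot_le : (⊥ : Ideal R) ≤ maximalIdeal R)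
      exact ⟨Q, hQ⟩
    exact hdim Q hQ (h0 ▸ bot_le)
  · exact hdim P (hfin.mem_toFinset.1 h) hle

/-- An element outside the square of the maximal ideal belongs to a generating set of minimal
cardinality, so the maximal ideal of the quotient needs at least one generator less. -/
theorem spanFinrank_maximalIdeal_quotient_lt {R : Type*} [CommRing R] [IsLocalRing R]
    [IsNoetherianRing R] {x : R} (hx : x ∈ maximalIdeal R) (hx2 : x ∉ maximalIdeal R ^ 2)
    [IsLocalRing (R ⧸ Ideal.span {x})] :
    (maximalIdeal (R ⧸ Ideal.span {x})).spanFinrank + 1 ≤ (maximalIdeal R).spanFinrank := by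
  classical
  obtain ⟨S, hScard, hS⟩ := Submodule.FG.exists_span_finset_card_eq_spanFinrank
    (IsNoetherian.noetherian (maximalIdeal R))
  have hSm : ∀ s ∈ S, s ∈ maximalIdeal R := fun s hs => hS ▸ Submodule.subset_span hs
  obtain ⟨a, -, ha⟩ := Submodule.mem_span_finset.1 (hS.symm ▸ hx : x ∈ Submodule.span R (S : Set R))
  obtain ⟨s, hs, has⟩ : ∃ s ∈ S, a s ∉ maximalIdeal R := by
    by_contra! h
    apply hx2
    rw [← ha, pow_two]
    exact Ideal.sum_mem _ fun s hs => Ideal.mul_mem_mul (h s hs) (hSm s hs)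
  obtain ⟨u, hu⟩ : IsUnit (a s) := by simpa using has
  set π := Ideal.Quotient.mk (Ideal.span {x})
  have hπx : π x = 0 := Ideal.Quotient.eq_zero_iff_mem.2 (Ideal.mem_span_singleton_self x)
  have hmax : maximalIdeal (R ⧸ Ideal.span {x})
      = Submodule.span (R ⧸ Ideal.span {x}) (π '' (S.erase s : Finset R)) := by
    have h1 : maximalIdeal (R ⧸ Ideal.span {x}) = (maximalIdeal R).map π := by
      have := IsLocalRing.of_surjective' π Ideal.Quotient.mk_surjective
      have hloc : IsLocalHom π := .of_surjective π Ideal.Quotient.mk_surjective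
      refine le_antisymm (fun y hy => ?_) ?_
      · obtain ⟨r, rfl⟩ := Ideal.Quotient.mk_surjective y
        refine Ideal.mem_map_of_mem _ ?_
        by_contra hr
        have : IsUnit r := by simpa using hr
        exact (mem_maximalIdeal _).1 hy (this.map π)
      · rw [Ideal.map_le_iff_le_comap]
        intro r hr hur
        exact (mem_maximalIdeal _).1 hr (isUnit_of_map_unit π r hur)
    have h2 : (maximalIdeal R).map π = Ideal.span (π '' (S : Set R)) := by
      rw [← hS]; exact Ideal.map_span _ _
    rw [h1, h2]
    refine le_antisymm (Ideal.span_le.2 ?_) (Ideal.span_mono (Set.image_mono (by simp)))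
    rintro _ ⟨t, ht, rfl⟩
    by_cases hts : t = s
    · subst hts
      have h3 : x = a t * t + ∑ r ∈ S.erase t, a r * r := by
        rw [← ha, ← Finset.add_sum_erase _ _ hs]
        rfl
      have h4 : π t = - (π ↑u⁻¹ * ∑ r ∈ S.erase t, π (a r) * π r) := by
        have h5 := congrArg π h3
        rw [hπx, map_add, map_mul, map_sum, ← hu] at h5
        simp only [map_mul] at h5
        have h6 : π ↑u⁻¹ * π ↑u = 1 := by rw [← map_mul]; simp
        linear_combination (- π ↑u⁻¹) * h5 - π t * h6
      rw [h4]
      refine Submodule.neg_mem _ (Ideal.mul_mem_left _ _ (Ideal.sum_mem _ fun r hr =>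
        Ideal.mul_mem_left _ _ (Ideal.subset_span ⟨r, hr, rfl⟩)))
    · exact Ideal.subset_span ⟨t, by simp [hts, Finset.mem_coe.1 ht], rfl⟩
  have hfin : (π '' ((S.erase s : Finset R) : Set R)).Finite := (Finset.finite_toSet _).image _
  rw [hmax]
  calc _ ≤ (π '' ((S.erase s : Finset R) : Set R)).ncard + 1 :=
        Nat.add_le_add_right (Submodule.spanFinrank_span_le_ncard_of_finite hfin) 1
    _ ≤ (S.erase s).card + 1 := by
        refine Nat.add_le_add_right ?_ 1
        have := Set.ncard_image_le (f := π) (Finset.finite_toSet (S.erase s))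
        rwa [Set.ncard_coe_finset] at this
    _ = _ := by rw [Finset.card_erase_add_one hs, hScard]

/-- Dividing a regular local ring by an element of the maximal ideal outside its square yields a
regular local ring of dimension one less. -/
theorem isRegularLocalRing_quotient {R : Type*} [CommRing R] [IsRegularLocalRing R] {x : R}
    (hx : x ∈ maximalIdeal R) (hx2 : x ∉ maximalIdeal R ^ 2) :
    IsRegularLocalRing (R ⧸ Ideal.span {x}) ∧
      ringKrullDim (R ⧸ Ideal.span {x}) + 1 = ringKrullDim R := by
  have hne : Nontrivial (R ⧸ Ideal.span {x}) :=
    Ideal.Quotient.nontrivial_iff.2 (ne_top_of_le_ne_top (maximalIdeal.isMaximal R).ne_top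
      ((Ideal.span_singleton_le_iff_mem _).2 hx))
  have hloc : IsLocalRing (R ⧸ Ideal.span {x}) :=
    IsLocalRing.of_surjective' (Ideal.Quotient.mk (Ideal.span {x})) Ideal.Quotient.mk_surjective
  have h1 := spanFinrank_maximalIdeal_quotient_lt hx hx2
  have h2 := ringKrullDim_le_spanFinrank_maximalIdeal (R ⧸ Ideal.span {x})
  have h3 : ringKrullDim R ≤ ringKrullDim (R ⧸ Ideal.span {x}) + 1 := by
    have := ringKrullDim_le_ringKrullDim_quotient_add_encard (R := R) {x} (by
      simpa [IsLocalRing.ringJacobson_eq_maximalIdeal] using hx)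
    rwa [Set.encard_singleton] at this
  have h4 := IsRegularLocalRing.spanFinrank_maximalIdeal (R := R)
  have h5 : ((maximalIdeal (R ⧸ Ideal.span {x})).spanFinrank : WithBot ℕ∞) + 1
      ≤ ringKrullDim R := by rw [← h4]; exact_mod_cast h1
  have h6 : ((maximalIdeal (R ⧸ Ideal.span {x})).spanFinrank : WithBot ℕ∞)
      ≤ ringKrullDim (R ⧸ Ideal.span {x}) := by
    have h7 := h5.trans h3
    generalize ringKrullDim (R ⧸ Ideal.span {x}) = D at *
    generalize (maximalIdeal (R ⧸ Ideal.span {x})).spanFinrank = k at *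
    obtain ⟨j, rfl⟩ : ∃ j : ℕ, D = j := by
      induction D with
      | bot => simp at h7
      | coe D =>
        induction D with
        | top => exact absurd h2 (by exact_mod_cast not_le.2 (WithBot.coe_lt_coe.2 (ENat.natCast_lt_top k)))
        | coe j => exact ⟨j, rfl⟩
    have : k + 1 ≤ j + 1 := by exact_mod_cast h7
    exact_mod_cast (show k ≤ j by omega)
  refine ⟨.of_spanFinrank_maximalIdeal_le _ h6, le_antisymm ?_ h3⟩
  exact (add_le_add_left h2 1).trans h5

theorem finite_frob {p : ℕ} [Fact p.Prime] {R : Type*} [CommRing R] [IsFpRing p R]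
    (h : FFiniteRing p R) (n : ℕ) : (frob p R n).Finite := by
  induction n with
  | zero =>
    refine RingHom.Finite.of_surjective _ fun a => ⟨a, ?_⟩
    change a ^ p ^ 0 = a
    simp
  | succ n ih =>
    have : frob p R (n + 1) = (frob p R 1).comp (frob p R n) := by
      ext a
      change a ^ p ^ (n + 1) = (a ^ p ^ n) ^ p ^ 1
      rw [← pow_mul, ← pow_add]
    rw [this]
    exact h.comp ih

/-- If the images of `b` form a basis of `R / x` over its `p ^ n`-th powers, where `x` is a nonzero
element of the maximal ideal of the Noetherian local domain `R`, then the products `x ^ i * b j`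
with `i < p ^ n` form a basis of `R` over its `p ^ n`-th powers. Both generation and independence
follow from Nakayama's lemma for the ideal `(x)`, applied to the cokernel and to the kernel of the
corresponding map `Φ` from a free module. -/
theorem free_frobTwist_of_quotient {p : ℕ} [Fact p.Prime] {R : Type*} [CommRing R] [IsFpRing p R]
    [IsDomain R] [IsLocalRing R] [IsNoetherianRing R] (n : ℕ)
    (hfin : Module.Finite R (FrobTwist p n R)) {x : R} (hx : x ∈ maximalIdeal R) (hx0 : x ≠ 0)
    [IsFpRing p (R ⧸ Ideal.span {x})] {ι : Type*} [Fintype ι]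
    (b : Module.Basis ι (R ⧸ Ideal.span {x}) (FrobTwist p n (R ⧸ Ideal.span {x}))) :
    Module.Free R (FrobTwist p n R) := by
  set π := Ideal.Quotient.mk (Ideal.span {x}) with hπ
  have hπ0 : ∀ r, π r = 0 ↔ x ∣ r := fun r => by
    rw [hπ, Ideal.Quotient.eq_zero_iff_mem, Ideal.mem_span_singleton]
  choose c hc using fun j => Ideal.Quotient.mk_surjective (show R ⧸ Ideal.span {x} from b j)
  have hbspan : ∀ r : R, ∃ a : ι → R, x ∣ r - ∑ j, a j ^ p ^ n * c j := by
    intro r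
    choose a ha using fun j => Ideal.Quotient.mk_surjective
      (b.repr (show FrobTwist p n (R ⧸ Ideal.span {x}) from π r) j)
    refine ⟨a, ?_⟩
    rw [← hπ0, map_sub, sub_eq_zero, map_sum]
    have h1 := b.sum_repr (show FrobTwist p n (R ⧸ Ideal.span {x}) from π r)
    refine (h1.symm.trans (Finset.sum_congr rfl fun j _ => ?_))
    rw [frobTwist_smul, map_mul, map_pow, ha, hc]
  have hbind : ∀ a : ι → R, x ∣ ∑ j, a j ^ p ^ n * c j → ∀ j, x ∣ a j := by
    intro a ha
    have h1 : ∑ j, π (a j) • b j = 0 := by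
      refine Eq.trans (Finset.sum_congr rfl fun j _ => ?_)
        ((map_sum π _ _).symm.trans ((hπ0 _).2 ha))
      rw [frobTwist_smul, map_mul, map_pow, hc]
    intro j
    exact (hπ0 _).1 (Fintype.linearIndependent_iff.1 b.linearIndependent _ h1 j)
  set q := p ^ n with hq
  have hq0 : 0 < q := pow_pos (Fact.out : p.Prime).pos n
  let Φ : (Fin q × ι → R) →ₗ[R] FrobTwist p n R :=
    Fintype.linearCombination R (fun ij : Fin q × ι => (show FrobTwist p n R from
      x ^ (ij.1 : ℕ) * c ij.2))
  have hΦ : ∀ a, Φ a = (show FrobTwist p n R from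
      ∑ i : Fin q, ∑ j, x ^ (i : ℕ) * (a (i, j) ^ q * c j)) := by
    intro a
    refine (Fintype.linearCombination_apply ..).trans
      ((Fintype.sum_prod_type _).trans ?_)
    refine Finset.sum_congr rfl fun i _ => Finset.sum_congr rfl fun j _ => ?_
    rw [frobTwist_smul]
    change a (i, j) ^ q * (x ^ (i : ℕ) * c j) = _
    ring
  have hjac : Ideal.span {x} ≤ (⊥ : Ideal R).jacobson :=
    ((Ideal.span_singleton_le_iff_mem _).2 hx).trans (maximalIdeal_le_jacobson _)
  have hsurj : LinearMap.range Φ = ⊤ := by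
    refine top_le_iff.1 (Submodule.le_of_le_smul_of_le_jacobson_bot hfin.fg_top hjac ?_)
    -- Every element can be expanded in powers of `x` up to a remainder divisible by `x ^ q = x • 1`.
    have key : ∀ k ≤ q, ∀ r : R, ∃ a, ∃ s : R, r = (show R from Φ a) + x ^ k * s := by
      intro k
      induction k with
      | zero => exact fun _ r => ⟨0, r, by rw [map_zero]; simp; exact (zero_add r).symm⟩
      | succ k ih =>
        intro hk r
        obtain ⟨a, s, hr⟩ := ih (by omega) r
        obtain ⟨a', d, hd⟩ := hbspan s
        refine ⟨a + fun ij => if ij.1 = ⟨k, hk⟩ then a' ij.2 else 0, d, ?_⟩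
        have h1 : Φ (fun ij => if ij.1 = ⟨k, hk⟩ then a' ij.2 else 0)
            = (show FrobTwist p n R from x ^ k * ∑ j, a' j ^ q * c j) := by
          rw [hΦ]
          change (∑ i : Fin q, ∑ j, _ : R) = x ^ k * ∑ j, a' j ^ q * c j
          rw [Finset.sum_eq_single ⟨k, hk⟩]
          · simp [Finset.mul_sum]
          · intro i _ hi
            refine Finset.sum_eq_zero fun j _ => ?_
            simp [hi, hq0.ne']
          · simp
        rw [map_add, h1, hr]
        change ((show R from Φ a) + x ^ k * s) = (show R from Φ a) + (x ^ k * ∑ j, a' j ^ q * c j) + x ^ (k + 1) * d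
        linear_combination x ^ k * hd
    intro r _
    obtain ⟨a, s, hr⟩ := key q le_rfl r
    have : r = Φ a + x • (show FrobTwist p n R from s) := hr
    rw [this]
    exact Submodule.add_mem_sup ⟨a, rfl⟩
      (Submodule.smul_mem_smul (Ideal.mem_span_singleton_self x) trivial)
  have hinj : LinearMap.ker Φ = ⊥ := by
    refine Submodule.eq_bot_of_le_smul_of_le_jacobson_bot _ _ (IsNoetherian.noetherian _) ?_ hjac
    intro a ha
    -- The coefficients of a relation are divisible by `x`, by comparing powers of `x` for increasing `i`.
    have key : ∀ k : ℕ, ∀ i : Fin q, (i : ℕ) < k → ∀ j, x ∣ a (i, j) := by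
      intro k
      induction k with
      | zero => intro i hi; omega
      | succ k ih =>
        intro i hi
        rcases Nat.lt_succ_iff_lt_or_eq.1 hi with hi | hi
        · exact ih i hi
        have h0 : (∑ i : Fin q, ∑ j, x ^ (i : ℕ) * (a (i, j) ^ q * c j) : R) = 0 :=
          (hΦ a).symm.trans ha
        rw [← Finset.add_sum_erase _ _ (Finset.mem_univ i), ← Finset.mul_sum] at h0
        have h1 : x ^ (k + 1) ∣ ∑ i ∈ Finset.univ.erase i, ∑ j, x ^ (i : ℕ) * (a (i, j) ^ q * c j) := by
          refine Finset.dvd_sum fun i' hi' => Finset.dvd_sum fun j _ => ?_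
          rcases lt_trichotomy (i' : ℕ) (i : ℕ) with h | h | h
          · obtain ⟨d, hd⟩ := ih i' (hi ▸ h) j
            rw [hd, mul_pow]
            have : x ^ (k + 1) ∣ x ^ q := pow_dvd_pow _ (hi ▸ i.2)
            exact Dvd.dvd.mul_left (this.mul_right _ |>.mul_right _) _
          · exact absurd (Fin.ext h) (Finset.ne_of_mem_erase hi')
          · exact (pow_dvd_pow x (hi ▸ h)).mul_right _
        have h2 : x ^ (k + 1) ∣ x ^ (i : ℕ) * ∑ j, a (i, j) ^ q * c j :=
          (dvd_add_left h1).1 (h0 ▸ dvd_zero _)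
        rw [hi, pow_succ] at h2
        exact hbind _ ((mul_dvd_mul_iff_left (pow_ne_zero k hx0)).1 h2)
    choose d hd using fun ij : Fin q × ι => key q ij.1 ij.1.2 ij.2
    have had : a = x • d := funext hd
    have hd0 : d ∈ LinearMap.ker Φ := by
      rw [LinearMap.mem_ker]
      have h1 : x • Φ d = 0 := by rw [← map_smul, ← had]; exact ha
      rw [frobTwist_smul] at h1
      exact (mul_eq_zero.1 (show x ^ p ^ n * (show R from Φ d) = 0 from h1)).resolve_left
        (pow_ne_zero _ hx0)
    rw [had]
    exact Submodule.smul_mem_smul (Ideal.mem_span_singleton_self x) hd0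
  exact Module.Free.of_equiv (LinearEquiv.ofBijective Φ
    ⟨LinearMap.ker_eq_bot.1 hinj, LinearMap.range_eq_top.1 hsurj⟩)

/-- A regular local ring of characteristic `p` is a domain and, if it is `F`-finite, free over its
`p ^ n`-th powers. The proof is by induction on the dimension, dividing by an element `x` that is part
of a regular system of parameters and lies in no minimal prime: then a minimal prime contained in the
prime ideal `(x)` is zero by Nakayama's lemma. -/
theorem isDomain_and_free_frobTwist {p : ℕ} [Fact p.Prime] (n d : ℕ) :
    ∀ (R : Type u) [CommRing R] [IsFpRing p R] [IsRegularLocalRing R], ringKrullDim R = d →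
      (frob p R n).Finite → IsDomain R ∧ Module.Free R (FrobTwist p n R) := by
  induction d with
  | zero =>
    intro R _ _ _ hd hfin
    have hR : IsField R := by
      rw [← finrank_cotangentSpace_eq_zero_iff]
      have := (IsRegularLocalRing.iff_finrank_cotangentSpace R).1 inferInstance
      rw [hd] at this
      exact_mod_cast this
    let _ := hR.toField
    exact ⟨inferInstance, inferInstance⟩
  | succ d ih =>
    intro R _ _ _ hd hfin
    obtain ⟨x, hx, hx2, hxP⟩ := exists_mem_maximalIdeal_avoiding (R := R) (by
      rw [hd]; exact_mod_cast Nat.succ_ne_zero d)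
    obtain ⟨hreg, hdim⟩ := isRegularLocalRing_quotient hx hx2
    set π := Ideal.Quotient.mk (Ideal.span {x}) with hπ
    have hFp : IsFpRing p (R ⧸ Ideal.span {x}) := .of_ringHom π
    have hfin' : (frob p (R ⧸ Ideal.span {x}) n).Finite := by
      refine RingHom.Finite.of_comp_finite (f := π) ?_
      rw [frob_comp_ringHom]
      exact (RingHom.Finite.of_surjective π Ideal.Quotient.mk_surjective).comp hfin
    obtain ⟨hdom, hfree⟩ := ih (R ⧸ Ideal.span {x}) (by
      rw [hd] at hdim
      generalize ringKrullDim (R ⧸ Ideal.span {x}) = D at *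
      induction D with
      | bot => exact absurd hdim.symm (by simp)
      | coe D =>
        have h1 : D + 1 = ((d + 1 : ℕ) : ℕ∞) := by exact_mod_cast hdim
        induction D with
        | top => exact absurd h1 (by simpa using (ENat.natCast_ne_top (d + 1)).symm)
        | coe j => rw [show j = d from Nat.succ_injective (by exact_mod_cast h1)]; rfl) hfin'
    have hprime : (Ideal.span {x}).IsPrime := (Ideal.Quotient.isDomain_iff_prime _).1 hdom
    have hR : IsDomain R := by
      obtain ⟨Q, hQ, hQx⟩ := Ideal.exists_minimalPrimes_le (bot_le : ⊥ ≤ Ideal.span {x})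
      have hQp : Q.IsPrime := hQ.1.1
      have h0 : Q = ⊥ := by
        refine Submodule.eq_bot_of_le_smul_of_le_jacobson_bot (Ideal.span {x}) Q
          (IsNoetherian.noetherian _) (fun y hy => ?_)
          (((Ideal.span_singleton_le_iff_mem _).2 hx).trans (maximalIdeal_le_jacobson _))
        obtain ⟨z, rfl⟩ := Ideal.mem_span_singleton.1 (hQx hy)
        exact Submodule.smul_mem_smul (Ideal.mem_span_singleton_self x)
          ((hQp.mem_or_mem hy).resolve_left (hxP Q hQ))
      rw [h0] at hQp
      exact (IsDomain.of_bot_isPrime R)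
    refine ⟨hR, ?_⟩
    have : Module.Finite (R ⧸ Ideal.span {x}) (FrobTwist p n (R ⧸ Ideal.span {x})) := hfin'
    refine free_frobTwist_of_quotient n hfin hx (fun h => hx2 (h ▸ zero_mem _))
      (Module.Free.chooseBasis (R ⧸ Ideal.span {x}) (FrobTwist p n (R ⧸ Ideal.span {x})))

theorem frobTwist_unit_smul_cancel {p : ℕ} [Fact p.Prime] {R : Type*} [CommRing R] [IsFpRing p R]
    (n : ℕ) {a : R} (ha : IsUnit a) {b c : FrobTwist p n R} (h : a • b = a • c) : b = c :=
  (ha.smul_left_cancel).1 h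

/-- **Kunz's theorem** (the direction that regularity implies flatness): an `F`-finite regular
Noetherian ring is finite projective over its `p ^ n`-th powers. Projectivity is checked at maximal
ideals, where the local case applies. -/
theorem projective_frobTwist {p : ℕ} [Fact p.Prime] (n : ℕ) (R : Type u) [CommRing R]
    [IsFpRing p R] [IsRegularRing R] (hfin : (frob p R n).Finite) :
    Module.Projective R (FrobTwist p n R) := by
  have : Module.Finite R (FrobTwist p n R) := hfin
  have hFp (P : Ideal R) [P.IsMaximal] : IsFpRing p (Localization.AtPrime P) :=
    .of_ringHom (algebraMap R _)
  let instM (P : Ideal R) [P.IsMaximal] : Module R (FrobTwist p n (Localization.AtPrime P)) :=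
    Module.compHom _ (algebraMap R (Localization.AtPrime P))
  have instT (P : Ideal R) [P.IsMaximal] :
      IsScalarTower R (Localization.AtPrime P) (FrobTwist p n (Localization.AtPrime P)) :=
    .of_algebraMap_smul fun _ _ => rfl
  let g (P : Ideal R) [P.IsMaximal] :
      FrobTwist p n R →ₗ[R] FrobTwist p n (Localization.AtPrime P) :=
    { toFun := fun a => algebraMap R (Localization.AtPrime P) a
      map_add' := fun a b => map_add (algebraMap R (Localization.AtPrime P)) _ _
      map_smul' := fun r a => by
        refine (map_mul (algebraMap R (Localization.AtPrime P)) (r ^ p ^ n) (show R from a)).trans ?_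
        rw [map_pow]
        rfl }
  have hloc (P : Ideal R) [P.IsMaximal] : IsLocalizedModule P.primeCompl (g P) := by
    refine ⟨fun s => ?_, fun y => ?_, fun {x y} hxy => ?_⟩
    · have hu : IsUnit (algebraMap R (Localization.AtPrime P) s) := IsLocalization.map_units _ s
      rw [Module.End.isUnit_iff]
      refine ⟨fun a b hab => frobTwist_unit_smul_cancel n hu hab, fun b => ?_⟩
      obtain ⟨u, hu⟩ := hu
      refine ⟨(show FrobTwist p n (Localization.AtPrime P) from
        (↑(u⁻¹) : Localization.AtPrime P) ^ p ^ n * (show Localization.AtPrime P from b)), ?_⟩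
      change algebraMap R (Localization.AtPrime P) s ^ p ^ n * (_ * _) = _
      rw [← hu, ← mul_assoc, ← mul_pow, Units.mul_inv, one_pow, one_mul]
    · obtain ⟨⟨a, s⟩, h⟩ := IsLocalization.surj P.primeCompl (show Localization.AtPrime P from y)
      have hq : p ^ n = (p ^ n - 1) + 1 :=
        (Nat.sub_add_cancel (pow_pos (Fact.out : p.Prime).pos n)).symm
      refine ⟨((show FrobTwist p n R from a * (s : R) ^ (p ^ n - 1)), s), ?_⟩
      change algebraMap R (Localization.AtPrime P) s ^ p ^ n * _
        = algebraMap R (Localization.AtPrime P) (a * (s : R) ^ (p ^ n - 1))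
      rw [map_mul, ← h, map_pow, hq, pow_succ]
      exact (fun v w => by rw [Nat.add_sub_cancel]; ring :
        ∀ v w : Localization.AtPrime P, v ^ (p ^ n - 1 + 1 - 1) * v * w
          = w * v * v ^ (p ^ n - 1 + 1 - 1)) _ _
    · obtain ⟨c, hc⟩ := (IsLocalization.eq_iff_exists P.primeCompl (Localization.AtPrime P)).1
        (show algebraMap R (Localization.AtPrime P) x = algebraMap R (Localization.AtPrime P) y from hxy)
      have hq : p ^ n = (p ^ n - 1) + 1 :=
        (Nat.sub_add_cancel (pow_pos (Fact.out : p.Prime).pos n)).symm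
      refine ⟨c, ?_⟩
      change (c : R) ^ p ^ n * (show R from x) = (c : R) ^ p ^ n * (show R from y)
      rw [hq, pow_succ, mul_assoc, mul_assoc]
      exact congrArg _ hc
  refine @Module.projective_of_localization_maximal' R (FrobTwist p n R) _ _ _
    (fun P _ => Localization.AtPrime P) _ _ _ (fun P _ => FrobTwist p n (Localization.AtPrime P))
    _ (fun P _ => instM P) (fun P _ => inferInstance) (fun P _ => instT P) (fun P _ => g P)
    (fun P _ => hloc P) (fun P hP => ?_) (Module.finitePresentation_of_finite R _)
  have hfinP : (frob p (Localization.AtPrime P) n).Finite := by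
    have h1 : Module.Finite (Localization.AtPrime P) (FrobTwist p n (Localization.AtPrime P)) :=
      Module.Finite.of_isLocalizedModule P.primeCompl (g P)
    exact h1
  obtain ⟨d, hd⟩ : ∃ d : ℕ, ringKrullDim (Localization.AtPrime P) = d :=
    ⟨_, (IsRegularLocalRing.spanFinrank_maximalIdeal (R := Localization.AtPrime P)).symm⟩
  have := (isDomain_and_free_frobTwist n d _ hd hfinP).2
  infer_instance

end Kunz

/-! ### Frobenius pullbacks of submodules and the adjoint operation -/

section Cartier

open scoped Pointwise

variable {p : ℕ} [Fact p.Prime] {k : ℕ} {R : Type*} [CommRing R] [IsFpRing p R]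
  {E : Type*} [AddCommGroup E] [Module R E]

/-- If `R` is finite projective over its `p ^ k`-th powers, there is a dual basis, that is, there are elements
`b j` and `p ^ (-k)`-linear maps `l j` with `a = ∑ j, (l j a) ^ (p ^ k) * b j` for all `a`. -/
theorem exists_frobTwist_dualBasis (p : ℕ) [Fact p.Prime] (k : ℕ) (R : Type*) [CommRing R]
    [IsFpRing p R] [Module.Finite R (FrobTwist p k R)] [Module.Projective R (FrobTwist p k R)] :
    ∃ (n : ℕ) (b : Fin n → R) (l : Fin n → FrobTwist p k R →ₗ[R] R),
      ∀ a : R, a = ∑ j, (l j (show FrobTwist p k R from a)) ^ p ^ k * b j := by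
  obtain ⟨n, f, g, -, -, hfg⟩ := Module.Finite.exists_comp_eq_id_of_projective R (FrobTwist p k R)
  refine ⟨n, fun j => (show R from f (Pi.single j 1)), fun j => LinearMap.proj j ∘ₗ g, fun a => ?_⟩
  have h1 : f (g (show FrobTwist p k R from a)) = (show FrobTwist p k R from a) :=
    LinearMap.congr_fun hfg _
  have h2 := f.pi_apply_eq_sum_univ (g (show FrobTwist p k R from a))
  refine (h1.symm.trans h2).trans (Finset.sum_congr rfl fun j _ => ?_)
  rw [frobTwist_smul]
  have h3 : (fun i => if j = i then (1 : R) else 0) = Pi.single j 1 := by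
    funext i
    simp [Pi.single_apply, eq_comm]
  rw [h3]
  rfl

namespace FrobEnd

/-- The Frobenius pullback of a submodule of a unit module, as a submodule of the latter: the
submodule generated by the image under the Frobenius action. -/
def pull (φ : FrobEnd p k R E) (N : Submodule R E) : Submodule R E :=
  Submodule.span R (φ.toEnd '' N)

theorem pull_mono (φ : FrobEnd p k R E) : Monotone φ.pull := fun _ _ h =>
  Submodule.span_mono (Set.image_mono h)

theorem smul_mem_pull (φ : FrobEnd p k R E) {N : Submodule R E} (a : R) {x : E} (hx : x ∈ N) :
    a • φ.toEnd x ∈ φ.pull N :=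
  Submodule.smul_mem _ _ (Submodule.subset_span ⟨x, hx, rfl⟩)

theorem pull_induction (φ : FrobEnd p k R E) {N : Submodule R E} {C : E → Prop} {y : E}
    (hy : y ∈ φ.pull N) (h0 : C 0) (hadd : ∀ y z, C y → C z → C (y + z))
    (h : ∀ (a : R), ∀ x ∈ N, C (a • φ.toEnd x)) : C y := by
  refine Submodule.closure_induction (p := fun y _ => C y) h0 (fun y z _ _ => hadd y z) ?_
    hy
  rintro a _ ⟨x, hx, rfl⟩
  exact h a x hx

theorem pull_top (φ : FrobEnd p k R E) (h : φ.IsUnit) : φ.pull ⊤ = ⊤ := by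
  refine top_le_iff.1 fun y _ => ?_
  obtain ⟨z, rfl⟩ := h.2 y
  induction z with
  | zero => simp
  | add x y hx hy => rw [map_add]; exact Submodule.add_mem _ (hx trivial) (hy trivial)
  | tmul a x => exact φ.smul_mem_pull (show R from a) trivial

/-- A unit module is generated by the image of the Frobenius action. -/
theorem unit_induction (φ : FrobEnd p k R E) (h : φ.IsUnit) {C : E → Prop} (h0 : C 0)
    (hadd : ∀ y z, C y → C z → C (y + z)) (hC : ∀ (a : R) x, C (a • φ.toEnd x)) (y : E) : C y :=
  φ.pull_induction (N := ⊤) (by rw [φ.pull_top h]; trivial) h0 hadd fun a x _ => hC a x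

theorem pull_iter_zero (φ : FrobEnd p k R E) (N : Submodule R E) : (φ.iter 0).pull N = N := by
  have : ((φ.iter 0).toEnd : E → E) '' N = N := by
    change (id : E → E) '' N = N
    simp
  rw [pull, this, Submodule.span_eq]

theorem pull_iter_succ (φ : FrobEnd p k R E) (n : ℕ) (N : Submodule R E) :
    (φ.iter (n + 1)).pull N = φ.pull ((φ.iter n).pull N) := by
  have hs (x : E) : (φ.iter (n + 1)).toEnd x = φ.toEnd ((φ.iter n).toEnd x) := by
    change (φ.toEnd ^ (n + 1)) x = φ.toEnd ((φ.toEnd ^ n) x)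
    rw [pow_succ']; rfl
  refine le_antisymm (Submodule.span_le.2 ?_) (Submodule.span_le.2 ?_)
  · rintro _ ⟨x, hx, rfl⟩
    rw [hs]
    exact Submodule.subset_span ⟨_, Submodule.subset_span ⟨x, hx, rfl⟩, rfl⟩
  · rintro _ ⟨y, hy, rfl⟩
    refine (φ.iter n).pull_induction (C := fun y => φ.toEnd y ∈ (φ.iter (n + 1)).pull N) hy
      (by simp) (fun y z hy hz => ?_) fun a x hx => ?_
    · rw [map_add]; exact Submodule.add_mem _ hy hz
    · rw [φ.map_smul, ← hs]
      exact (φ.iter (n + 1)).smul_mem_pull _ hx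

theorem pull_iter (φ : FrobEnd p k R E) (n : ℕ) : (φ.iter n).pull = φ.pull^[n] := by
  induction n with
  | zero => ext1 N; exact φ.pull_iter_zero N
  | succ n ih => ext1 N; rw [φ.pull_iter_succ, ih, Function.iterate_succ_apply']

/-- The action on a unit module of a `p ^ (-k)`-linear map `l : R → R`: it sends `a • φ x` to
`l a • x`. -/
noncomputable def cartierOp (φ : FrobEnd p k R E) (h : φ.IsUnit) (l : FrobTwist p k R →ₗ[R] R) :
    E →+ E :=
  ((TensorProduct.lid R E).toLinearMap ∘ₗ l.rTensor E).toAddMonoidHom.comp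
    (AddEquiv.ofBijective φ.lin h).symm.toAddMonoidHom

theorem cartierOp_apply (φ : FrobEnd p k R E) (h : φ.IsUnit) (l : FrobTwist p k R →ₗ[R] R)
    (a : R) (x : E) :
    φ.cartierOp h l (a • φ.toEnd x) = l (show FrobTwist p k R from a) • x := by
  have : (AddEquiv.ofBijective φ.lin h).symm (a • φ.toEnd x)
      = (show FrobTwist p k R from a) ⊗ₜ x := by
    rw [AddEquiv.symm_apply_eq]; rfl
  change TensorProduct.lid R E (l.rTensor E
    ((AddEquiv.ofBijective φ.lin h).symm (a • φ.toEnd x))) = _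
  rw [this, LinearMap.rTensor_tmul, TensorProduct.lid_tmul]

theorem cartierOp_pow_smul (φ : FrobEnd p k R E) (h : φ.IsUnit) (l : FrobTwist p k R →ₗ[R] R)
    (a : R) (y : E) : φ.cartierOp h l (a ^ p ^ k • y) = a • φ.cartierOp h l y := by
  induction y using φ.unit_induction h with
  | h0 => simp
  | hadd y z hy hz => rw [smul_add, map_add, hy, hz, map_add, smul_add]
  | hC b x =>
    rw [smul_smul, cartierOp_apply, cartierOp_apply, smul_smul]
    congr 1
    exact l.map_smul a (show FrobTwist p k R from b)

/-- A dual basis expresses an element of a unit module through its images under the `cartierOp`s. -/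
theorem eq_sum_cartierOp (φ : FrobEnd p k R E) (h : φ.IsUnit) {n : ℕ} {b : Fin n → R}
    {l : Fin n → FrobTwist p k R →ₗ[R] R}
    (hbl : ∀ a : R, a = ∑ j, (l j (show FrobTwist p k R from a)) ^ p ^ k * b j) (y : E) :
    y = ∑ j, b j • φ.toEnd (φ.cartierOp h (l j) y) := by
  induction y using φ.unit_induction h with
  | h0 => simp
  | hadd y z hy hz =>
    simp only [map_add, smul_add, Finset.sum_add_distrib]
    rw [← hy, ← hz]
  | hC a x =>
    simp only [cartierOp_apply, φ.map_smul, smul_smul]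
    rw [← Finset.sum_smul]
    congr 1
    exact (hbl a).trans (Finset.sum_congr rfl fun j _ => mul_comm _ _)

/-- The submodule generated by the images of `N` under all `p ^ (-k)`-linear maps. If `E = R`
and `N` is an ideal, this is the ideal often written `N ^ [1 / p ^ k]`. -/
noncomputable def cartierSpan (φ : FrobEnd p k R E) (h : φ.IsUnit) (N : Submodule R E) :
    Submodule R E :=
  Submodule.span R {z | ∃ l, ∃ y ∈ N, z = φ.cartierOp h l y}

theorem cartierOp_mem (φ : FrobEnd p k R E) (h : φ.IsUnit) {N : Submodule R E}
    (l : FrobTwist p k R →ₗ[R] R) {y : E} (hy : y ∈ N) :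
    φ.cartierOp h l y ∈ φ.cartierSpan h N :=
  Submodule.subset_span ⟨l, y, hy, rfl⟩

theorem cartierSpan_mono (φ : FrobEnd p k R E) (h : φ.IsUnit) : Monotone (φ.cartierSpan h) :=
  fun _ _ hN => Submodule.span_mono fun _ ⟨l, y, hy, hz⟩ => ⟨l, y, hN hy, hz⟩

/-- The defining property of `cartierSpan N`: it is the smallest submodule whose Frobenius pullback
contains `N`. -/
theorem gc_cartierSpan (φ : FrobEnd p k R E) (h : φ.IsUnit) [Module.Finite R (FrobTwist p k R)]
    [Module.Projective R (FrobTwist p k R)] : GaloisConnection (φ.cartierSpan h) φ.pull := by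
  intro N N'
  constructor
  · intro hle y hy
    obtain ⟨n, b, l, hbl⟩ := exists_frobTwist_dualBasis p k R
    rw [φ.eq_sum_cartierOp h hbl y]
    exact Submodule.sum_mem _ fun j _ => φ.smul_mem_pull _ (hle (φ.cartierOp_mem h _ hy))
  · intro hle
    refine Submodule.span_le.2 ?_
    rintro _ ⟨l, y, hy, rfl⟩
    refine φ.pull_induction (C := fun y => φ.cartierOp h l y ∈ N') (hle hy) (by simp)
      (fun y z hy hz => ?_) fun a x hx => ?_
    · rw [map_add]; exact Submodule.add_mem _ hy hz
    · rw [cartierOp_apply]; exact Submodule.smul_mem _ _ hx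

theorem cartierSpan_pow_smul (φ : FrobEnd p k R E) (h : φ.IsUnit) (a : R) (N : Submodule R E) :
    φ.cartierSpan h (a ^ p ^ k • N) = a • φ.cartierSpan h N := by
  refine le_antisymm (Submodule.span_le.2 ?_) ?_
  · rintro _ ⟨l, _, ⟨y, hy, rfl⟩, rfl⟩
    exact ⟨_, φ.cartierOp_mem h l hy, (φ.cartierOp_pow_smul h l a y).symm⟩
  · rw [cartierSpan, Submodule.smul_span]
    refine Submodule.span_le.2 ?_
    rintro _ ⟨_, ⟨l, y, hy, rfl⟩, rfl⟩
    change a • φ.cartierOp h l y ∈ _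
    rw [← cartierOp_pow_smul]
    exact φ.cartierOp_mem h l ⟨y, hy, rfl⟩

/-- A dual basis turns generators of `N` into generators of `cartierSpan N`. -/
theorem cartierSpan_span (φ : FrobEnd p k R E) (h : φ.IsUnit) {n : ℕ} {b : Fin n → R}
    {l : Fin n → FrobTwist p k R →ₗ[R] R}
    (hbl : ∀ a : R, a = ∑ j, (l j (show FrobTwist p k R from a)) ^ p ^ k * b j) (Y : Set E) :
    φ.cartierSpan h (Submodule.span R Y)
      = Submodule.span R {z | ∃ j, ∃ y ∈ Y, z = φ.cartierOp h (l j) y} := by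
  refine le_antisymm (Submodule.span_le.2 ?_) (Submodule.span_mono ?_)
  · rintro _ ⟨l', y, hy, rfl⟩
    refine Submodule.closure_induction (p := fun y _ => φ.cartierOp h l' y ∈ Submodule.span R _)
      (by simp) (fun y z _ _ hy hz => ?_) (fun a y hy => ?_) hy
    · rw [map_add]; exact Submodule.add_mem _ hy hz
    · have h1 : φ.cartierOp h l' (a • y) = ∑ j, l' (show FrobTwist p k R from a * b j) •
          φ.cartierOp h (l j) y := by
        conv_lhs => rw [φ.eq_sum_cartierOp h hbl y, Finset.smul_sum, map_sum]
        refine Finset.sum_congr rfl fun j _ => ?_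
        rw [smul_smul, cartierOp_apply]
      rw [h1]
      exact Submodule.sum_mem _ fun j _ => Submodule.smul_mem _ _
        (Submodule.subset_span ⟨j, y, hy, rfl⟩)
  · rintro _ ⟨j, y, hy, rfl⟩
    exact ⟨l j, y, Submodule.subset_span hy, rfl⟩

theorem cartierSpan_fg (φ : FrobEnd p k R E) (h : φ.IsUnit) [Module.Finite R (FrobTwist p k R)]
    [Module.Projective R (FrobTwist p k R)] {N : Submodule R E} (hN : N.FG) :
    (φ.cartierSpan h N).FG := by
  obtain ⟨n, b, l, hbl⟩ := exists_frobTwist_dualBasis p k R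
  obtain ⟨Y, rfl⟩ := hN
  rw [φ.cartierSpan_span h hbl]
  refine Submodule.fg_span (((Set.finite_range
    (fun jy : Fin n × Y => φ.cartierOp h (l jy.1) jy.2))).subset ?_)
  rintro _ ⟨j, y, hy, rfl⟩
  exact ⟨(j, ⟨y, hy⟩), rfl⟩

theorem cartierSpan_iter (φ : FrobEnd p k R E) (h : φ.IsUnit)
    (hfin : ∀ n, Module.Finite R (FrobTwist p n R))
    (hproj : ∀ n, Module.Projective R (FrobTwist p n R)) (n : ℕ) :
    (φ.iter n).cartierSpan (isUnit_iter h n) = (φ.cartierSpan h)^[n] := by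
  have h1 := (φ.iter n).gc_cartierSpan (isUnit_iter h n)
  have h2 : GaloisConnection (φ.cartierSpan h)^[n] φ.pull^[n] := by
    clear h1
    induction n with
    | zero => exact GaloisConnection.id
    | succ n ih =>
      rw [Function.iterate_succ, Function.iterate_succ']
      exact (φ.gc_cartierSpan h).compose ih
  rw [φ.pull_iter] at h1
  exact funext fun N => h1.l_unique h2 fun _ => rfl

/-! ### Modules over the operators of finite level -/

/-- The additive map `r ↦ a * l r ^ (p ^ k)`, an operator of level `k`. -/
def powOp (a : R) (l : FrobTwist p k R →ₗ[R] R) : AddMonoid.End R :=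
  AddMonoidHom.mk' (fun r => a * l (show FrobTwist p k R from r) ^ p ^ k) fun r s => by
    change a * l ((show FrobTwist p k R from r) + (show FrobTwist p k R from s)) ^ p ^ k = _
    rw [map_add, add_pow_frob, mul_add]

theorem isLevel_powOp (a : R) (l : FrobTwist p k R →ₗ[R] R) : IsLevel p k (powOp a l) := by
  intro s r
  have : l (show FrobTwist p k R from s ^ p ^ k * r) = s * l (show FrobTwist p k R from r) :=
    l.map_smul s (show FrobTwist p k R from r)
  change a * l _ ^ p ^ k = s ^ p ^ k * (a * l _ ^ p ^ k)
  rw [this, mul_pow]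
  ring

/-- The module over the operators of level `k * n` generated by `N` is the `n`-fold Frobenius
pullback of the `n`-fold `cartierSpan` of `N`. -/
theorem coe_levelSpan [NeZero k] (φ : FrobEnd p k R E) (h : φ.IsUnit)
    (hfin : ∀ n, Module.Finite R (FrobTwist p n R))
    (hproj : ∀ n, Module.Projective R (FrobTwist p n R)) (n : ℕ) (N : Submodule R E) :
    (φ.levelSpan h (k * n) N : Set E) = φ.pull^[n] ((φ.cartierSpan h)^[n] N) := by
  have hu := isUnit_iter h n
  rw [← φ.pull_iter, ← φ.cartierSpan_iter h hfin hproj]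
  refine Set.Subset.antisymm (fun y hy => ?_) (fun y hy => ?_)
  · have hle : N ≤ (φ.iter n).pull ((φ.iter n).cartierSpan hu N) :=
      ((φ.iter n).gc_cartierSpan hu).le_u_l N
    refine AddSubgroup.closure_induction (p := fun y _ => y ∈ (φ.iter n).pull
      ((φ.iter n).cartierSpan hu N)) ?_ (Submodule.zero_mem _) (fun _ _ _ _ => Submodule.add_mem _)
      (fun _ _ => Submodule.neg_mem _) hy
    rintro _ ⟨P, hP, x, hx, rfl⟩
    refine (φ.iter n).pull_induction (C := fun y => φ.act h P ⟨_, hP⟩ y ∈ (φ.iter n).pull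
      ((φ.iter n).cartierSpan hu N)) (hle hx) (by simp) (fun y z hy hz => ?_) fun a x hx => ?_
    · rw [map_add]; exact Submodule.add_mem _ hy hz
    · rw [φ.act_apply h P _ n hP]
      exact (φ.iter n).smul_mem_pull _ hx
  · refine (φ.iter n).pull_induction hy (zero_mem (φ.levelSpan h (k * n) N))
      (fun _ _ => add_mem (S := AddSubgroup E)) fun a x hx => ?_
    revert a
    refine Submodule.closure_induction (p := fun x _ => ∀ a : R, a • (φ.iter n).toEnd x ∈
      (φ.levelSpan h (k * n) N : Set E)) (fun a => ?_) (fun y z _ _ hy hz a => ?_) ?_ hx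
    · rw [map_zero, smul_zero]; exact zero_mem (φ.levelSpan h (k * n) N)
    · rw [map_add, smul_add]; exact add_mem (S := AddSubgroup E) (hy a) (hz a)
    · rintro r _ ⟨l, y, hy, rfl⟩ a
      rw [(φ.iter n).map_smul, smul_smul]
      refine AddSubgroup.subset_closure ⟨powOp (a * r ^ p ^ (k * n)) l, isLevel_powOp _ _, y, hy, ?_⟩
      clear hy
      induction y using (φ.iter n).unit_induction hu with
      | h0 => simp
      | hadd y z hy hz =>
        rw [map_add, map_add, map_add, smul_add, hy, hz]
      | hC b x =>
        rw [φ.act_apply h _ _ n (isLevel_powOp _ _), cartierOp_apply, (φ.iter n).map_smul, smul_smul]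
        rfl

/-- Inclusions between modules over the operators of level `k * n` are inclusions between iterated
`cartierSpan`s, because pulling back by Frobenius reflects inclusions of the latter. -/
theorem levelSpan_le_iff [NeZero k] (φ : FrobEnd p k R E) (h : φ.IsUnit)
    (hfin : ∀ n, Module.Finite R (FrobTwist p n R))
    (hproj : ∀ n, Module.Projective R (FrobTwist p n R)) (n : ℕ) (N N' : Submodule R E) :
    φ.levelSpan h (k * n) N ≤ φ.levelSpan h (k * n) N' ↔
      (φ.cartierSpan h)^[n] N ≤ (φ.cartierSpan h)^[n] N' := by
  have h1 : φ.levelSpan h (k * n) N ≤ φ.levelSpan h (k * n) N' ↔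
      φ.pull^[n] ((φ.cartierSpan h)^[n] N) ≤ φ.pull^[n] ((φ.cartierSpan h)^[n] N') := by
    rw [← SetLike.coe_subset_coe, φ.coe_levelSpan h hfin hproj, φ.coe_levelSpan h hfin hproj,
      SetLike.coe_subset_coe]
  rw [h1, ← φ.pull_iter, ← φ.cartierSpan_iter h hfin hproj]
  have gc := (φ.iter n).gc_cartierSpan (isUnit_iter h n)
  exact ⟨fun hle => gc.l_le (gc.le_u_l N |>.trans hle), fun hle => (φ.iter n).pull_mono hle⟩

end FrobEnd

end Cartier

/-! ### Stabilization of the iterates of a `q⁻¹`-linear operation -/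

section Stabilization

open scoped Pointwise

theorem isArtinian_span_of_annihilated {A V : Type*} [CommRing A] [AddCommGroup V] [Module A V]
    (J : Ideal A) [IsArtinianRing (A ⧸ J)] {Y : Set V} (hY : Y.Finite)
    (h : ∀ y ∈ Y, ∀ a ∈ J, a • y = 0) : IsArtinian A (Submodule.span A Y) := by
  have hA : IsArtinian A (A ⧸ J) :=
    isArtinian_of_surjective_algebraMap (S := A) (R := A ⧸ J) (M := A ⧸ J)
      Ideal.Quotient.mk_surjective
  rw [← Y.iUnion_of_singleton_coe, Submodule.span_iUnion]
  have := hY.to_subtype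
  have hy (y : Y) : IsArtinian A (Submodule.span A {(y : V)}) := by
    let g : A ⧸ J →ₗ[A] V := Submodule.liftQ J (LinearMap.toSpanSingleton A V y) fun a ha => by
      rw [LinearMap.mem_ker, LinearMap.toSpanSingleton_apply, h y y.2 a ha]
    have : Submodule.span A {(y : V)} = LinearMap.range g := by
      rw [Submodule.range_liftQ, LinearMap.range_toSpanSingleton]
    rw [this]
    infer_instance
  infer_instance

/-- The terms of the sequence have bounded length modulo `J • N 0`, because `A ⧸ J` is Artinian and
`N 0` is finitely generated. -/
theorem exists_eq_succ_of_antitone {A V : Type*} [CommRing A] [AddCommGroup V] [Module A V]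
    (J : Ideal A) [IsArtinianRing (A ⧸ J)] {N : ℕ → Submodule A V} (hN : Antitone N)
    (hfg : (N 0).FG) (hJ : ∀ n, J • N 0 ≤ N n) : ∃ n, N n = N (n + 1) := by
  obtain ⟨Y, hY⟩ := hfg
  set K := J • N 0 with hK
  have hart : IsArtinian A ((N 0).map K.mkQ) := by
    rw [← hY, Submodule.map_span]
    refine isArtinian_span_of_annihilated J ((Finset.finite_toSet Y).image _) ?_
    rintro _ ⟨y, hy, rfl⟩ a ha
    rw [← map_smul]
    exact (Submodule.Quotient.mk_eq_zero K).2
      (Submodule.smul_mem_smul ha (hY ▸ Submodule.subset_span hy))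
  let g : ℕ →o (Submodule A ((N 0).map K.mkQ))ᵒᵈ :=
    ⟨fun n => OrderDual.toDual (((N n).map K.mkQ).comap ((N 0).map K.mkQ).subtype),
      fun i j hij => Submodule.comap_mono (Submodule.map_mono (hN hij))⟩
  obtain ⟨n, hn⟩ := IsArtinian.monotone_stabilizes g
  refine ⟨n, ?_⟩
  have h1 : ((N n).map K.mkQ).comap ((N 0).map K.mkQ).subtype
      = ((N (n + 1)).map K.mkQ).comap ((N 0).map K.mkQ).subtype := hn (n + 1) (Nat.le_succ n)
  have h2 (i : ℕ) : (((N i).map K.mkQ).comap ((N 0).map K.mkQ).subtype).map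
      ((N 0).map K.mkQ).subtype = (N i).map K.mkQ := by
    rw [Submodule.map_comap_subtype, inf_eq_right]
    exact Submodule.map_mono (hN (Nat.zero_le i))
  have h3 : (N n).map K.mkQ = (N (n + 1)).map K.mkQ := by rw [← h2, h1, h2]
  have h4 (i : ℕ) : ((N i).map K.mkQ).comap K.mkQ = N i := by
    rw [Submodule.comap_map_mkQ, sup_eq_right]
    exact hJ i
  rw [← h4 n, h3, h4]

/-- At a minimal prime of `I`, the ideal `I ^ 2` is primary to the maximal ideal. -/
theorem isArtinianRing_localization_quotient {R : Type*} [CommRing R] [IsNoetherianRing R]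
    {I P : Ideal R} [hP : P.IsPrime] (hPI : P ∈ I.minimalPrimes) :
    IsArtinianRing (Localization.AtPrime P ⧸
      (I ^ 2).map (algebraMap R (Localization.AtPrime P))) := by
  set A := Localization.AtPrime P
  set J := (I ^ 2).map (algebraMap R A) with hJ
  rw [isArtinianRing_iff_krullDimLE_zero]
  refine Ring.KrullDimLE.mk₀ fun Q hQ => ⟨⟨hQ.ne_top, fun K hK => ?_⟩⟩
  have hQ1 : (Q.comap (Ideal.Quotient.mk J)).IsPrime := inferInstance
  have hQ2 : ((Q.comap (Ideal.Quotient.mk J)).comap (algebraMap R A)).IsPrime := inferInstance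
  have hI : I ≤ (Q.comap (Ideal.Quotient.mk J)).comap (algebraMap R A) := by
    refine hQ2.le_of_pow_le (n := 2) fun a ha => ?_
    rw [Ideal.mem_comap, Ideal.mem_comap,
      Ideal.Quotient.eq_zero_iff_mem.2 (Ideal.mem_map_of_mem (algebraMap R A) ha)]
    exact zero_mem _
  have hle : (Q.comap (Ideal.Quotient.mk J)).comap (algebraMap R A) ≤ P :=
    (Ideal.comap_mono (IsLocalRing.le_maximalIdeal hQ1.ne_top)).trans_eq
      Localization.AtPrime.under_maximalIdeal
  have hPle := hPI.2 ⟨hQ2, hI⟩ hle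
  have hmax : IsLocalRing.maximalIdeal A ≤ Q.comap (Ideal.Quotient.mk J) := by
    rw [← Localization.AtPrime.map_eq_maximalIdeal]
    exact Ideal.map_le_iff_le_comap.2 hPle
  obtain ⟨z, hzK, hzQ⟩ := Set.exists_of_ssubset hK
  obtain ⟨a, rfl⟩ := Ideal.Quotient.mk_surjective z
  have hu : IsUnit a := by
    by_contra h
    exact hzQ (hmax ((IsLocalRing.mem_maximalIdeal a).2 h))
  exact Ideal.eq_top_of_isUnit_mem _ hzK (hu.map _)

variable {R : Type*} [CommRing R] {E : Type*} [AddCommGroup E] [Module R E]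

theorem smul_mono_right' (a : R) {N N' : Submodule R E} (h : N ≤ N') : a • N ≤ a • N' :=
  Submodule.map_mono h

theorem iterate_le_of_le {C : Submodule R E → Submodule R E} (hmono : Monotone C)
    {M : Submodule R E} (hM : C M ≤ M) : Antitone fun n => C^[n] M :=
  antitone_nat_of_succ_le fun n => by
    rw [Function.iterate_succ_apply]
    exact (hmono.iterate n) hM

/-- Let `C` be a monotone `q⁻¹`-linear operation on submodules. For a finitely generated
submodule `M` with `C M ≤ M` the chain of the `C ^ n M` stabilizes (Hartshorne--Speiser, Lyubeznik,
Gabber). The ideals `I n` of elements that multiply `C ^ n M` into `C ^ (n + 1) M` increase, so they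
are eventually equal to some `I`; then `I ^ 2` multiplies `C ^ n M` into all later terms. At a
minimal prime of `I` the chain would therefore be an infinite chain of distinct submodules of a
module of finite length. -/
theorem exists_iterate_eq {C : Submodule R E → Submodule R E} [IsNoetherianRing R]
    (hmono : Monotone C) {q : ℕ} (hq : 2 ≤ q)
    (hC : ∀ (a : R) N, C (a ^ q • N) = a • C N) {M : Submodule R E} (hfg : ∀ n, (C^[n] M).FG)
    (hM : C M ≤ M) : ∃ n, C (C^[n] M) = C^[n] M := by
  classical
  have hanti := iterate_le_of_le hmono hM
  have hmem : ∀ n a, a ∈ (C^[n + 1] M).colon (C^[n] M : Set E) ↔ a • C^[n] M ≤ C^[n + 1] M :=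
    fun n a => Submodule.mem_colon.trans
      ⟨fun h => by rintro _ ⟨x, hx, rfl⟩; exact h x hx, fun h x hx => h ⟨x, hx, rfl⟩⟩
  let I : ℕ →o Ideal R := ⟨fun n => (C^[n + 1] M).colon (C^[n] M : Set E),
    monotone_nat_of_le_succ fun n a ha => by
      rw [hmem] at ha ⊢
      rw [Function.iterate_succ_apply' C n, ← hC, Function.iterate_succ_apply' C (n + 1)]
      refine hmono (le_trans ?_ ha)
      obtain ⟨j, rfl⟩ : ∃ j, q = j + 1 := ⟨q - 1, by omega⟩
      rw [pow_succ', mul_smul]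
      exact smul_mono_right' a (FrobEnd.smul_le _ _)⟩
  obtain ⟨n₀, hn₀⟩ := monotone_stabilizes_iff_noetherian.2 (inferInstance : IsNoetherianRing R) I
  by_contra! hne
  have hI : I n₀ ≠ ⊤ := by
    intro h
    have h1 : (1 : R) ∈ I n₀ := by rw [h]; trivial
    have h2 := (hmem n₀ 1).1 h1
    rw [one_smul, Function.iterate_succ_apply'] at h2
    refine hne n₀ (le_antisymm ?_ h2)
    rw [← Function.iterate_succ_apply' C]
    exact hanti (Nat.le_succ n₀)
  obtain ⟨P, hP⟩ := (I n₀).nonempty_minimalPrimes hI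
  have hPp : P.IsPrime := hP.1.1
  set N : ℕ → Submodule R E := fun n => C^[n₀ + n] M with hN
  have hNs : ∀ n, N (n + 1) = C (N n) := fun n => Function.iterate_succ_apply' C (n₀ + n) M
  have hsq : ∀ n, I n₀ ^ 2 • N 0 ≤ N n := by
    intro n
    induction n with
    | zero => exact Submodule.smul_le_right
    | succ n ih =>
      rw [pow_two, Submodule.mul_smul]
      refine Submodule.smul_le.2 fun a ha x hx => ?_
      have h1 : x ∈ N 1 := by
        refine (Submodule.smul_le.2 (fun b hb y hy => ?_) : I n₀ • N 0 ≤ N 1) hx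
        exact (hmem n₀ b).1 hb ⟨y, hy, rfl⟩
      rw [hNs] at h1 ⊢
      have h2 : a • C (N 0) ≤ C (N n) := by
        rw [← hC]
        refine hmono (le_trans ?_ ih)
        rintro _ ⟨y, hy, rfl⟩
        obtain ⟨j, rfl⟩ : ∃ j, q = j + 2 := ⟨q - 2, by omega⟩
        refine Submodule.smul_mem_smul ?_ hy
        rw [pow_add]
        exact Ideal.mul_mem_left _ _ (Ideal.pow_mem_pow ha 2)
      exact h2 ⟨x, h1, rfl⟩
  set A := Localization.AtPrime P
  set g := LocalizedModule.mkLinearMap P.primeCompl E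
  have hart := isArtinianRing_localization_quotient hP
  obtain ⟨n, hn⟩ := exists_eq_succ_of_antitone ((I n₀ ^ 2).map (algebraMap R A))
    (N := fun n => (N n).localized' A P.primeCompl g)
    (fun i j hij => (Submodule.localized'gi A P.primeCompl g).gc.monotone_l
      (hanti (Nat.add_le_add_left hij n₀)))
    (by
      obtain ⟨Y, hY⟩ := hfg n₀
      have : N 0 = Submodule.span R (Y : Set E) := hY.symm
      rw [this, Submodule.localized'_span]
      exact Submodule.fg_span ((Finset.finite_toSet Y).image _))
    (fun n => by
      refine Submodule.smul_le.2 fun a ha x hx => ?_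
      have h1 : ∀ b ∈ I n₀ ^ 2, ∀ x ∈ (N 0).localized' A P.primeCompl g,
          algebraMap R A b • x ∈ (N n).localized' A P.primeCompl g := by
        rintro b hb _ ⟨y, hy, s, rfl⟩
        rw [algebraMap_smul, ← IsLocalizedModule.mk'_smul]
        exact ⟨_, hsq n (Submodule.smul_mem_smul hb hy), s, rfl⟩
      refine Submodule.span_induction (p := fun a _ => ∀ x ∈ (N 0).localized' A P.primeCompl g,
        a • x ∈ (N n).localized' A P.primeCompl g) ?_ ?_ ?_ ?_ ha x hx
      · rintro _ ⟨b, hb, rfl⟩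
        exact h1 b hb
      · intro x _; rw [zero_smul]; exact zero_mem _
      · intro a b _ _ ha hb x hx; rw [add_smul]; exact add_mem (ha x hx) (hb x hx)
      · intro c a _ ha x hx; rw [smul_eq_mul, mul_smul]; exact Submodule.smul_mem _ _ (ha x hx))
  -- Hence some element outside `P` multiplies `N n` into `N (n + 1)`.
  obtain ⟨Y, hY⟩ := hfg (n₀ + n)
  have hex : ∀ y ∈ N n, ∃ s ∈ P.primeCompl, s • y ∈ N (n + 1) := by
    intro y hy
    have h1 : g y ∈ (N (n + 1)).localized' A P.primeCompl g := by
      rw [← hn]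
      exact ⟨y, hy, 1, IsLocalizedModule.mk'_one _ _ _⟩
    obtain ⟨z, hz, s, h2⟩ := h1
    rw [IsLocalizedModule.mk'_eq_iff] at h2
    have h3 : g z = g ((s : R) • y) := by rw [map_smul, h2]; rfl
    obtain ⟨c, hc⟩ := (IsLocalizedModule.eq_iff_exists P.primeCompl g).1 h3
    refine ⟨c * s, mul_mem c.2 s.2, ?_⟩
    rw [mul_smul]
    change (c : R) • z = (c : R) • ((s : R) • y) at hc
    rw [← hc]
    exact Submodule.smul_mem _ _ hz
  have hYN : ∀ y ∈ Y, y ∈ N n := fun y hy => by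
    change y ∈ C^[n₀ + n] M
    rw [← hY]; exact Submodule.subset_span hy
  choose! s hs hsy using hex
  have hprod : ∏ y ∈ Y, s y ∈ P.primeCompl := prod_mem fun y hy => hs y (hYN y hy)
  have h5 : ∏ y ∈ Y, s y ∈ I (n₀ + n) := by
    rw [show I (n₀ + n) = _ from rfl]
    refine (hmem _ _).2 ?_
    have h6 : C^[n₀ + n] M ≤ (N (n + 1)).comap (DistribSMul.toLinearMap R E (∏ y ∈ Y, s y)) := by
      conv_lhs => rw [← hY]
      refine Submodule.span_le.2 fun y hy => ?_
      change (∏ y ∈ Y, s y) • y ∈ N (n + 1)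
      rw [← Finset.prod_erase_mul _ _ hy, mul_smul]
      exact Submodule.smul_mem _ _ (hsy y (hYN y hy))
    rintro _ ⟨y, hy, rfl⟩
    exact h6 hy
  rw [← hn₀ (n₀ + n) (Nat.le_add_right _ _)] at h5
  exact hprod (hP.1.2 h5)

end Stabilization

/-! ### Jumps -/

section Jumps

open scoped Pointwise

variable {R : Type*} [CommRing R] {E : Type*} [AddCommGroup E] [Module R E]
  {C : Submodule R E → Submodule R E} {q : ℕ} {f : R}

/-- The exponents `a` at which the decreasing sequence of the `C ^ m (f ^ a N)` jumps. -/
def jumps (C : Submodule R E → Submodule R E) (f : R) (m : ℕ) (N : Submodule R E) : Set ℕ :=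
  {a | ¬ C^[m] (f ^ a • N) ≤ C^[m] (f ^ (a + 1) • N)}

theorem pow_smul_anti (f : R) (N : Submodule R E) {a b : ℕ} (h : a ≤ b) :
    f ^ b • N ≤ f ^ a • N := by
  obtain ⟨c, rfl⟩ := Nat.exists_eq_add_of_le h
  rw [pow_add, mul_smul]
  exact smul_mono_right' _ (FrobEnd.smul_le _ _)

theorem iterate_pow_smul (hC : ∀ (a : R) N, C (a ^ q • N) = a • C N) (m : ℕ) (a : R)
    (N : Submodule R E) : C^[m] (a ^ q ^ m • N) = a • C^[m] N := by
  induction m generalizing N with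
  | zero => simp
  | succ m ih => rw [Function.iterate_succ_apply, pow_succ, pow_mul, hC, ih,
      Function.iterate_succ_apply]

theorem iterate_succ_pow_smul (hC : ∀ (a : R) N, C (a ^ q • N) = a • C N) (m s r : ℕ)
    (N : Submodule R E) :
    C^[m + 1] (f ^ (q * s + r) • N) = C^[m] (f ^ s • C (f ^ r • N)) := by
  rw [Function.iterate_succ_apply, pow_add, mul_smul, mul_comm q s, pow_mul, hC]

/-- Dividing a jump of level `m + 1` of `N` by `q` gives a jump of level `m` of `C N`: within a block
`[q s, q (s + 1))` the modules lie between `C ^ m (f ^ s (C N))` and `C ^ m (f ^ (s + 1) (C N))`. -/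
theorem div_mem_jumps (hmono : Monotone C) (hq : 0 < q)
    (hC : ∀ (a : R) N, C (a ^ q • N) = a • C N) {m a : ℕ} {N : Submodule R E}
    (ha : a ∈ jumps C f (m + 1) N) : a / q ∈ jumps C f m (C N) := by
  intro hle
  apply ha
  have h1 : a = q * (a / q) + a % q := (Nat.div_add_mod a q).symm
  have h2 : a % q < q := Nat.mod_lt _ hq
  calc C^[m + 1] (f ^ a • N) = C^[m] (f ^ (a / q) • C (f ^ (a % q) • N)) := by
        rw [← iterate_succ_pow_smul hC, ← h1]
    _ ≤ C^[m] (f ^ (a / q) • C N) :=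
        hmono.iterate m (smul_mono_right' _ (hmono (FrobEnd.smul_le _ _)))
    _ ≤ C^[m] (f ^ (a / q + 1) • C N) := hle
    _ = C^[m + 1] (f ^ (q * (a / q + 1) + 0) • N) := by
        rw [iterate_succ_pow_smul hC, pow_zero, one_smul]
    _ ≤ _ := hmono.iterate (m + 1) (pow_smul_anti f N (by rw [mul_add]; omega))

/-- Conversely, a jump `s` of level `m` of `C N` comes from some jump of level `m + 1` of `N` in the
block `[q s, q (s + 1))`, as otherwise the modules at the two ends of the block coincide. -/
theorem exists_add_mem_jumps (hC : ∀ (a : R) N, C (a ^ q • N) = a • C N) {m s : ℕ}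
    {N : Submodule R E} (hs : s ∈ jumps C f m (C N)) :
    ∃ r < q, q * s + r ∈ jumps C f (m + 1) N := by
  by_contra! h
  apply hs
  have key : ∀ r ≤ q, C^[m + 1] (f ^ (q * s + 0) • N) ≤ C^[m + 1] (f ^ (q * s + r) • N) := by
    intro r
    induction r with
    | zero => exact fun _ => le_rfl
    | succ r ih => exact fun hr => (ih (by omega)).trans (not_not.1 (h r hr))
  have h1 := key q le_rfl
  rw [show q * s + q = q * (s + 1) + 0 by ring, iterate_succ_pow_smul hC,
    iterate_succ_pow_smul hC, pow_zero, one_smul] at h1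
  exact h1

/-- The lower digits of a jump are a jump of lower level. -/
theorem mod_mem_jumps (hmono : Monotone C) (hC : ∀ (a : R) N, C (a ^ q • N) = a • C N)
    {m n a : ℕ} (hmn : m ≤ n) {N : Submodule R E} (ha : a ∈ jumps C f n N) :
    a % q ^ m ∈ jumps C f m N := by
  intro hle
  apply ha
  obtain ⟨k, rfl⟩ := Nat.exists_eq_add_of_le' hmn
  have h1 (i : ℕ) : C^[k + m] (f ^ (a % q ^ m + q ^ m * (a / q ^ m) + i) • N)
      = C^[k] (f ^ (a / q ^ m) • C^[m] (f ^ (a % q ^ m + i) • N)) := by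
    rw [Function.iterate_add_apply, add_right_comm, add_comm, pow_add, mul_smul, mul_comm,
      pow_mul, iterate_pow_smul hC]
  have h2 := h1 0
  have h3 := h1 1
  rw [Nat.mod_add_div, add_zero, add_zero] at h2
  rw [Nat.mod_add_div] at h3
  rw [h2, h3]
  exact hmono.iterate k (smul_mono_right' _ hle)

end Jumps

/-! ### Truncations of `p`-adic integers -/

section Padic

variable {p : ℕ} [Fact p.Prime]

theorem appr_eq_of_dvd {α : ℤ_[p]} {n a : ℕ} (ha : a < p ^ n) (h : (p : ℤ_[p]) ^ n ∣ α - a) :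
    α.appr n = a := by
  have h1 : (p : ℤ_[p]) ^ n ∣ α - α.appr n := Ideal.mem_span_singleton.1 (PadicInt.appr_spec n α)
  have h2 : (p : ℤ_[p]) ^ n ∣ ((α.appr n - a : ℤ) : ℤ_[p]) := by
    have := dvd_sub h h1
    push_cast
    convert this using 1
    ring
  have h3 : ((p ^ n : ℕ) : ℤ) ∣ (α.appr n - a : ℤ) := by
    exact_mod_cast (PadicInt.pow_p_dvd_int_iff n _).1 h2
  have h4 := PadicInt.appr_lt α n
  have h5 : (α.appr n : ℤ) ≡ a [ZMOD ((p ^ n : ℕ) : ℤ)] := (Int.modEq_iff_dvd.2 h3).symm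
  have h6 := (Int.natCast_modEq_iff.1 h5)
  rwa [Nat.ModEq, Nat.mod_eq_of_lt h4, Nat.mod_eq_of_lt ha] at h6

theorem dvd_sub_appr (α : ℤ_[p]) (n : ℕ) : (p : ℤ_[p]) ^ n ∣ α - α.appr n :=
  Ideal.mem_span_singleton.1 (PadicInt.appr_spec n α)

theorem appr_mod (α : ℤ_[p]) {m n : ℕ} (h : m ≤ n) : α.appr n % p ^ m = α.appr m := by
  refine (appr_eq_of_dvd (Nat.mod_lt _ (pow_pos (Fact.out : p.Prime).pos m)) ?_).symm
  have h1 : (p : ℤ_[p]) ^ m ∣ α - α.appr n := (pow_dvd_pow _ h).trans (dvd_sub_appr α n)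
  have h2 : (p : ℤ_[p]) ^ m ∣ (α.appr n : ℤ_[p]) - ((α.appr n % p ^ m : ℕ) : ℤ_[p]) := by
    refine ⟨((α.appr n / p ^ m : ℕ) : ℤ_[p]), ?_⟩
    have h3 : ((α.appr n % p ^ m + p ^ m * (α.appr n / p ^ m) : ℕ) : ℤ_[p]) = (α.appr n : ℤ_[p]) :=
      congrArg _ (Nat.mod_add_div _ _)
    rw [← h3]
    push_cast
    ring
  have := dvd_add h1 h2
  rwa [sub_add_sub_cancel] at this

theorem exists_appr_ne {α β : ℤ_[p]} (h : α ≠ β) : ∃ m, ∀ n, m ≤ n → α.appr n ≠ β.appr n := by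
  by_contra! hc
  apply h
  have h1 : ∀ m, α.appr m = β.appr m := fun m => by
    obtain ⟨n, hn, h2⟩ := hc m
    rw [← appr_mod α hn, ← appr_mod β hn, h2]
  rw [← sub_eq_zero]
  have h2 : ∀ m, (p : ℤ_[p]) ^ m ∣ α - β := fun m => by
    have := dvd_sub (dvd_sub_appr α m) (dvd_sub_appr β m)
    rw [h1 m] at this
    simpa using this
  by_contra h0
  obtain ⟨m, hm⟩ := PadicInt.exists_pow_neg_lt p (norm_pos_iff.2 h0)
  exact absurd ((PadicInt.norm_le_pow_iff_mem_span_pow (α - β) m).2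
    (Ideal.mem_span_singleton.2 (h2 m))) (not_le.2 hm)

theorem appr_mul_add (β : ℤ_[p]) {e n c : ℕ} (hc : c < p ^ e) :
    ((p ^ e : ℕ) * β + c : ℤ_[p]).appr (e + n) = p ^ e * β.appr n + c := by
  apply appr_eq_of_dvd
  · have h1 := PadicInt.appr_lt β n
    calc p ^ e * β.appr n + c < p ^ e * β.appr n + p ^ e := by omega
      _ = p ^ e * (β.appr n + 1) := by ring
      _ ≤ p ^ e * p ^ n := Nat.mul_le_mul_left _ h1
      _ = _ := (pow_add _ _ _).symm
  · obtain ⟨d, hd⟩ := dvd_sub_appr β n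
    refine ⟨d, ?_⟩
    push_cast
    rw [pow_add]
    linear_combination (p : ℤ_[p]) ^ e * hd

theorem eq_mul_add_appr (α : ℤ_[p]) (e : ℕ) : ∃ β : ℤ_[p], α = (p ^ e : ℕ) * β + α.appr e := by
  obtain ⟨β, hβ⟩ := dvd_sub_appr α e
  refine ⟨β, ?_⟩
  push_cast
  linear_combination hβ

end Padic

/-! ### Limits of jumps: finiteness and rationality -/

section LimitJumps

open scoped Pointwise

variable {p : ℕ} [Fact p.Prime] {e : ℕ} {R : Type*} [CommRing R] {E : Type*} [AddCommGroup E]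
  [Module R E] {C : Submodule R E → Submodule R E} {f : R}

/-- The `p`-adic integers all of whose truncations modulo `p ^ (e * m)` are jumps of level `m`. -/
def limitJumps (p : ℕ) [Fact p.Prime] (e : ℕ) (C : Submodule R E → Submodule R E) (f : R)
    (N : Submodule R E) : Set ℤ_[p] :=
  {α | ∀ m, α.appr (e * m) ∈ jumps C f m N}

/-- A set of `p`-adic integers whose truncations are among boundedly many numbers is finite, because
finitely many `p`-adic integers have distinct truncations at all high levels. -/
theorem finite_of_encard_le (he : 0 < e) {B : Set ℤ_[p]} {J : ℕ → Set ℕ}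
    (hBJ : ∀ α ∈ B, ∀ m, α.appr (e * m) ∈ J m) {L : ℕ}
    (hL : ∀ m, 1 ≤ m → (J m ∩ Set.Iio (p ^ (e * m))).encard ≤ L) : B.Finite := by
  classical
  by_contra hinf
  obtain ⟨S, hSB, hcard⟩ := Set.Infinite.exists_subset_card_eq hinf (L + 1)
  have h1 : ∀ αβ : ℤ_[p] × ℤ_[p], αβ.1 ≠ αβ.2 → ∃ m, ∀ n, m ≤ n → αβ.1.appr n ≠ αβ.2.appr n :=
    fun αβ h => exists_appr_ne h
  choose! k hk using h1
  set m := (S ×ˢ S).sup k + 1 with hm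
  have hinj : Set.InjOn (fun α : ℤ_[p] => α.appr (e * m)) S := by
    intro α hα β hβ h
    by_contra hne
    refine hk (α, β) hne (e * m) ?_ h
    have h2 : k (α, β) ≤ (S ×ˢ S).sup k := Finset.le_sup (Finset.mem_product.2 ⟨hα, hβ⟩)
    nlinarith [Nat.le_mul_of_pos_left m he]
  have h3 : ((fun α : ℤ_[p] => α.appr (e * m)) '' S) ⊆ J m ∩ Set.Iio (p ^ (e * m)) := by
    rintro _ ⟨α, hα, rfl⟩
    exact ⟨hBJ α (hSB hα) m, PadicInt.appr_lt _ _⟩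
  have h4 := (Set.encard_le_encard h3).trans (hL m (by omega))
  rw [hinj.encard_image, Set.encard_coe_eq_coe_finsetCard, hcard] at h4
  exact absurd (by exact_mod_cast h4 : L + 1 ≤ L) (by omega)

/-- Removing the lowest digit in base `p ^ e` passes from the limits of jumps of `N` to those of
`C N`. -/
theorem exists_shift_mem_limitJumps (hmono : Monotone C)
    (hC : ∀ (a : R) N, C (a ^ p ^ e • N) = a • C N) {N : Submodule R E} {α : ℤ_[p]}
    (hα : α ∈ limitJumps p e C f N) :
    ∃ β ∈ limitJumps p e C f (C N), ∃ c : ℕ, α = (p ^ e : ℕ) * β + c := by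
  obtain ⟨β, hβ⟩ := eq_mul_add_appr α e
  refine ⟨β, fun m => ?_, _, hβ⟩
  have hc := PadicInt.appr_lt α e
  have h1 := hα (m + 1)
  rw [hβ, Nat.mul_succ, add_comm (e * m) e, appr_mul_add β hc] at h1
  have h2 := div_mem_jumps hmono (pow_pos (Fact.out : p.Prime).pos e) hC h1
  rwa [Nat.mul_add_div (pow_pos (Fact.out : p.Prime).pos e), Nat.div_eq_of_lt hc, add_zero] at h2

theorem exists_shift_iterate_mem_limitJumps (hmono : Monotone C)
    (hC : ∀ (a : R) N, C (a ^ p ^ e • N) = a • C N) (n : ℕ) {N : Submodule R E} {α : ℤ_[p]}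
    (hα : α ∈ limitJumps p e C f N) :
    ∃ β ∈ limitJumps p e C f (C^[n] N), ∃ c d : ℕ, α = d * β + c := by
  induction n with
  | zero => exact ⟨α, hα, 0, 1, by simp⟩
  | succ n ih =>
    obtain ⟨β, hβ, c, d, h⟩ := ih
    obtain ⟨γ, hγ, c', h'⟩ := exists_shift_mem_limitJumps hmono hC hβ
    refine ⟨γ, by rwa [Function.iterate_succ_apply'], d * c' + c, d * p ^ e, ?_⟩
    rw [h, h']
    push_cast
    ring

/-- If `C N = N`, every element of `limitJumps` can be prolonged by one more digit in base `p ^ e`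
at its lower end. -/
theorem exists_unshift_mem_limitJumps (hmono : Monotone C)
    (hC : ∀ (a : R) N, C (a ^ p ^ e • N) = a • C N) {N : Submodule R E} (hN : C N = N) {β : ℤ_[p]}
    (hβ : β ∈ limitJumps p e C f N) :
    ∃ c < p ^ e, ((p ^ e : ℕ) * β + c : ℤ_[p]) ∈ limitJumps p e C f N := by
  by_contra! h
  have h1 : ∀ c : ℕ, ∃ m, c < p ^ e →
      ((p ^ e : ℕ) * β + c : ℤ_[p]).appr (e * m) ∉ jumps C f m N := fun c => by
    by_cases hc : c < p ^ e
    · have h2 := h c hc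
      simp only [limitJumps, Set.mem_ofPred_eq, not_forall] at h2
      exact h2.imp fun m hm _ => hm
    · exact ⟨0, fun h => absurd h hc⟩
  choose k hk using h1
  set m := (Finset.range (p ^ e)).sup k
  have h2 := hβ m
  rw [← hN] at h2
  obtain ⟨c, hc, h3⟩ := exists_add_mem_jumps hC h2
  have h4 : k c ≤ m + 1 := (Finset.le_sup (Finset.mem_range.2 hc)).trans (Nat.le_succ m)
  apply hk c hc
  rw [← appr_mul_add β hc, show e + e * m = e * (m + 1) by ring] at h3
  have h5 := mod_mem_jumps hmono hC h4 h3
  rwa [← pow_mul, appr_mod _ (Nat.mul_le_mul_left e h4)] at h5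

/-- If `C N = N` and `limitJumps` is finite, prolonging by a digit permutes it, so that the
expansions of its elements in base `p ^ e` are purely periodic: `β = Q β + a` with `Q` a power of `p`
and `0 ≤ a < Q`. -/
theorem rational_of_mem_limitJumps (he : 0 < e) (hmono : Monotone C)
    (hC : ∀ (a : R) N, C (a ^ p ^ e • N) = a • C N) {N : Submodule R E} (hN : C N = N)
    (hfin : (limitJumps p e C f N).Finite) {β : ℤ_[p]} (hβ : β ∈ limitJumps p e C f N) :
    ∃ r : ℚ, (β : ℚ_[p]) = r ∧ -1 ≤ r ∧ r ≤ 0 := by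
  have h1 : ∀ β : limitJumps p e C f N, ∃ γ : limitJumps p e C f N, ∃ c < p ^ e,
      (γ : ℤ_[p]) = (p ^ e : ℕ) * β + c := fun β => by
    obtain ⟨c, hc, h⟩ := exists_unshift_mem_limitJumps hmono hC hN β.2
    exact ⟨⟨_, h⟩, c, hc, rfl⟩
  choose S c hc hS using h1
  have hp0 : (p : ℤ_[p]) ≠ 0 := by exact_mod_cast (Fact.out : p.Prime).ne_zero
  have hinj : Function.Injective S := by
    intro x y hxy
    have h2 : ((p ^ e : ℕ) * (x : ℤ_[p]) + c x : ℤ_[p]) = (p ^ e : ℕ) * (y : ℤ_[p]) + c y := by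
      rw [← hS, ← hS, hxy]
    have h3 : c x = c y := by
      have h4 := appr_mul_add (x : ℤ_[p]) (n := 0) (hc x)
      have h5 := appr_mul_add (y : ℤ_[p]) (n := 0) (hc y)
      rw [h2, h5] at h4
      simpa [PadicInt.appr] using h4.symm
    rw [h3] at h2
    have h6 := add_right_cancel h2
    exact Subtype.ext (mul_left_cancel₀ (by push_cast; exact pow_ne_zero e hp0) h6)
  have := hfin.to_subtype
  obtain ⟨n, hn, hper⟩ := Function.Injective.mem_periodicPts hinj ⟨β, hβ⟩
  have key : ∀ n, ∀ x : limitJumps p e C f N, ∃ a < p ^ (e * n),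
      ((S^[n] x : limitJumps p e C f N) : ℤ_[p]) = (p ^ (e * n) : ℕ) * x + a := by
    intro n
    induction n with
    | zero => exact fun x => ⟨0, by simp, by simp⟩
    | succ n ih =>
      intro x
      obtain ⟨a, ha, h⟩ := ih x
      refine ⟨p ^ e * a + c (S^[n] x), ?_, ?_⟩
      · have := hc (S^[n] x)
        calc p ^ e * a + c (S^[n] x) < p ^ e * (a + 1) := by rw [mul_add]; omega
          _ ≤ p ^ e * p ^ (e * n) := Nat.mul_le_mul_left _ ha
          _ = _ := by rw [← pow_add]; ring_nf
      · rw [Function.iterate_succ_apply', hS, h, Nat.mul_succ, pow_add]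
        push_cast
        ring
  obtain ⟨a, ha, h⟩ := key n ⟨β, hβ⟩
  rw [hper.eq] at h
  set Q := p ^ (e * n) with hQ
  have hQ2 : 2 ≤ Q := by
    have : 0 < e * n := Nat.mul_pos he hn
    calc 2 ≤ p := (Fact.out : p.Prime).two_le
      _ ≤ p ^ (e * n) := Nat.le_self_pow this.ne' p
  have hQ2' : (2 : ℚ) ≤ Q := by exact_mod_cast hQ2
  have haQ : (a : ℚ) + 1 ≤ Q := by exact_mod_cast ha
  have ha0 : (0 : ℚ) ≤ a := Nat.cast_nonneg a
  refine ⟨-((a : ℚ) / (Q - 1)), ?_, ?_, ?_⟩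
  · have h2 : (β : ℚ_[p]) = Q * (β : ℚ_[p]) + a := by
      have := congrArg (fun x : ℤ_[p] => (x : ℚ_[p])) h
      simpa using this
    have h3 : ((Q : ℚ_[p]) - 1) ≠ 0 := by
      have : ((Q : ℚ) - 1) ≠ 0 := by linarith
      exact_mod_cast this
    push_cast
    rw [← neg_div, eq_div_iff h3]
    linear_combination -h2
  · rw [neg_le_neg_iff, div_le_one (by linarith)]
    linarith
  · rw [neg_nonpos]
    exact div_nonneg ha0 (by linarith)

/-- A bound for the number of jumps of `N` also holds for `C ^ n N`. -/
theorem encard_jumps_iterate_le (hC : ∀ (a : R) N, C (a ^ p ^ e • N) = a • C N)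
    {N : Submodule R E} {L : ℕ}
    (hL : ∀ m, 1 ≤ m → (jumps C f m N ∩ Set.Iio (p ^ (e * m))).encard ≤ L) (n m : ℕ)
    (hm : 1 ≤ m) : (jumps C f m (C^[n] N) ∩ Set.Iio (p ^ (e * m))).encard ≤ L := by
  induction n generalizing N with
  | zero => exact hL m hm
  | succ n ih =>
    refine ih (N := C N) fun m hm => ?_
    refine le_trans ?_ (hL (m + 1) (by omega))
    have h1 : jumps C f m (C N) ∩ Set.Iio (p ^ (e * m)) ⊆
        (fun a => a / p ^ e) '' (jumps C f (m + 1) N ∩ Set.Iio (p ^ (e * (m + 1)))) := by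
      rintro s ⟨hs, hs2⟩
      obtain ⟨r, hr, h⟩ := exists_add_mem_jumps hC hs
      refine ⟨p ^ e * s + r, ⟨h, ?_⟩, ?_⟩
      · have hs2' : s + 1 ≤ p ^ (e * m) := hs2
        change p ^ e * s + r < p ^ (e * (m + 1))
        calc p ^ e * s + r < p ^ e * (s + 1) := by rw [mul_add]; omega
          _ ≤ p ^ e * p ^ (e * m) := Nat.mul_le_mul_left _ hs2'
          _ = _ := by rw [← pow_add]; ring_nf
      · change (p ^ e * s + r) / p ^ e = s
        rw [Nat.mul_add_div (pow_pos (Fact.out : p.Prime).pos e), Nat.div_eq_of_lt hr, add_zero]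
    exact (Set.encard_le_encard h1).trans (Set.encard_image_le _ _)

/-- The limits of jumps of a submodule with `C M ≤ M` are rational: removing sufficiently many lower
digits yields a limit of jumps of a submodule `C ^ n M` that is fixed by `C`. -/
theorem rational_of_mem_limitJumps_of_le [IsNoetherianRing R] (he : 0 < e) (hmono : Monotone C)
    (hC : ∀ (a : R) N, C (a ^ p ^ e • N) = a • C N) {M : Submodule R E}
    (hfg : ∀ n, (C^[n] M).FG) (hM : C M ≤ M) {L : ℕ}
    (hL : ∀ m, 1 ≤ m → (jumps C f m M ∩ Set.Iio (p ^ (e * m))).encard ≤ L) {α : ℤ_[p]}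
    (hα : α ∈ limitJumps p e C f M) : ∃ r : ℚ, (α : ℚ_[p]) = r := by
  have hq : 2 ≤ p ^ e := (Fact.out : p.Prime).two_le.trans (Nat.le_self_pow he.ne' p)
  obtain ⟨n, hn⟩ := exists_iterate_eq hmono hq hC hfg hM
  obtain ⟨β, hβ, c, d, h⟩ := exists_shift_iterate_mem_limitJumps hmono hC n hα
  have hfin : (limitJumps p e C f (C^[n] M)).Finite :=
    finite_of_encard_le he (fun α hα m => hα m)
      (encard_jumps_iterate_le hC hL n)
  obtain ⟨r, hr, -, -⟩ := rational_of_mem_limitJumps he hmono hC hn hfin hβ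
  exact ⟨d * r + c, by rw [h]; push_cast; rw [hr]⟩

end LimitJumps

/-! ### Operators of finite level are differential operators -/

section LevelOperators

variable {p : ℕ} [Fact p.Prime] {R : Type*} [CommRing R] [IsFpRing p R]

/-- If `R` is finite over its `p ^ m`-th powers, an operator of level `m` is a differential
operator. The kernel `J` of the multiplication `R ⊗ R → R` is finitely generated modulo the ideal
`K` generated by the `a ^ (p ^ m) ⊗ 1 - 1 ⊗ a ^ (p ^ m)`, and each of its generators is nilpotent
modulo `K`. So a power of `J` lies in `K`, which is killed by operators of level `m`. -/
theorem IsLevel.isDiffOp {m : ℕ} (hfin : (frob p R m).Finite) {P : AddMonoid.End R}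
    (hP : IsLevel p m P) : IsDiffOp P := by
  have hFp : IsFpRing p (R ⊗[ℤ] R) :=
    .of_ringHom (Algebra.TensorProduct.includeLeftRingHom : R →+* R ⊗[ℤ] R)
  set J := RingHom.ker (Algebra.TensorProduct.lmul' ℤ (S := R)) with hJ
  let d : R → R ⊗[ℤ] R := fun a => a ⊗ₜ[ℤ] (1 : R) - (1 : R) ⊗ₜ[ℤ] a
  have hdpow : ∀ a, d (a ^ p ^ m) = d a ^ p ^ m := by
    intro a
    have := add_pow_frob p m (d a) ((1 : R) ⊗ₜ[ℤ] a)
    rw [sub_add_cancel, Algebra.TensorProduct.tmul_pow, Algebra.TensorProduct.tmul_pow,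
      one_pow] at this
    exact sub_eq_of_eq_add this
  have hdmul : ∀ a b, d (a * b) = (a ⊗ₜ[ℤ] (1 : R)) * d b + ((1 : R) ⊗ₜ[ℤ] b) * d a := by
    intro a b
    simp only [d, mul_sub, Algebra.TensorProduct.tmul_mul_tmul, mul_one, one_mul]
    rw [mul_comm b a]
    abel
  have hdadd : ∀ a b, d (a + b) = d a + d b := by
    intro a b
    simp only [d, TensorProduct.add_tmul, TensorProduct.tmul_add]
    abel
  set K := Ideal.span (Set.range fun a => d (a ^ p ^ m)) with hK
  have hJspan : J ≤ Ideal.span (Set.range d) := by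
    intro z hz
    have key : ∀ z : R ⊗[ℤ] R, z - (Algebra.TensorProduct.lmul' ℤ (S := R) z) ⊗ₜ[ℤ] (1 : R)
        ∈ Ideal.span (Set.range d) := by
      intro z
      induction z with
      | zero => simp
      | add x y hx hy =>
        rw [map_add, TensorProduct.add_tmul, add_sub_add_comm]
        exact Ideal.add_mem _ hx hy
      | tmul a b =>
        have : a ⊗ₜ[ℤ] b - (Algebra.TensorProduct.lmul' ℤ (S := R) (a ⊗ₜ[ℤ] b)) ⊗ₜ[ℤ] (1 : R)
            = - ((a ⊗ₜ[ℤ] (1 : R)) * d b) := by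
          simp only [d, mul_sub, Algebra.TensorProduct.tmul_mul_tmul, mul_one, one_mul,
            Algebra.TensorProduct.lmul'_apply_tmul]
          abel
        rw [this]
        exact neg_mem (Ideal.mul_mem_left _ _ (Ideal.subset_span ⟨b, rfl⟩))
    have h1 := key z
    rw [RingHom.mem_ker.1 hz, TensorProduct.zero_tmul, sub_zero] at h1
    exact h1
  have : Module.Finite R (FrobTwist p m R) := hfin
  obtain ⟨S, hS⟩ := this.fg_top
  set J' := Ideal.span ((fun s : FrobTwist p m R => d (show R from s)) '' (S : Set (FrobTwist p m R)))
    with hJ'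
  have hd : ∀ a, d a ∈ J' ⊔ K := by
    intro a
    have ha : (show FrobTwist p m R from a) ∈ Submodule.span R (S : Set (FrobTwist p m R)) := by
      rw [hS]; trivial
    refine Submodule.closure_induction (p := fun (y : FrobTwist p m R) _ => d (show R from y) ∈ J' ⊔ K)
      ?_ (fun y z _ _ hy hz => ?_) (fun r y hy => ?_) ha
    · change d 0 ∈ _
      simp [d]
    · have : d (show R from y + z) = d (show R from y) + d (show R from z) := hdadd _ _
      rw [this]
      exact Ideal.add_mem _ hy hz
    · have : d (show R from r • y) = d (r ^ p ^ m * (show R from y)) := rfl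
      rw [this, hdmul]
      exact Ideal.add_mem _
        (Ideal.mul_mem_left _ _ (Ideal.mem_sup_left (Ideal.subset_span ⟨y, hy, rfl⟩)))
        (Ideal.mul_mem_left _ _ (Ideal.mem_sup_right (Ideal.subset_span ⟨r, rfl⟩)))
  have hJ'fg : J'.FG := Submodule.fg_span ((Finset.finite_toSet S).image _)
  have hJ'rad : J' ≤ K.radical := by
    refine Ideal.span_le.2 ?_
    rintro _ ⟨a, -, rfl⟩
    exact ⟨p ^ m, by rw [← hdpow]; exact Ideal.subset_span ⟨a, rfl⟩⟩
  obtain ⟨n, hn⟩ := Ideal.exists_pow_le_of_le_radical_of_fg hJ'rad hJ'fg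
  have hJn : J ^ (n + 1) ≤ K := by
    have h1 : J ≤ J' ⊔ K := hJspan.trans (Ideal.span_le.2 (by rintro _ ⟨a, rfl⟩; exact hd a))
    refine (Ideal.pow_right_mono h1 _).trans ((Ideal.sup_pow_add_le_pow_sup_pow).trans ?_)
    rw [pow_one]
    exact sup_le hn le_rfl
  refine ⟨n, fun z hz => ?_⟩
  refine Submodule.closure_induction (p := fun z _ => LinearMap.mul' ℤ R (LinearMap.lTensor R
    (AddMonoidHom.toIntLinearMap P) z) = 0) (by simp) (fun y z _ _ hy hz => ?_) ?_ (hJn hz)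
  · rw [map_add, map_add, hy, hz, add_zero]
  · rintro w _ ⟨a, rfl⟩
    rw [smul_eq_mul]
    induction w with
    | zero => simp
    | add x y hx hy => rw [add_mul, map_add, map_add, hx, hy, add_zero]
    | tmul b c =>
      simp only [d, mul_sub, Algebra.TensorProduct.tmul_mul_tmul, mul_one, map_sub,
        LinearMap.lTensor_tmul, LinearMap.mul'_apply]
      change b * a ^ p ^ m * P c - b * P (c * a ^ p ^ m) = 0
      rw [mul_comm c, hP]
      ring

end LevelOperators

/-! ### Bernstein--Sato roots are limits of jumps -/

section GraphLemma

open scoped Pointwise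

variable {p : ℕ} [Fact p.Prime] {e : ℕ} [NeZero e] {R : Type*} [CommRing R] [IsFpRing p R]
  {E : Type*} [AddCommGroup E] [Module R E]

/-- If every element of `B` lies in `A` after multiplication with a function that is `1` at `α`, the
fibres of `A` and `B` at `α` coincide. -/
theorem lTensor_evalAt_surjective {N : Type*} [AddCommGroup N] [Module (LocConst p) N]
    {A B : Submodule (LocConst p) N} (hAB : A ≤ B) {α : ℤ_[p]}
    (h : ∀ z ∈ B, ∃ c : LocConst p, c α = 1 ∧ c • z ∈ A) :
    Function.Surjective (LinearMap.lTensor (EvalAt p α) (Submodule.inclusion hAB)) := by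
  intro t
  induction t with
  | zero => exact ⟨0, map_zero _⟩
  | add x y hx hy =>
    obtain ⟨x', rfl⟩ := hx
    obtain ⟨y', rfl⟩ := hy
    exact ⟨x' + y', map_add _ _ _⟩
  | tmul r z =>
    obtain ⟨c, hc, hz⟩ := h z z.2
    refine ⟨r ⊗ₜ ⟨c • (z : N), hz⟩, ?_⟩
    rw [LinearMap.lTensor_tmul]
    have h1 : Submodule.inclusion hAB ⟨c • (z : N), hz⟩ = c • z := rfl
    have h2 : c • r = r := by
      change (show ZMod p from c α) * (show ZMod p from r) = r
      rw [hc]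
      exact one_mul (show ZMod p from r)
    rw [h1, ← TensorProduct.smul_tmul, h2]

theorem graphEnd_congr (f : R) {m m' : ℕ} {T : AddMonoid.End (PolynomialModule R E)}
    (hT : IsPolyLevel p m T) (hT' : IsPolyLevel p m' T) : graphEnd p f hT = graphEnd p f hT' := by
  ext z
  induction z using GraphModule.induction with
  | h y s =>
    rw [graphEnd_mk_of_le p f hT (le_max_left m m'), graphEnd_mk_of_le p f hT' (le_max_right m m')]

/-- A function that is constant modulo `p ^ n` acts through the numerators of fractions whose
denominators are `p ^ n`-th powers. -/
theorem locConst_smul_mk_pow (f : R) {n : ℕ} {c : LocConst p}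
    (hc : ∀ a b : ℤ_[p], (p : ℤ_[p]) ^ n ∣ a - b → c a = c b) (y : PolynomialModule R E)
    (s : graphPowers f) :
    c • GraphModule.mk f y (s ^ p ^ n) = GraphModule.mk f (locConstEnd p c y) (s ^ p ^ n) := by
  have hT : IsPolyLevel p n (locConstEnd p c : AddMonoid.End (PolynomialModule R E)) :=
    isPolyLevel_locConstEnd hc
  have h1 : c • GraphModule.mk f y (s ^ p ^ n) = graphEnd p f hT (GraphModule.mk f y (s ^ p ^ n)) := by
    change locConstGraphEnd p f c _ = _
    rw [locConstGraphEnd, graphEnd_congr f _ hT]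
  have hq : 0 < p ^ n := pow_pos (Fact.out : p.Prime).pos n
  rw [h1, graphEnd_mk]
  have h2 : (s ^ p ^ n) ^ (p ^ n - 1) = (s ^ (p ^ n - 1)) ^ p ^ n := by
    rw [← pow_mul, ← pow_mul, mul_comm]
  have h3 : (s ^ p ^ n) ^ p ^ n = (s ^ (p ^ n - 1)) ^ p ^ n * s ^ p ^ n := by
    rw [← mul_pow, ← pow_succ, Nat.sub_add_cancel hq]
  rw [h2, h3]
  have h4 : locConstEnd p c ((s ^ (p ^ n - 1)) ^ p ^ n • y)
      = (s ^ (p ^ n - 1)) ^ p ^ n • locConstEnd p c y :=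
    hT ((s ^ (p ^ n - 1) : graphPowers f) : R[X]) y
  rw [h4]
  exact congrArg Submodule.Quotient.mk (LocalizedModule.mk_cancel_common_left _ _ _)

/-- In characteristic `p`, `(f - t) ^ (p ^ n - 1)` is the sum of the `f ^ (p ^ n - 1 - i) * t ^ i`. -/
theorem sub_X_pow_pred (f : R) (n : ℕ) :
    (Polynomial.C f - Polynomial.X : R[X]) ^ (p ^ n - 1)
      = ∑ i ∈ Finset.range (p ^ n), Polynomial.monomial i (f ^ (p ^ n - 1 - i)) := by
  have hq : p ^ n = (p ^ n - 1) + 1 :=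
    (Nat.sub_add_cancel (pow_pos (Fact.out : p.Prime).pos n)).symm
  have hmonic : (Polynomial.X - Polynomial.C f : R[X]).Monic := Polynomial.monic_X_sub_C f
  have hreg : IsRegular (Polynomial.C f - Polynomial.X : R[X]) := by
    rw [← neg_sub, ← neg_one_mul]
    exact (isUnit_one.neg.isRegular).mul hmonic.isRegular
  have h1 : (Polynomial.C f - Polynomial.X : R[X]) ^ p ^ n
      = Polynomial.C f ^ p ^ n - Polynomial.X ^ p ^ n := by
    have := add_pow_frob p n (Polynomial.C f - Polynomial.X : R[X]) Polynomial.X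
    rw [sub_add_cancel] at this
    rw [this, add_sub_cancel_right]
  refine hreg.left ?_
  change (Polynomial.C f - Polynomial.X : R[X]) * _ = (Polynomial.C f - Polynomial.X : R[X]) * _
  have h2 := (Commute.all (Polynomial.C f : R[X]) Polynomial.X).mul_geom_sum₂ (p ^ n)
  rw [← pow_succ', ← hq, h1, ← neg_inj, neg_sub, ← neg_mul, neg_sub]
  have h3 := (Commute.all (Polynomial.X : R[X]) (Polynomial.C f)).mul_geom_sum₂ (p ^ n)
  rw [← h3]
  refine congrArg _ (Finset.sum_congr rfl fun i _ => ?_)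
  rw [← Polynomial.C_pow, mul_comm, Polynomial.C_mul_X_pow_eq_monomial]

/-- The denominator `f - t`. -/
noncomputable def graphDenom (f : R) : graphPowers f :=
  ⟨Polynomial.C f - Polynomial.X, Submonoid.mem_powers _⟩

theorem graphDenom_pow_smul_single (f : R) (n : ℕ) (x : E) :
    graphDenom f ^ (p ^ n - 1) • PolynomialModule.single R 0 x
      = ∑ i ∈ Finset.range (p ^ n), PolynomialModule.single R i (f ^ (p ^ n - 1 - i) • x) := by
  have h1 : graphDenom f ^ (p ^ n - 1) • PolynomialModule.single R 0 x
      = (Polynomial.C f - Polynomial.X : R[X]) ^ (p ^ n - 1) • PolynomialModule.single R 0 x := rfl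
  rw [h1, sub_X_pow_pred, Finset.sum_smul]
  refine Finset.sum_congr rfl fun i _ => ?_
  rw [PolynomialModule.monomial_smul_single, add_zero]

/-- The characteristic function of `α + p ^ n ℤ_p`. -/
noncomputable def residueIndicator (α : ℤ_[p]) (n : ℕ) : LocConst p where
  toFun β := by classical exact if (p : ℤ_[p]) ^ n ∣ β - α then 1 else 0
  isLocallyConstant := by
    classical
    rw [IsLocallyConstant.iff_eventually_eq]
    intro β
    have hp : (0 : ℝ) < (p : ℝ) ^ (-(n : ℤ)) :=
      zpow_pos (by exact_mod_cast (Fact.out : p.Prime).pos) _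
    filter_upwards [Metric.closedBall_mem_nhds β hp] with γ hγ
    rw [Metric.mem_closedBall, dist_eq_norm, PadicInt.norm_le_pow_iff_mem_span_pow,
      Ideal.mem_span_singleton] at hγ
    have : (p : ℤ_[p]) ^ n ∣ γ - α ↔ (p : ℤ_[p]) ^ n ∣ β - α := by
      rw [← sub_add_sub_cancel γ β α]
      exact dvd_add_right hγ
    simp only [this]

theorem residueIndicator_apply (α β : ℤ_[p]) (n : ℕ) [Decidable ((p : ℤ_[p]) ^ n ∣ β - α)] :
    residueIndicator α n β = if (p : ℤ_[p]) ^ n ∣ β - α then 1 else 0 := by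
  change (@ite _ _ (Classical.propDecidable _) _ _) = _
  congr

theorem residueIndicator_congr (α : ℤ_[p]) (n : ℕ) (a b : ℤ_[p]) (hab : (p : ℤ_[p]) ^ n ∣ a - b) :
    residueIndicator α n a = residueIndicator α n b := by
  classical
  rw [residueIndicator_apply, residueIndicator_apply]
  have : (p : ℤ_[p]) ^ n ∣ a - α ↔ (p : ℤ_[p]) ^ n ∣ b - α := by
    rw [← sub_add_sub_cancel a b α]
    exact dvd_add_right hab
  simp only [this]

theorem residueIndicator_self (α : ℤ_[p]) (n : ℕ) : residueIndicator α n α = 1 := by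
  classical
  rw [residueIndicator_apply, if_pos (by simp)]

theorem residueIndicator_neg_sub_one (α : ℤ_[p]) (n i : ℕ) (hi : i < p ^ n) :
    residueIndicator α n (-(i : ℤ_[p]) - 1) = if i = p ^ n - 1 - α.appr n then 1 else 0 := by
  classical
  rw [residueIndicator_apply]
  have ha := PadicInt.appr_lt α n
  have h1 : (p : ℤ_[p]) ^ n ∣ (-(i : ℤ_[p]) - 1) - α ↔ i = p ^ n - 1 - α.appr n := by
    have h2 : (p : ℤ_[p]) ^ n ∣ (-(i : ℤ_[p]) - 1) - α ↔
        (p : ℤ_[p]) ^ n ∣ α - ((p ^ n - 1 - i : ℕ) : ℤ_[p]) := by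
      have h3 : α - ((p ^ n - 1 - i : ℕ) : ℤ_[p]) = -((-(i : ℤ_[p]) - 1) - α) - (p : ℤ_[p]) ^ n := by
        rw [Nat.cast_sub (by omega), Nat.cast_sub (by omega)]
        push_cast
        ring
      rw [h3, dvd_sub_self_right, dvd_neg]
    rw [h2]
    constructor
    · intro h
      have := appr_eq_of_dvd (by omega) h
      omega
    · intro h
      have : p ^ n - 1 - i = α.appr n := by omega
      rw [this]
      exact dvd_sub_appr α n
  simp only [h1]

namespace FrobEnd

theorem act_pow_smul (φ : FrobEnd p e R E) (h : φ.IsUnit) {P : AddMonoid.End R} {n : ℕ}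
    (hP : IsLevel p (e * n) P) (hP' : ∃ m, IsLevel p m P) (a : R) (y : E) :
    φ.act h P hP' (a ^ p ^ (e * n) • y) = a ^ p ^ (e * n) • φ.act h P hP' y := by
  induction y using (φ.iter n).unit_induction (isUnit_iter h n) with
  | h0 => simp
  | hadd y z hy hz => rw [smul_add, map_add, hy, hz, map_add, smul_add]
  | hC b x =>
    rw [smul_smul, φ.act_apply h P _ n hP, φ.act_apply h P _ n hP, smul_smul, hP]

theorem act_mul (φ : FrobEnd p e R E) (h : φ.IsUnit) {P Q : AddMonoid.End R} {n : ℕ}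
    (hP : IsLevel p (e * n) P) (hQ : IsLevel p (e * n) Q) (hPQ : IsLevel p (e * n) (P * Q)) (y : E) :
    φ.act h P ⟨_, hP⟩ (φ.act h Q ⟨_, hQ⟩ y) = φ.act h (P * Q) ⟨_, hPQ⟩ y := by
  induction y using (φ.iter n).unit_induction (isUnit_iter h n) with
  | h0 => simp
  | hadd y z hy hz => rw [map_add, map_add, map_add, hy, hz]
  | hC b x =>
    rw [φ.act_apply h Q _ n hQ, φ.act_apply h P _ n hP, φ.act_apply h (P * Q) _ n hPQ]
    rfl

/-- The component at `α` modulo `p ^ (e * n)` of `P (x δ₀)`, for `P` of level `e * n`. -/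
theorem residueIndicator_smul_graphAct (φ : FrobEnd p e R E) (h : φ.IsUnit) (f : R)
    {P : AddMonoid.End R} (hP : IsDiffOp P) {n : ℕ} (hPn : IsLevel p (e * n) P) (α : ℤ_[p]) (x : E) :
    residueIndicator α (e * n) • φ.graphAct h f P hP (GraphModule.delta f x)
      = GraphModule.mk f (PolynomialModule.single R (p ^ (e * n) - 1 - α.appr (e * n))
          (φ.act h P ⟨_, hPn⟩ (f ^ α.appr (e * n) • x))) (graphDenom f ^ p ^ (e * n)) := by
  have ha := PadicInt.appr_lt α (e * n)
  have hT : IsPolyLevel p (e * n) (coeffEnd (R := R) (φ.act h P ⟨_, hPn⟩)) :=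
    isPolyLevel_coeffEnd p (φ.act_pow_smul h hPn _)
  have h1 : φ.graphAct h f P hP (GraphModule.delta f x)
      = GraphModule.mk f (coeffEnd (φ.act h P ⟨_, hPn⟩)
          (graphDenom f ^ (p ^ (e * n) - 1) • PolynomialModule.single R 0 x))
          (graphDenom f ^ p ^ (e * n)) := by
    rw [graphAct, graphEnd_congr f _ hT]
    rfl
  rw [h1, locConst_smul_mk_pow f (residueIndicator_congr α (e * n)), graphDenom_pow_smul_single,
    map_sum, map_sum]
  congr 1
  rw [Finset.sum_eq_single (p ^ (e * n) - 1 - α.appr (e * n))]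
  · rw [coeffEnd_single, locConstEnd_single, residueIndicator_neg_sub_one _ _ _ (by omega),
      if_pos rfl, map_one, one_smul]
    congr 4
    omega
  · intro i hi hne
    rw [coeffEnd_single, locConstEnd_single,
      residueIndicator_neg_sub_one _ _ _ (Finset.mem_range.1 hi), if_neg hne, map_zero, zero_smul,
      PolynomialModule.single_zero]
  · intro hi
    exact absurd (Finset.mem_range.2 (by omega)) hi

theorem mem_levelSpan_self (φ : FrobEnd p e R E) (h : φ.IsUnit) (n : ℕ) {N : Submodule R E} {x : E}
    (hx : x ∈ N) : x ∈ φ.levelSpan h (e * n) N := by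
  have h1 : IsLevel p (e * n) (1 : AddMonoid.End R) := fun _ _ => rfl
  have h2 : ∀ y, φ.act h 1 ⟨_, h1⟩ y = y := fun y => by
    induction y using (φ.iter n).unit_induction (isUnit_iter h n) with
    | h0 => simp
    | hadd y z hy hz => rw [map_add, hy, hz]
    | hC b x => rw [φ.act_apply h 1 _ n h1]; rfl
  exact AddSubgroup.subset_closure ⟨1, h1, x, hx, (h2 x).symm⟩

/-- A Bernstein--Sato root has all its truncations among the jumps of finite level. Otherwise, let `a`
be the truncation of `α` to a high level `n` at which it is not a jump. The component of `P (x δ₀)`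
at `α` modulo `p ^ (e * n)` is `P (f ^ a x)` times a fixed power of `t` and `(f - t) ^ (- p ^ (e * n))`,
and `f ^ a x` lies in `D ^ (e * n) f ^ (a + 1) M`. So this component lies in `N_f (f M)`. -/
theorem mem_limitJumps_of_not_surjective (φ : FrobEnd p e R E) (h : φ.IsUnit)
    (hfin : ∀ n, (frob p R n).Finite) (hproj : ∀ n, Module.Projective R (FrobTwist p n R))
    (f : R) (M : Submodule R E) {α : ℤ_[p]}
    (hα : ¬ Function.Surjective (φ.specialize h f M α)) :
    α ∈ limitJumps p e (φ.cartierSpan h) f M := by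
  by_contra hlim
  apply hα
  simp only [limitJumps, Set.mem_ofPred_eq, not_forall] at hlim
  obtain ⟨m, hm⟩ := hlim
  have hjump : ∀ n, m ≤ n → φ.levelSpan h (e * n) (f ^ α.appr (e * n) • M)
      ≤ φ.levelSpan h (e * n) (f ^ (α.appr (e * n) + 1) • M) := by
    intro n hmn
    rw [φ.levelSpan_le_iff h hfin hproj]
    by_contra hn
    have h1 : α.appr (e * n) ∈ jumps (φ.cartierSpan h) f n M := hn
    have := mod_mem_jumps (φ.cartierSpan_mono h) (q := p ^ e) (φ.cartierSpan_pow_smul h) hmn h1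
    rw [← pow_mul, appr_mod _ (Nat.mul_le_mul_left e hmn)] at this
    exact hm this
  refine lTensor_evalAt_surjective _ fun z hz => ?_
  refine Submodule.span_induction (p := fun z _ => ∃ c : LocConst p, c α = 1 ∧
    c • z ∈ φ.graphSubmodule h f (f • M)) ?_ ⟨1, rfl, by simp⟩ ?_ ?_ hz
  · rintro _ ⟨P, hP, x, hx, rfl⟩
    obtain ⟨k, hk⟩ := hP.exists_isLevel p
    have hk' : k ≤ e * (max m k) :=
      (le_max_right m k).trans (Nat.le_mul_of_pos_left _ (NeZero.pos e))
    have hPn := hk.mono hk'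
    generalize hn : max m k = n at hPn
    have hmn : m ≤ n := hn ▸ le_max_left m k
    -- Multiplication with the indicator function of the residue class of `α` extracts the component.
    refine ⟨residueIndicator α (e * n), residueIndicator_self α _, ?_⟩
    rw [φ.residueIndicator_smul_graphAct h f hP hPn]
    have hw : f ^ α.appr (e * n) • x ∈ φ.levelSpan h (e * n) (f ^ (α.appr (e * n) + 1) • M) :=
      hjump n hmn (φ.mem_levelSpan_self h n ⟨x, hx, rfl⟩)
    have hadd : ∀ y z : E, GraphModule.mk f (PolynomialModule.single R
        (p ^ (e * n) - 1 - α.appr (e * n)) (φ.act h P ⟨_, hPn⟩ (y + z))) (graphDenom f ^ p ^ (e * n))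
        = GraphModule.mk f (PolynomialModule.single R
        (p ^ (e * n) - 1 - α.appr (e * n)) (φ.act h P ⟨_, hPn⟩ y)) (graphDenom f ^ p ^ (e * n))
        + GraphModule.mk f (PolynomialModule.single R
        (p ^ (e * n) - 1 - α.appr (e * n)) (φ.act h P ⟨_, hPn⟩ z)) (graphDenom f ^ p ^ (e * n)) :=
      fun y z => by rw [map_add, PolynomialModule.single_add, GraphModule.mk_add]
    -- Each element of `D ^ (e * n) f ^ (a + 1) M` yields an element of `N_f (f M)`.
    let g : E →+ GraphModule E f := AddMonoidHom.mk' (fun y => GraphModule.mk f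
      (PolynomialModule.single R (p ^ (e * n) - 1 - α.appr (e * n)) (φ.act h P ⟨_, hPn⟩ y))
      (graphDenom f ^ p ^ (e * n))) hadd
    have hle : φ.levelSpan h (e * n) (f ^ (α.appr (e * n) + 1) • M)
        ≤ (φ.graphSubmodule h f (f • M)).toAddSubgroup.comap g := by
      refine (AddSubgroup.closure_le _).2 ?_
      rintro _ ⟨Q, hQ, _, ⟨y, hy, rfl⟩, rfl⟩
      have hPQ : IsLevel p (e * n) (P * Q) := fun a b => by
        change P (Q _) = _ * P (Q _)
        rw [hQ, hPn]
      change GraphModule.mk f (PolynomialModule.single R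
        (p ^ (e * n) - 1 - α.appr (e * n)) (φ.act h P ⟨_, hPn⟩ (φ.act h Q ⟨_, hQ⟩
          (f ^ (α.appr (e * n) + 1) • y)))) (graphDenom f ^ p ^ (e * n)) ∈ φ.graphSubmodule h f (f • M)
      rw [φ.act_mul h hPn hQ hPQ, pow_succ, mul_smul,
        ← φ.residueIndicator_smul_graphAct h f (hPQ.isDiffOp (hfin _)) hPQ]
      exact Submodule.smul_mem _ _ (Submodule.subset_span ⟨_, _, f • y, ⟨y, hy, rfl⟩, rfl⟩)
    exact hle hw
  · rintro y z _ _ ⟨c, hc, hy⟩ ⟨d, hd, hz⟩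
    refine ⟨c * d, by rw [LocallyConstant.mul_apply, hc, hd, one_mul], ?_⟩
    rw [smul_add]
    refine Submodule.add_mem _ ?_ ?_
    · rw [mul_comm, mul_smul]; exact Submodule.smul_mem _ _ hy
    · rw [mul_smul]; exact Submodule.smul_mem _ _ hz
  · rintro d z _ ⟨c, hc, hz⟩
    refine ⟨c, hc, ?_⟩
    rw [smul_comm]
    exact Submodule.smul_mem _ _ hz

end FrobEnd

end GraphLemma

/-! ### Finitely generated unit Frobenius modules -/

section Generation

variable {p : ℕ} [Fact p.Prime] {k : ℕ} {R : Type*} [CommRing R] [IsFpRing p R]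
  {E : Type*} [AddCommGroup E] [Module R E]

namespace FrobEnd

theorem pull_span (φ : FrobEnd p k R E) (Y : Set E) :
    φ.pull (Submodule.span R Y) = Submodule.span R (φ.toEnd '' Y) := by
  refine le_antisymm (Submodule.span_le.2 ?_) (Submodule.span_mono (Set.image_mono Submodule.subset_span))
  rintro _ ⟨y, hy, rfl⟩
  refine Submodule.span_induction (p := fun y _ => φ.toEnd y ∈ Submodule.span R (φ.toEnd '' Y))
    (fun y hy => Submodule.subset_span ⟨y, hy, rfl⟩) (by simp) (fun y z _ _ hy hz => ?_)
    (fun a y _ hy => ?_) hy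
  · rw [map_add]; exact add_mem hy hz
  · rw [φ.map_smul]; exact Submodule.smul_mem _ _ hy

theorem pull_fg (φ : FrobEnd p k R E) {N : Submodule R E} (hN : N.FG) : (φ.pull N).FG := by
  obtain ⟨Y, rfl⟩ := hN
  rw [pull_span]
  exact Submodule.fg_span ((Finset.finite_toSet Y).image _)

/-- The `R`-submodule generated by the `φ ^ i s` with `s ∈ S` and `i ≤ n`. -/
def genFiltration (φ : FrobEnd p k R E) (S : Set E) : ℕ → Submodule R E
  | 0 => Submodule.span R S
  | n + 1 => Submodule.span R S ⊔ φ.pull (genFiltration φ S n)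

theorem genFiltration_mono (φ : FrobEnd p k R E) (S : Set E) : Monotone (φ.genFiltration S) := by
  refine monotone_nat_of_le_succ fun n => ?_
  induction n with
  | zero => exact le_sup_left
  | succ n ih => exact sup_le_sup_left (φ.pull_mono ih) _

theorem genFiltration_fg (φ : FrobEnd p k R E) {S : Set E} (hS : S.Finite) (n : ℕ) :
    (φ.genFiltration S n).FG := by
  induction n with
  | zero => exact Submodule.fg_span hS
  | succ n ih => exact (Submodule.fg_span hS).sup (φ.pull_fg ih)

theorem exists_mem_genFiltration (φ : FrobEnd p k R E) {S : Set E}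
    (hgen : ∀ N : Submodule R E, S ⊆ N → (∀ y ∈ N, φ.toEnd y ∈ N) → N = ⊤) (y : E) :
    ∃ n, y ∈ φ.genFiltration S n := by
  have hdir := (φ.genFiltration_mono S).directed_le
  have h1 : (⨆ n, φ.genFiltration S n) = ⊤ := by
    refine hgen _ (fun s hs => ?_) (fun y hy => ?_)
    · exact (le_iSup (φ.genFiltration S) 0) (Submodule.subset_span hs)
    · obtain ⟨n, hn⟩ := (Submodule.mem_iSup_of_directed _ hdir).1 hy
      exact (le_iSup (φ.genFiltration S) (n + 1))
        (le_sup_right (a := Submodule.span R S) (Submodule.subset_span ⟨y, hn, rfl⟩))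
  exact (Submodule.mem_iSup_of_directed _ hdir).1 (h1 ▸ Submodule.mem_top)

theorem exists_mem_pull_genFiltration (φ : FrobEnd p k R E) (h : φ.IsUnit) {S : Set E}
    (hgen : ∀ N : Submodule R E, S ⊆ N → (∀ y ∈ N, φ.toEnd y ∈ N) → N = ⊤) (y : E) :
    ∃ n, y ∈ φ.pull (φ.genFiltration S n) := by
  have hmono := φ.pull_mono.comp (φ.genFiltration_mono S)
  induction y using φ.unit_induction h with
  | h0 => exact ⟨0, zero_mem _⟩
  | hadd y z hy hz =>
    obtain ⟨n, hn⟩ := hy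
    obtain ⟨m, hm⟩ := hz
    exact ⟨max n m, add_mem (hmono (le_max_left n m) hn) (hmono (le_max_right n m) hm)⟩
  | hC a x =>
    obtain ⟨n, hn⟩ := φ.exists_mem_genFiltration hgen x
    exact ⟨n, φ.smul_mem_pull a hn⟩

theorem exists_forall_mem_of_finite {T : ℕ → Submodule R E} (hT : Monotone T) {Y : Set E}
    (hY : Y.Finite) (h : ∀ y ∈ Y, ∃ n, y ∈ T n) : ∃ n, Y ⊆ T n := by
  induction Y, hY using Set.Finite.induction_on with
  | empty => exact ⟨0, Set.empty_subset _⟩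
  | insert _ _ ih =>
    obtain ⟨n, hn⟩ := ih fun y hy => h y (Set.mem_insert_of_mem _ hy)
    obtain ⟨m, hm⟩ := h _ (Set.mem_insert _ _)
    exact ⟨max n m, Set.insert_subset (hT (le_max_right n m) hm) (hn.trans (hT (le_max_left n m)))⟩

/-- A finitely generated submodule of a finitely generated unit `F ^ k`-module is contained in a
finitely generated submodule `N` that is contained in its Frobenius pullback. For `N` one takes a
term of `genFiltration` so large that its pullback contains the generators. -/
theorem exists_fg_le_pull (φ : FrobEnd p k R E) (h : φ.IsUnit) {S : Set E} (hS : S.Finite)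
    (hgen : ∀ N : Submodule R E, S ⊆ N → (∀ y ∈ N, φ.toEnd y ∈ N) → N = ⊤)
    {M : Submodule R E} (hM : M.FG) :
    ∃ N : Submodule R E, N.FG ∧ M ≤ N ∧ N ≤ φ.pull N := by
  obtain ⟨Y, rfl⟩ := hM
  obtain ⟨n, hn⟩ := exists_forall_mem_of_finite (φ.genFiltration_mono S) (Finset.finite_toSet Y)
    fun y _ => φ.exists_mem_genFiltration hgen y
  obtain ⟨m, hm⟩ := exists_forall_mem_of_finite (φ.pull_mono.comp (φ.genFiltration_mono S)) hS
    fun y _ => φ.exists_mem_pull_genFiltration h hgen y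
  refine ⟨φ.genFiltration S (max n m), φ.genFiltration_fg hS _,
    (Submodule.span_le.2 hn).trans (φ.genFiltration_mono S (le_max_left n m)), ?_⟩
  have h1 : Submodule.span R S ≤ φ.pull (φ.genFiltration S (max n m)) :=
    (Submodule.span_le.2 hm).trans (φ.pull_mono (φ.genFiltration_mono S (le_max_right n m)))
  generalize max n m = N at h1
  cases N with
  | zero => exact h1
  | succ N => exact sup_le h1 (φ.pull_mono (φ.genFiltration_mono S (Nat.le_succ N)))

end FrobEnd

end Generation

/-! ### Gauges and the bound over algebras of finite type -/

section Gauge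

open scoped Pointwise

variable (K : Type*) [Field K] {R : Type*} [CommRing R] [Algebra K R]
  {E : Type*} [AddCommGroup E] [Module R E] [Module K E] [IsScalarTower K R E]
  {ι : Type*} [Fintype ι]

/-- The monomials in the `x i` with all exponents at most `d`. -/
def boxMonomials (x : ι → R) (d : ℕ) : Set R :=
  {b | ∃ v : ι → ℕ, (∀ i, v i ≤ d) ∧ b = ∏ i, x i ^ v i}

theorem boxMonomials_mono (x : ι → R) : Monotone (boxMonomials x) :=
  fun _ _ h _ ⟨v, hv, hb⟩ => ⟨v, fun i => (hv i).trans h, hb⟩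

theorem finite_boxMonomials (x : ι → R) (d : ℕ) : (boxMonomials x d).Finite := by
  refine (Set.finite_range fun v : ι → Fin (d + 1) => ∏ i, x i ^ (v i : ℕ)).subset ?_
  rintro _ ⟨v, hv, rfl⟩
  exact ⟨fun i => ⟨v i, Nat.lt_succ_of_le (hv i)⟩, rfl⟩

theorem mul_mem_boxMonomials {x : ι → R} {d d' : ℕ} {b b' : R} (hb : b ∈ boxMonomials x d)
    (hb' : b' ∈ boxMonomials x d') : b * b' ∈ boxMonomials x (d + d') := by
  obtain ⟨v, hv, rfl⟩ := hb
  obtain ⟨w, hw, rfl⟩ := hb'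
  exact ⟨v + w, fun i => add_le_add (hv i) (hw i), by
    simp only [Pi.add_apply, pow_add, Finset.prod_mul_distrib]⟩

theorem one_mem_boxMonomials (x : ι → R) : 1 ∈ boxMonomials x 0 :=
  ⟨0, fun _ => le_rfl, by simp⟩

theorem mul_mem_span_boxMonomials {x : ι → R} {d d' : ℕ} {a a' : R}
    (ha : a ∈ Submodule.span K (boxMonomials x d)) (ha' : a' ∈ Submodule.span K (boxMonomials x d')) :
    a * a' ∈ Submodule.span K (boxMonomials x (d + d')) := by
  have h := Submodule.mul_mem_mul ha ha'
  rw [Submodule.span_mul_span] at h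
  refine Submodule.span_mono ?_ h
  rintro _ ⟨b, hb, b', hb', rfl⟩
  exact mul_mem_boxMonomials hb hb'

theorem exists_mem_span_boxMonomials {x : ι → R} (hx : Algebra.adjoin K (Set.range x) = ⊤) (a : R) :
    ∃ d, a ∈ Submodule.span K (boxMonomials x d) := by
  classical
  have ha : a ∈ Algebra.adjoin K (Set.range x) := by rw [hx]; trivial
  induction ha using Algebra.adjoin_induction with
  | mem y hy =>
    obtain ⟨i, rfl⟩ := hy
    refine ⟨1, Submodule.subset_span ⟨Pi.single i 1, fun j => ?_, ?_⟩⟩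
    · by_cases h : j = i
      · subst h; simp
      · simp [h]
    · rw [Finset.prod_eq_single i] <;> simp +contextual
  | algebraMap c =>
    refine ⟨0, ?_⟩
    rw [Algebra.algebraMap_eq_smul_one]
    exact Submodule.smul_mem _ _ (Submodule.subset_span (one_mem_boxMonomials x))
  | add a b _ _ ha hb =>
    obtain ⟨d, hd⟩ := ha
    obtain ⟨d', hd'⟩ := hb
    exact ⟨max d d', add_mem
      (Submodule.span_mono (boxMonomials_mono x (le_max_left d d')) hd)
      (Submodule.span_mono (boxMonomials_mono x (le_max_right d d')) hd')⟩
  | mul a b _ _ ha hb =>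
    obtain ⟨d, hd⟩ := ha
    obtain ⟨d', hd'⟩ := hb
    exact ⟨d + d', mul_mem_span_boxMonomials K hd hd'⟩

/-- The gauge on an `R`-module with generators `G`, for `R` generated by the `x i` as an algebra over
`K`: the `K`-subspace spanned by the products of elements of `G` with monomials with all exponents at
most `d`. -/
def gauge (x : ι → R) (G : Set E) (d : ℕ) : Submodule K E :=
  Submodule.span K (boxMonomials x d • G)

theorem gauge_mono (x : ι → R) (G : Set E) : Monotone (gauge K x G) := fun _ _ h =>
  Submodule.span_mono (Set.smul_subset_smul_right (boxMonomials_mono x h))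

theorem gauge_finite (x : ι → R) {G : Set E} (hG : G.Finite) (d : ℕ) :
    Module.Finite K (gauge K x G d) := by
  have : (boxMonomials x d • G).Finite := (finite_boxMonomials x d).smul hG
  exact Module.Finite.span_of_finite K this

theorem boxMonomial_smul_mem_gauge {x : ι → R} {G : Set E} {d d' : ℕ} {b : R}
    (hb : b ∈ boxMonomials x d) {y : E} (hy : y ∈ gauge K x G d') :
    b • y ∈ gauge K x G (d + d') := by
  refine Submodule.span_induction (p := fun y _ => b • y ∈ gauge K x G (d + d')) ?_ (by simp)
    (fun y z _ _ hy hz => ?_) (fun c _ _ hy => ?_) hy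
  · rintro _ ⟨b', hb', g, hg, rfl⟩
    change b • b' • g ∈ _
    rw [smul_smul]
    exact Submodule.subset_span ⟨_, mul_mem_boxMonomials hb hb', g, hg, rfl⟩
  · rw [smul_add]; exact add_mem hy hz
  · rw [smul_algebra_smul_comm]; exact Submodule.smul_mem _ _ hy

theorem smul_mem_gauge {x : ι → R} {G : Set E} {d d' : ℕ} {a : R}
    (ha : a ∈ Submodule.span K (boxMonomials x d)) {y : E} (hy : y ∈ gauge K x G d') :
    a • y ∈ gauge K x G (d + d') := by
  refine Submodule.span_induction (p := fun a _ => a • y ∈ gauge K x G (d + d'))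
    (fun b hb => boxMonomial_smul_mem_gauge K hb hy) (by simp)
    (fun a b _ _ ha hb => ?_) (fun c a _ ha => ?_) ha
  · rw [add_smul]; exact add_mem ha hb
  · rw [smul_assoc]; exact Submodule.smul_mem _ _ ha

theorem exists_mem_gauge {x : ι → R} (hx : Algebra.adjoin K (Set.range x) = ⊤) {G : Set E} {y : E}
    (hy : y ∈ Submodule.span R G) : ∃ d, y ∈ gauge K x G d := by
  refine Submodule.span_induction (p := fun y _ => ∃ d, y ∈ gauge K x G d) (fun g hg => ?_)
    ⟨0, zero_mem _⟩ (fun y z _ _ hy hz => ?_) (fun a y _ hy => ?_) hy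
  · exact ⟨0, Submodule.subset_span ⟨1, one_mem_boxMonomials x, g, hg, one_smul R g⟩⟩
  · obtain ⟨d, hd⟩ := hy
    obtain ⟨d', hd'⟩ := hz
    exact ⟨max d d', add_mem (gauge_mono K x G (le_max_left d d') hd)
      (gauge_mono K x G (le_max_right d d') hd')⟩
  · obtain ⟨d, hd⟩ := hy
    obtain ⟨d', hd'⟩ := exists_mem_span_boxMonomials K hx a
    exact ⟨d' + d, smul_mem_gauge K hd' hd⟩

theorem exists_subset_gauge {x : ι → R} (hx : Algebra.adjoin K (Set.range x) = ⊤) {G : Set E}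
    {Y : Set E} (hfin : Y.Finite) (hY : Y ⊆ Submodule.span R G) : ∃ d, Y ⊆ gauge K x G d :=
  FrobEnd.exists_forall_mem_of_finite (gauge_mono K x G) hfin
    fun _ hy => exists_mem_gauge K hx (hY hy)

variable {p : ℕ} [Fact p.Prime] {e : ℕ} [IsFpRing p R]

/-- The operators `cartierOp (l j)` contract the gauge by the factor `p ^ e`, up to a constant. Indeed
`c x ^ v` is a sum of terms `(d x ^ u) ^ q * (c' x ^ a)` with `u = v / q`, with exponents `a` below `q`
and with `c'` in a finite generating set of `K` over its `q`-th powers, where `q = p ^ e`; the constant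
accounts for the finitely many images of the elements `c' x ^ a g`. -/
theorem exists_cartierOp_mem_gauge [IsFpRing p K] (hK : FFiniteRing p K)
    {x : ι → R} (hx : Algebra.adjoin K (Set.range x) = ⊤)
    (φ : FrobEnd p e R E) (h : φ.IsUnit) {G : Set E} (hG : G.Finite)
    (hC : φ.cartierSpan h (Submodule.span R G) ≤ Submodule.span R G)
    {n : ℕ} (l : Fin n → FrobTwist p e R →ₗ[R] R) :
    ∃ D, ∀ d j, ∀ y ∈ gauge K x G d, φ.cartierOp h (l j) y ∈ gauge K x G (d / p ^ e + D) := by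
  have : Module.Finite K (FrobTwist p e K) := finite_frob hK e
  obtain ⟨C, hCspan⟩ := this.fg_top
  let T : Set E := Set.range (fun t : Fin n × C × boxMonomials x (p ^ e) × G =>
    φ.cartierOp h (l t.1) ((show K from (t.2.1 : FrobTwist p e K)) • (t.2.2.1 : R) • (t.2.2.2 : E)))
  have hT : T.Finite := by
    have := (finite_boxMonomials x (p ^ e)).to_subtype
    have := hG.to_subtype
    exact Set.finite_range _
  obtain ⟨D, hD⟩ := exists_subset_gauge K hx hT (G := G) (by
    rintro _ ⟨t, rfl⟩
    refine hC (φ.cartierOp_mem h _ ?_)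
    rw [← algebraMap_smul R]
    exact Submodule.smul_mem _ _ (Submodule.smul_mem _ _ (Submodule.subset_span t.2.2.2.2)))
  refine ⟨D, fun d j y hy => ?_⟩
  refine Submodule.closure_induction
    (p := fun y _ => φ.cartierOp h (l j) y ∈ gauge K x G (d / p ^ e + D)) (by simp)
    (fun y z _ _ hy hz => ?_) ?_ hy
  · rw [map_add]; exact add_mem hy hz
  rintro c _ ⟨_, ⟨v, hv, rfl⟩, g, hg, rfl⟩
  have hprod : (∏ i, x i ^ v i : R)
      = (∏ i, x i ^ (v i / p ^ e)) ^ p ^ e * ∏ i, x i ^ (v i % p ^ e) := by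
    rw [← Finset.prod_pow, ← Finset.prod_mul_distrib]
    refine Finset.prod_congr rfl fun i _ => ?_
    rw [← pow_mul, ← pow_add, Nat.div_add_mod']
  have hc : (show FrobTwist p e K from c) ∈ Submodule.span K (C : Set (FrobTwist p e K)) := by
    rw [hCspan]; trivial
  change φ.cartierOp h (l j) (c • (∏ i, x i ^ v i) • g) ∈ _
  refine Submodule.closure_induction (p := fun (c : FrobTwist p e K) _ => φ.cartierOp h (l j)
    ((show K from c) • (∏ i, x i ^ v i) • g) ∈ gauge K x G (d / p ^ e + D)) ?_
    (fun c c' _ _ hc hc' => ?_) (fun a c hc => ?_) hc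
  · change φ.cartierOp h (l j) ((0 : K) • _) ∈ _
    rw [zero_smul, map_zero]
    exact zero_mem _
  · have : (show K from c + c') = (show K from c) + (show K from c') := rfl
    rw [this, add_smul, map_add]
    exact add_mem hc hc'
  · have h1 : (show K from a • c) • (∏ i, x i ^ v i : R) • g
        = (algebraMap K R a * ∏ i, x i ^ (v i / p ^ e)) ^ p ^ e •
          ((show K from c) • (∏ i, x i ^ (v i % p ^ e) : R) • g) := by
      change (a ^ p ^ e * (show K from c)) • (∏ i, x i ^ v i : R) • g = _
      rw [hprod, mul_pow, ← map_pow, mul_smul, mul_smul, mul_smul, algebraMap_smul]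
      exact congrArg _ (smul_algebra_smul_comm _ _ _).symm
    rw [h1, φ.cartierOp_pow_smul, mul_smul, algebraMap_smul]
    refine Submodule.smul_mem _ _ (boxMonomial_smul_mem_gauge K
      ⟨_, fun i => Nat.div_le_div_right (hv i), rfl⟩ (hD ⟨⟨j, ⟨c, hc⟩, ⟨_, _, fun i => ?_, rfl⟩,
        ⟨g, hg⟩⟩, rfl⟩))
    exact (Nat.mod_lt _ (pow_pos (Fact.out : p.Prime).pos e)).le

theorem cartierSpan_le_span_inter_gauge (φ : FrobEnd p e R E) (h : φ.IsUnit) {x : ι → R} {G : Set E}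
    {n : ℕ} {b : Fin n → R} {l : Fin n → FrobTwist p e R →ₗ[R] R}
    (hbl : ∀ a : R, a = ∑ j, (l j (show FrobTwist p e R from a)) ^ p ^ e * b j) {D d : ℕ}
    (hD : ∀ j, ∀ y ∈ gauge K x G d, φ.cartierOp h (l j) y ∈ gauge K x G (d / p ^ e + D))
    {N : Submodule R E} (hN : N ≤ Submodule.span R (N ∩ gauge K x G d : Set E)) :
    φ.cartierSpan h N
      ≤ Submodule.span R (φ.cartierSpan h N ∩ gauge K x G (d / p ^ e + D) : Set E) := by
  refine (φ.cartierSpan_mono h hN).trans ?_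
  rw [φ.cartierSpan_span h hbl]
  refine Submodule.span_mono ?_
  rintro _ ⟨j, y, ⟨hy, hy'⟩, rfl⟩
  exact ⟨φ.cartierOp_mem h _ hy, hD j y hy'⟩

/-- After `m` steps a gauge of at most `q ^ m * A + 2 * D` has been contracted to `A + 2 * D`, as
`2 * D / q + D ≤ 2 * D`. -/
theorem iterate_cartierSpan_le_span_inter_gauge (he : e ≠ 0) (φ : FrobEnd p e R E) (h : φ.IsUnit)
    {x : ι → R} {G : Set E}
    {n : ℕ} {b : Fin n → R} {l : Fin n → FrobTwist p e R →ₗ[R] R}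
    (hbl : ∀ a : R, a = ∑ j, (l j (show FrobTwist p e R from a)) ^ p ^ e * b j) {D : ℕ}
    (hD : ∀ d j, ∀ y ∈ gauge K x G d, φ.cartierOp h (l j) y ∈ gauge K x G (d / p ^ e + D))
    (A m : ℕ) {d : ℕ} (hd : d ≤ (p ^ e) ^ m * A + 2 * D)
    {N : Submodule R E} (hN : N ≤ Submodule.span R (N ∩ gauge K x G d : Set E)) :
    (φ.cartierSpan h)^[m] N
      ≤ Submodule.span R ((φ.cartierSpan h)^[m] N ∩ gauge K x G (A + 2 * D) : Set E) := by
  induction m generalizing d N with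
  | zero =>
    rw [pow_zero, one_mul] at hd
    exact hN.trans (Submodule.span_mono (Set.inter_subset_inter_right _ (gauge_mono K x G hd)))
  | succ m ih =>
    rw [Function.iterate_succ_apply]
    refine ih ?_ (cartierSpan_le_span_inter_gauge K φ h hbl (hD d) hN)
    have hq : 2 ≤ p ^ e := (Fact.out : p.Prime).two_le.trans (Nat.le_self_pow he p)
    have h1 : d / p ^ e ≤ ((p ^ e) ^ m * A) + D := by
      refine (Nat.div_lt_iff_lt_mul (by omega)).2 ?_ |> Nat.lt_succ_iff.1
      have h2 : 2 * D ≤ p ^ e * D := Nat.mul_le_mul_right D hq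
      calc d ≤ (p ^ e) ^ (m + 1) * A + 2 * D := hd
        _ ≤ (p ^ e) ^ (m + 1) * A + p ^ e * D := by omega
        _ < (((p ^ e) ^ m * A) + D).succ * p ^ e := by
          rw [pow_succ, Nat.succ_mul]
          have : (p ^ e) ^ m * p ^ e * A + p ^ e * D = ((p ^ e) ^ m * A + D) * p ^ e := by ring
          omega
    omega

/-- If `R` is of finite type over an `F`-finite field, the number of jumps in `[0, p ^ (e * m))` is
bounded independently of `m`: for `a ≤ p ^ (e * m)` the module `C ^ m (f ^ a M)` is generated by its
intersection with one fixed finite-dimensional space `V`, and the dimensions of these intersections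
strictly decrease along the jumps. -/
theorem exists_encard_jumps_le [IsFpRing p K] (hK : FFiniteRing p K) [Algebra.FiniteType K R]
    (he : e ≠ 0) [Module.Finite R (FrobTwist p e R)] [Module.Projective R (FrobTwist p e R)]
    (φ : FrobEnd p e R E) (h : φ.IsUnit) {S : Set E} (hS : S.Finite)
    (hgen : ∀ N : Submodule R E, S ⊆ N → (∀ y ∈ N, φ.toEnd y ∈ N) → N = ⊤)
    (f : R) {M : Submodule R E} (hM : M.FG) :
    ∃ L : ℕ, ∀ m, (jumps (φ.cartierSpan h) f m M ∩ Set.Iio (p ^ (e * m))).encard ≤ L := by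
  obtain ⟨s, hs⟩ := Algebra.FiniteType.out (R := K) (A := R)
  have hx : Algebra.adjoin K (Set.range (Subtype.val : s → R)) = ⊤ := by
    rw [Subtype.range_coe]; exact hs
  obtain ⟨N₀, ⟨G, hG⟩, hMN, hN⟩ := φ.exists_fg_le_pull h hS hgen hM
  obtain ⟨Y, rfl⟩ := hM
  obtain ⟨n, b, l, hbl⟩ := exists_frobTwist_dualBasis p e R
  subst hG
  obtain ⟨D, hD⟩ := exists_cartierOp_mem_gauge K hK hx φ h (Finset.finite_toSet G)
    ((φ.gc_cartierSpan h).l_le hN) l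
  obtain ⟨δ, hδ⟩ := exists_mem_span_boxMonomials K hx f
  obtain ⟨d, hd⟩ := exists_subset_gauge K hx (Finset.finite_toSet Y) (G := (G : Set E))
    (Submodule.subset_span.trans hMN)
  set V := gauge K (Subtype.val : s → R) (G : Set E) (δ + d + 2 * D) with hV
  have hVfin : Module.Finite K V := gauge_finite K _ (Finset.finite_toSet G) _
  refine ⟨Module.finrank K V + 1, fun m => ?_⟩
  set N : ℕ → Submodule R E := fun a => (φ.cartierSpan h)^[m] (f ^ a • Submodule.span R (Y : Set E))
    with hNdef
  have hanti : Antitone N := fun a b hab =>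
    (φ.cartierSpan_mono h).iterate m (pow_smul_anti f _ hab)
  have hfpow : ∀ a, f ^ a ∈ Submodule.span K (boxMonomials (Subtype.val : s → R) (a * δ)) := by
    intro a
    induction a with
    | zero => simpa using Submodule.subset_span (one_mem_boxMonomials _)
    | succ a ih =>
      rw [pow_succ, Nat.succ_mul]
      exact mul_mem_span_boxMonomials K ih hδ
  have hgenN : ∀ a ≤ p ^ (e * m), N a ≤ Submodule.span R (N a ∩ V : Set E) := by
    intro a ha
    refine iterate_cartierSpan_le_span_inter_gauge K he φ h hbl hD (δ + d) m (d := a * δ + d) ?_ ?_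
    · rw [pow_mul] at ha
      have h1 := Nat.mul_le_mul_right δ ha
      have h2 : d ≤ (p ^ e) ^ m * d :=
        Nat.le_mul_of_pos_left d (pow_pos (pow_pos (Fact.out : p.Prime).pos _) _)
      rw [mul_add]
      omega
    · rintro _ ⟨y, hy, rfl⟩
      refine Submodule.span_induction (p := fun y _ => f ^ a • y ∈ Submodule.span R
        (↑(f ^ a • Submodule.span R (Y : Set E)) ∩
          ↑(gauge K (Subtype.val : s → R) (G : Set E) (a * δ + d)) : Set E)) ?_ (by simp)
        (fun y z _ _ hy hz => ?_) (fun c y _ hy => ?_) hy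
      · intro y hy
        exact Submodule.subset_span ⟨⟨y, Submodule.subset_span hy, rfl⟩,
          smul_mem_gauge K (hfpow a) (hd hy)⟩
      · rw [smul_add]; exact add_mem hy hz
      · rw [smul_comm]; exact Submodule.smul_mem _ _ hy
  let W : ℕ → Submodule K E := fun a => (N a).restrictScalars K ⊓ V
  have hWfin : ∀ a, Module.Finite K (W a) := fun a =>
    Module.Finite.of_injective (Submodule.inclusion (inf_le_right : W a ≤ V))
      (Submodule.inclusion_injective _)
  have hlt : ∀ a ∈ jumps (φ.cartierSpan h) f m (Submodule.span R (Y : Set E)) ∩ Set.Iio (p ^ (e * m)),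
      ∀ b, a < b → Module.finrank K (W b) < Module.finrank K (W a) := by
    intro a ha b hab
    refine Submodule.finrank_lt_finrank_of_lt (lt_of_le_not_ge
      (inf_le_inf_right V (hanti hab.le)) fun hle => ha.1 ?_)
    refine (hgenN a (Set.mem_Iio.1 ha.2).le).trans (Submodule.span_le.2 fun y hy => ?_)
    exact hanti (Nat.succ_le_of_lt hab) (hle hy).1
  have hinj : Set.InjOn (fun a => Module.finrank K (W a))
      (jumps (φ.cartierSpan h) f m (Submodule.span R (Y : Set E)) ∩ Set.Iio (p ^ (e * m))) := by
    intro a ha b hb hab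
    rcases lt_trichotomy a b with h1 | h1 | h1
    · exact absurd hab (hlt a ha b h1).ne'
    · exact h1
    · exact absurd hab (hlt b hb a h1).ne
  rw [← hinj.encard_image]
  refine (Set.encard_le_encard (t := Set.Iic (Module.finrank K V)) ?_).trans ?_
  · rintro _ ⟨a, -, rfl⟩
    exact Submodule.finrank_mono (inf_le_right : W a ≤ V)
  · rw [← Finset.coe_Iic, Set.encard_coe_eq_coe_finsetCard, Nat.card_Iic]

end Gauge

/-! ### Localization -/

section Away

open scoped Pointwise

variable {R R' E E' : Type*} [CommRing R] [CommRing R'] [AddCommGroup E] [AddCommGroup E']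
  [Module R E] [Module R' E']

/-- The ring homomorphism `σ` and the `σ`-linear map `ρ` exhibit the ring `R'` and the `R'`-module `E'`
as the localizations of `R` and `E` away from `g`. -/
structure IsAwayMap (g : R) (σ : R →+* R') (ρ : E →+ E') : Prop where
  map_smul : ∀ a x, ρ (a • x) = σ a • ρ x
  isUnit : IsUnit (σ g)
  exists_ring : ∀ a', ∃ n a, σ g ^ n * a' = σ a
  exists_module : ∀ y, ∃ n x, σ g ^ n • y = ρ x
  exists_pow_smul : ∀ x, ρ x = 0 → ∃ n, g ^ n • x = 0

/-- The submodule generated by the image of a submodule under a semilinear map. -/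
def extend (R' : Type*) [CommRing R'] [Module R' E'] (ρ : E →+ E') (N : Submodule R E) :
    Submodule R' E' :=
  Submodule.span R' (ρ '' N)

theorem extend_mono (ρ : E →+ E') {N N' : Submodule R E} (h : N ≤ N') :
    extend R' ρ N ≤ extend R' ρ N' :=
  Submodule.span_mono (Set.image_mono h)

theorem mem_extend_of_mem (ρ : E →+ E') {N : Submodule R E} {x : E} (hx : x ∈ N) :
    ρ x ∈ extend R' ρ N :=
  Submodule.subset_span ⟨x, hx, rfl⟩

theorem extend_smul {σ : R →+* R'} {ρ : E →+ E'} (hρ : ∀ a x, ρ (a • x) = σ a • ρ x) (a : R)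
    (N : Submodule R E) : extend R' ρ (a • N) = σ a • extend R' ρ N := by
  rw [extend, extend, ← Submodule.span_smul]
  congr 1
  ext y
  constructor
  · rintro ⟨_, ⟨x, hx, rfl⟩, rfl⟩
    exact ⟨ρ x, ⟨x, hx, rfl⟩, (hρ a x).symm⟩
  · rintro ⟨_, ⟨x, hx, rfl⟩, rfl⟩
    exact ⟨a • x, ⟨x, hx, rfl⟩, hρ a x⟩

namespace IsAwayMap

variable {g : R} {σ : R →+* R'} {ρ : E →+ E'}

theorem exists_pow_smul_eq (h : IsAwayMap g σ ρ) {x x' : E} (hx : ρ x = ρ x') :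
    ∃ n, g ^ n • x = g ^ n • x' := by
  obtain ⟨n, hn⟩ := h.exists_pow_smul (x - x') (by rw [map_sub, hx, sub_self])
  exact ⟨n, by rwa [smul_sub, sub_eq_zero] at hn⟩

theorem mem_of_pow_smul_mem (h : IsAwayMap g σ ρ) {N : Submodule R' E'} {n : ℕ} {y : E'}
    (hy : σ g ^ n • y ∈ N) : y ∈ N := by
  obtain ⟨u, hu⟩ := h.isUnit.pow n
  have : y = (↑u⁻¹ : R') • σ g ^ n • y := by rw [← hu, smul_smul, Units.inv_mul, one_smul]
  rw [this]
  exact N.smul_mem _ hy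

theorem exists_of_mem_extend (h : IsAwayMap g σ ρ) {N : Submodule R E} {y : E'}
    (hy : y ∈ extend R' ρ N) : ∃ n, ∃ x ∈ N, σ g ^ n • y = ρ x := by
  refine Submodule.span_induction (p := fun y _ => ∃ n, ∃ x ∈ N, σ g ^ n • y = ρ x) ?_
    ⟨0, 0, zero_mem _, by simp⟩ ?_ ?_ hy
  · rintro _ ⟨x, hx, rfl⟩
    exact ⟨0, x, hx, by simp⟩
  · rintro y z - - ⟨n, x, hx, hy⟩ ⟨m, w, hw, hz⟩
    refine ⟨n + m, g ^ m • x + g ^ n • w, add_mem (N.smul_mem _ hx) (N.smul_mem _ hw), ?_⟩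
    rw [map_add, h.map_smul, h.map_smul, ← hy, ← hz, smul_add, map_pow, map_pow, smul_smul, smul_smul,
      ← pow_add, ← pow_add, add_comm m n]
  · rintro a y - ⟨n, x, hx, hy⟩
    obtain ⟨m, b, hb⟩ := h.exists_ring a
    refine ⟨m + n, b • x, N.smul_mem _ hx, ?_⟩
    rw [h.map_smul, ← hy, ← hb, smul_smul, smul_smul, pow_add]
    congr 1
    ring

theorem exists_pow_smul_mem (h : IsAwayMap g σ ρ) {N : Submodule R E} {x : E}
    (hx : ρ x ∈ extend R' ρ N) : ∃ n, g ^ n • x ∈ N := by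
  obtain ⟨n, y, hy, hxy⟩ := h.exists_of_mem_extend hx
  rw [← map_pow, ← h.map_smul] at hxy
  obtain ⟨m, hm⟩ := h.exists_pow_smul_eq hxy
  exact ⟨m + n, by rw [pow_add, mul_smul, hm]; exact N.smul_mem _ hy⟩

variable {p : ℕ} [Fact p.Prime] {k : ℕ} [IsFpRing p R] [IsFpRing p R']

/-- The formation of `cartierSpan` commutes with localization. For the inclusion from left to right,
the preimage `P` of a submodule of `E'` is saturated with respect to `g`, and hence so is `pull P`. -/
theorem extend_cartierSpan (h : IsAwayMap g σ ρ) (φ : FrobEnd p k R E) (hφ : φ.IsUnit)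
    (φ' : FrobEnd p k R' E') (hφ' : φ'.IsUnit) (hρ : ∀ x, ρ (φ.toEnd x) = φ'.toEnd (ρ x))
    [Module.Finite R (FrobTwist p k R)] [Module.Projective R (FrobTwist p k R)]
    [Module.Finite R' (FrobTwist p k R')] [Module.Projective R' (FrobTwist p k R')]
    (N : Submodule R E) :
    extend R' ρ (φ.cartierSpan hφ N) = φ'.cartierSpan hφ' (extend R' ρ N) := by
  have hgc := φ.gc_cartierSpan hφ
  have hgc' := φ'.gc_cartierSpan hφ'
  apply le_antisymm
  · set Q := φ'.cartierSpan hφ' (extend R' ρ N) with hQ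
    let P : Submodule R E :=
      { carrier := {x | ρ x ∈ Q}
        add_mem' := fun {x y} hx hy => by
          change ρ (x + y) ∈ Q
          rw [map_add]; exact add_mem hx hy
        zero_mem' := by
          change ρ 0 ∈ Q
          rw [map_zero]; exact zero_mem _
        smul_mem' := fun a x hx => by
          change ρ (a • x) ∈ Q
          rw [h.map_smul]; exact Q.smul_mem _ hx }
    have hP : φ.cartierSpan hφ N ≤ P := by
      refine hgc.l_le fun x hx => ?_
      have hx' : ρ x ∈ φ'.pull Q := (hgc' _ _).1 le_rfl (mem_extend_of_mem ρ hx)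
      have h1 : ∀ y ∈ φ'.pull Q, ∃ n, ∃ z ∈ φ.pull P, σ g ^ n • y = ρ z := by
        intro y hy
        refine φ'.pull_induction (C := fun y => ∃ n, ∃ z ∈ φ.pull P, σ g ^ n • y = ρ z) hy
          ⟨0, 0, zero_mem _, by simp⟩ ?_ ?_
        · rintro y z ⟨n, x, hx, hy⟩ ⟨m, w, hw, hz⟩
          refine ⟨n + m, g ^ m • x + g ^ n • w,
            add_mem (Submodule.smul_mem _ _ hx) (Submodule.smul_mem _ _ hw), ?_⟩
          rw [map_add, h.map_smul, h.map_smul, ← hy, ← hz, smul_add, map_pow, map_pow, smul_smul,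
            smul_smul, ← pow_add, ← pow_add, add_comm m n]
        · intro a y hy
          obtain ⟨m, b, hb⟩ := h.exists_ring a
          obtain ⟨n, z, hz⟩ := h.exists_module y
          have hzP : z ∈ P := by
            change ρ z ∈ Q
            rw [← hz]; exact Q.smul_mem _ hy
          refine ⟨m + n * p ^ k, b • φ.toEnd z, φ.smul_mem_pull b hzP, ?_⟩
          rw [h.map_smul, hρ, ← hz, φ'.map_smul, ← hb, smul_smul, smul_smul, ← pow_mul, pow_add]
          congr 1
          ring
      obtain ⟨n, z, hz, hxz⟩ := h1 _ hx'
      rw [← map_pow, ← h.map_smul] at hxz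
      obtain ⟨m, hm⟩ := h.exists_pow_smul_eq hxz
      have h2 : (g ^ (m + n)) ^ p ^ k • x ∈ φ.pull P := by
        have h3 : g ^ (m + n) • x ∈ φ.pull P := by
          rw [pow_add, mul_smul, hm]; exact Submodule.smul_mem _ _ hz
        rw [← Nat.sub_add_cancel (pow_pos (Fact.out : p.Prime).pos k), pow_succ, mul_smul]
        exact Submodule.smul_mem _ _ h3
      have h4 : Submodule.span R {x} ≤ φ.pull P := by
        refine (hgc _ _).1 (Submodule.span_le.2 ?_)
        rintro _ ⟨l, y, hy, rfl⟩
        obtain ⟨a, rfl⟩ := Submodule.mem_span_singleton.1 hy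
        change ρ _ ∈ Q
        refine h.mem_of_pow_smul_mem (n := m + n) ?_
        rw [← map_pow, ← h.map_smul, ← φ.cartierOp_pow_smul]
        have h5 : Submodule.span R {(g ^ (m + n)) ^ p ^ k • x} ≤ φ.pull P :=
          (Submodule.span_singleton_le_iff_mem _ _).2 h2
        refine (hgc _ _).2 h5 (φ.cartierOp_mem hφ l ?_)
        rw [smul_comm]
        exact Submodule.smul_mem _ _ (Submodule.mem_span_singleton_self _)
      exact h4 (Submodule.mem_span_singleton_self x)
    refine Submodule.span_le.2 ?_
    rintro _ ⟨x, hx, rfl⟩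
    exact hP hx
  · refine hgc'.l_le (Submodule.span_le.2 ?_)
    rintro _ ⟨x, hx, rfl⟩
    have hx' : x ∈ φ.pull (φ.cartierSpan hφ N) := (hgc _ _).1 le_rfl hx
    refine φ.pull_induction (C := fun x => ρ x ∈ φ'.pull (extend R' ρ (φ.cartierSpan hφ N))) hx'
      (by rw [map_zero]; exact zero_mem _)
      (fun x y hx hy => by rw [map_add]; exact add_mem hx hy) fun a x hx => ?_
    rw [h.map_smul, hρ]
    exact φ'.smul_mem_pull _ (mem_extend_of_mem ρ hx)

/-- Generators of a module over `R[F ^ k]` generate its localization. -/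
theorem generates (h : IsAwayMap g σ ρ) (φ : FrobEnd p k R E) (φ' : FrobEnd p k R' E')
    (hρ : ∀ x, ρ (φ.toEnd x) = φ'.toEnd (ρ x)) {S : Set E}
    (hgen : ∀ N : Submodule R E, S ⊆ N → (∀ y ∈ N, φ.toEnd y ∈ N) → N = ⊤)
    (Q : Submodule R' E') (hS : ρ '' S ⊆ Q) (hQ : ∀ y ∈ Q, φ'.toEnd y ∈ Q) : Q = ⊤ := by
  let P : Submodule R E :=
    { carrier := {x | ρ x ∈ Q}
      add_mem' := fun {x y} hx hy => by
        change ρ (x + y) ∈ Q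
        rw [map_add]; exact add_mem hx hy
      zero_mem' := by
        change ρ 0 ∈ Q
        rw [map_zero]; exact zero_mem _
      smul_mem' := fun a x hx => by
        change ρ (a • x) ∈ Q
        rw [h.map_smul]; exact Q.smul_mem _ hx }
  have hP : P = ⊤ := hgen P (fun s hs => hS ⟨s, hs, rfl⟩) fun y hy => by
    change ρ (φ.toEnd y) ∈ Q
    rw [hρ]
    exact hQ _ hy
  refine top_le_iff.1 fun y _ => ?_
  obtain ⟨n, x, hx⟩ := h.exists_module y
  refine h.mem_of_pow_smul_mem (n := n) ?_
  rw [hx]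
  have : x ∈ P := hP ▸ Submodule.mem_top
  exact this

end IsAwayMap

end Away

/-! ### Sections over affine open subsets -/

section QuasiCoherent

variable {X : Scheme.{u}}

/-- The restriction homomorphism of sections of the structure sheaf. -/
noncomputable def resRing {U V : X.Opens} (h : V ≤ U) : Γ(X, U) →+* Γ(X, V) :=
  (X.presheaf.map (homOfLE h).op).hom

/-- The restriction homomorphism of sections of an `𝒪_X`-module. -/
noncomputable def resModule (𝓜 : X.Modules) {U V : X.Opens} (h : V ≤ U) : Γ(𝓜, U) →+ Γ(𝓜, V) :=
  (𝓜.presheaf.map (homOfLE h).op).hom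

theorem resRing_resRing {U V W : X.Opens} (h : V ≤ U) (h' : W ≤ V) (a : Γ(X, U)) :
    resRing h' (resRing h a) = resRing (h'.trans h) a := by
  have : X.presheaf.map (homOfLE h).op ≫ X.presheaf.map (homOfLE h').op
      = X.presheaf.map (homOfLE (h'.trans h)).op := (X.presheaf.map_comp _ _).symm
  exact congr($this a)

theorem resModule_resModule (𝓜 : X.Modules) {U V W : X.Opens} (h : V ≤ U) (h' : W ≤ V)
    (x : Γ(𝓜, U)) : resModule 𝓜 h' (resModule 𝓜 h x) = resModule 𝓜 (h'.trans h) x := by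
  have : 𝓜.presheaf.map (homOfLE h).op ≫ 𝓜.presheaf.map (homOfLE h').op
      = 𝓜.presheaf.map (homOfLE (h'.trans h)).op := (𝓜.presheaf.map_comp _ _).symm
  exact congr($this x)

theorem resModule_smul (𝓜 : X.Modules) {U V : X.Opens} (h : V ≤ U) (a : Γ(X, U)) (x : Γ(𝓜, U)) :
    resModule 𝓜 h (a • x) = resRing h a • resModule 𝓜 h x :=
  𝓜.map_smul (homOfLE h) a x

theorem appIso_inv_ΓSpecIso_inv {U : X.Opens} (hU : IsAffineOpen U) (W : (Spec Γ(X, U)).Opens)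
    (hW : hU.fromSpec ''ᵁ W ≤ U) (r : Γ(X, U)) :
    (hU.fromSpec.appIso W).inv
        ((Spec Γ(X, U)).presheaf.map W.leTop.op ((Scheme.ΓSpecIso Γ(X, U)).inv r))
      = X.presheaf.map (homOfLE hW).op r := by
  have h1 := Scheme.Hom.app_appIso_inv hU.fromSpec U
  rw [hU.fromSpec_app_self] at h1
  have e : W ≤ hU.fromSpec ⁻¹ᵁ U := by rw [hU.fromSpec_preimage_self]; exact le_top
  have h2 := Scheme.Hom.appIso_inv_naturality hU.fromSpec (homOfLE e).op
  have h3 : W.leTop.op = (eqToHom hU.fromSpec_preimage_self).op ≫ (homOfLE e).op := rfl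
  have h4 : (Scheme.ΓSpecIso Γ(X, U)).inv ≫ (Spec Γ(X, U)).presheaf.map W.leTop.op ≫
      (hU.fromSpec.appIso W).inv = X.presheaf.map (homOfLE hW).op := by
    rw [h3, Functor.map_comp, Category.assoc, h2, ← Category.assoc, ← Category.assoc,
      Category.assoc _ _ (Scheme.Hom.appIso _ _).inv, ← Category.assoc, h1]
    exact (X.presheaf.map_comp _ _).symm
  exact congr($h4 r)

/-- The action of `Γ(X, U)` on the sections of the restriction of `𝓜` to `Spec Γ(X, U)`. -/
theorem restrict_fromSpec_smul (𝓜 : X.Modules) {U : X.Opens} (hU : IsAffineOpen U)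
    (W : (Spec Γ(X, U)).Opens) (hW : hU.fromSpec ''ᵁ W ≤ U) (r : Γ(X, U))
    (x : Γ(𝓜.restrict hU.fromSpec, W)) :
    (r • x : Γ(𝓜.restrict hU.fromSpec, W))
      = (X.presheaf.map (homOfLE hW).op r • (show Γ(𝓜, hU.fromSpec ''ᵁ W) from x) :
          Γ(𝓜, hU.fromSpec ''ᵁ W)) := by
  rw [← appIso_inv_ΓSpecIso_inv hU]
  rfl

/-- Sections of a quasi-coherent module over a basic open subset `V` of an affine open subset `U`.
The open subset `U'` is equal to `U`; this form allows for rewriting `U'` as an image. -/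
theorem quasicoherent_sections (𝓜 : X.Modules) [𝓜.IsQuasicoherent] {U : X.Opens}
    (hU : IsAffineOpen U) (g : Γ(X, U)) {U' V : X.Opens} (h : V ≤ U') (hU'U : U' ≤ U)
    (hU' : U' = hU.fromSpec ''ᵁ ⊤) (hV : V = hU.fromSpec ''ᵁ PrimeSpectrum.basicOpen g) :
    (∀ y : Γ(𝓜, V), ∃ (n : ℕ) (x : Γ(𝓜, U')),
      X.presheaf.map (homOfLE (h.trans hU'U)).op (g ^ n) • y = 𝓜.presheaf.map (homOfLE h).op x) ∧
    ∀ x : Γ(𝓜, U'), 𝓜.presheaf.map (homOfLE h).op x = 0 →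
      ∃ n : ℕ, X.presheaf.map (homOfLE hU'U).op (g ^ n) • x = 0 := by
  subst hU' hV
  have hloc := (isIso_fromTildeΓ_iff_isLocalizing (𝓜.restrict hU.fromSpec)).1 inferInstance g
  constructor
  · intro y
    obtain ⟨⟨x, ⟨_, n, rfl⟩⟩, hx⟩ := hloc.surj y
    exact ⟨n, x, (restrict_fromSpec_smul 𝓜 hU (PrimeSpectrum.basicOpen g) _ _ _).symm.trans hx⟩
  · intro x hx
    obtain ⟨⟨_, n, rfl⟩, hn⟩ := hloc.exists_of_eq (x₁ := x) (x₂ := 0) (hx.trans (map_zero _).symm)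
    exact ⟨n, (restrict_fromSpec_smul 𝓜 hU ⊤ _ _ _).symm.trans (hn.trans (smul_zero _))⟩

theorem isAwayMap_res (𝓜 : X.Modules) [𝓜.IsQuasicoherent] {U : X.Opens} (hU : IsAffineOpen U)
    (g : Γ(X, U)) {V : X.Opens} (h : V ≤ U) (hV : V = X.basicOpen g) :
    IsAwayMap g (resRing h) (resModule 𝓜 h) := by
  have htop : U = hU.fromSpec ''ᵁ ⊤ := by
    rw [Scheme.Hom.image_top_eq_opensRange, hU.opensRange_fromSpec]
  obtain ⟨h1, h2⟩ := quasicoherent_sections 𝓜 hU g h le_rfl htop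
    (hV.trans (hU.fromSpec_image_basicOpen g).symm)
  subst hV
  have := hU.isLocalization_basicOpen g
  refine ⟨resModule_smul 𝓜 h, ?_, fun a => ?_, fun y => ?_, fun x hx => ?_⟩
  · exact IsLocalization.Away.algebraMap_isUnit (S := Γ(X, X.basicOpen g)) g
  · obtain ⟨n, b, hb⟩ := IsLocalization.Away.surj g a
    exact ⟨n, b, (mul_comm _ _).trans hb⟩
  · obtain ⟨n, x, hx⟩ := h1 y
    refine ⟨n, x, ?_⟩
    rw [← map_pow]
    exact hx
  · obtain ⟨n, hn⟩ := h2 x hx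
    refine ⟨n, ?_⟩
    have h3 : X.presheaf.map (homOfLE (le_refl U)).op (g ^ n) = g ^ n := by
      have : (homOfLE (le_refl U)).op = 𝟙 (Opposite.op U) := rfl
      rw [this, X.presheaf.map_id]; rfl
    rwa [h3] at hn

theorem extend_extend (𝓜 : X.Modules) {U V W : X.Opens} (h : V ≤ U) (h' : W ≤ V)
    (N : Submodule Γ(X, U) Γ(𝓜, U)) :
    extend Γ(X, W) (resModule 𝓜 h') (extend Γ(X, V) (resModule 𝓜 h) N)
      = extend Γ(X, W) (resModule 𝓜 (h'.trans h)) N := by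
  apply le_antisymm
  · refine Submodule.span_le.2 ?_
    rintro _ ⟨y, hy, rfl⟩
    refine Submodule.span_induction (p := fun y _ => resModule 𝓜 h' y ∈
      extend Γ(X, W) (resModule 𝓜 (h'.trans h)) N) ?_ (by rw [map_zero]; exact zero_mem _)
      (fun y z _ _ hy hz => by rw [map_add]; exact add_mem hy hz)
      (fun a y _ hy => by rw [resModule_smul]; exact Submodule.smul_mem _ _ hy) hy
    rintro _ ⟨x, hx, rfl⟩
    rw [resModule_resModule]
    exact mem_extend_of_mem _ hx
  · refine Submodule.span_le.2 ?_
    rintro _ ⟨x, hx, rfl⟩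
    rw [← resModule_resModule 𝓜 h h']
    exact mem_extend_of_mem _ (mem_extend_of_mem _ hx)

/-- An inclusion of submodules of the sections over an affine open subset can be checked on basic open
subsets. -/
theorem le_of_locally (𝓜 : X.Modules) [𝓜.IsQuasicoherent] {U : X.Opens} (hU : IsAffineOpen U)
    {N N' : Submodule Γ(X, U) Γ(𝓜, U)}
    (hloc : ∀ x ∈ U, ∃ g : Γ(X, U), ∃ V, ∃ h : V ≤ U, V = X.basicOpen g ∧ x ∈ V ∧
      extend Γ(X, V) (resModule 𝓜 h) N ≤ extend Γ(X, V) (resModule 𝓜 h) N') : N ≤ N' := by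
  intro y hy
  refine Submodule.mem_of_span_eq_top_of_smul_pow_mem N' {g | ∃ n, g ^ n • y ∈ N'} ?_ y
    fun ⟨g, hg⟩ => hg
  rw [← hU.self_le_iSup_basicOpen_iff]
  intro x hx
  obtain ⟨g, V, h, hV, hxV, hle⟩ := hloc x hx
  have hg : ∃ n, g ^ n • y ∈ N' :=
    (isAwayMap_res 𝓜 hU g h hV).exists_pow_smul_mem (hle (mem_extend_of_mem _ hy))
  exact TopologicalSpace.Opens.mem_iSup.2 ⟨⟨g, hg⟩, hV ▸ hxV⟩

theorem isRegularRing_sections [IsLocallyNoetherian X] (hreg : RegularScheme X) (U : X.affineOpens) :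
    IsRegularRing Γ(X, U) := by
  have : IsNoetherianRing Γ(X, U) := IsLocallyNoetherian.component_noetherian U
  refine isRegularRing_iff.2 fun P hP => ?_
  let y : PrimeSpectrum Γ(X, U) := ⟨P, hP⟩
  have hy : U.2.fromSpec y ∈ (U : X.Opens) := by
    have : U.2.fromSpec y ∈ Set.range U.2.fromSpec := ⟨y, rfl⟩
    rwa [U.2.range_fromSpec] at this
  let _ : Algebra Γ(X, U) (X.presheaf.stalk (U.2.fromSpec y)) :=
    TopCat.Presheaf.algebra_section_stalk X.presheaf (⟨U.2.fromSpec y, hy⟩ : (U : X.Opens))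
  have : IsLocalization P.primeCompl (X.presheaf.stalk (U.2.fromSpec y)) :=
    U.2.isLocalization_stalk' y hy
  have := hreg (U.2.fromSpec y)
  exact IsRegularLocalRing.of_ringEquiv (R := X.presheaf.stalk (U.2.fromSpec y))
    (IsLocalization.algEquiv P.primeCompl (X.presheaf.stalk (U.2.fromSpec y))
      (Localization.AtPrime P)).toRingEquiv

end QuasiCoherent

/-! ### Unit Frobenius modules on schemes -/

section FrobeniusModules

open scoped Pointwise

variable {p : ℕ} [Fact p.Prime] {e : ℕ} {X : Scheme.{u}} [IsFpScheme p X] {𝓜 : X.Modules}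

theorem finite_frobTwist_sections (hfin : FFiniteScheme p X) (U : X.affineOpens) (n : ℕ) :
    Module.Finite Γ(X, U) (FrobTwist p n Γ(X, U)) :=
  finite_frob (hfin U) n

theorem projective_frobTwist_sections [IsLocallyNoetherian X] (hreg : RegularScheme X)
    (hfin : FFiniteScheme p X) (U : X.affineOpens) (n : ℕ) :
    Module.Projective Γ(X, U) (FrobTwist p n Γ(X, U)) :=
  have := isRegularRing_sections hreg U
  projective_frobTwist n Γ(X, U) (finite_frob (hfin U) n)

namespace FrobeniusModule

/-- The formation of `cartierSpan` commutes with restriction to basic open subsets. -/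
theorem extend_cartierSpan_of_eq_basicOpen [IsLocallyNoetherian X] (hreg : RegularScheme X)
    (hfin : FFiniteScheme p X) [𝓜.IsQuasicoherent] (F : FrobeniusModule p e 𝓜) (hF : F.IsUnit)
    {U V : X.affineOpens} (h : (V : X.Opens) ≤ U) (g : Γ(X, U)) (hV : (V : X.Opens) = X.basicOpen g)
    (N : Submodule Γ(X, U) Γ(𝓜, U)) :
    extend Γ(X, V) (resModule 𝓜 h) ((F.frob U).cartierSpan (hF U) N)
      = (F.frob V).cartierSpan (hF V) (extend Γ(X, V) (resModule 𝓜 h) N) := by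
  have := finite_frobTwist_sections hfin U e
  have := finite_frobTwist_sections hfin V e
  have := projective_frobTwist_sections hreg hfin U e
  have := projective_frobTwist_sections hreg hfin V e
  exact (isAwayMap_res 𝓜 U.2 g h hV).extend_cartierSpan _ (hF U) _ (hF V) (F.map_frob h) N

/-- The formation of `cartierSpan` commutes with restriction to an affine open subset `V` of `U`: this
can be checked on open subsets that are basic in both `U` and `V`. -/
theorem extend_cartierSpan [IsLocallyNoetherian X] (hreg : RegularScheme X)
    (hfin : FFiniteScheme p X) [𝓜.IsQuasicoherent] (F : FrobeniusModule p e 𝓜) (hF : F.IsUnit)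
    {U V : X.affineOpens} (h : (V : X.Opens) ≤ U) (N : Submodule Γ(X, U) Γ(𝓜, U)) :
    extend Γ(X, V) (resModule 𝓜 h) ((F.frob U).cartierSpan (hF U) N)
      = (F.frob V).cartierSpan (hF V) (extend Γ(X, V) (resModule 𝓜 h) N) := by
  have key : ∀ x ∈ (V : X.Opens), ∃ g : Γ(X, V), ∃ W, ∃ hW : W ≤ (V : X.Opens),
      W = X.basicOpen g ∧ x ∈ W ∧
      extend Γ(X, W) (resModule 𝓜 hW)
        (extend Γ(X, V) (resModule 𝓜 h) ((F.frob U).cartierSpan (hF U) N))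
      = extend Γ(X, W) (resModule 𝓜 hW)
        ((F.frob V).cartierSpan (hF V) (extend Γ(X, V) (resModule 𝓜 h) N)) := by
    intro x hx
    obtain ⟨a, b, hab, hxa⟩ := exists_basicOpen_le_affine_inter U.2 V.2 x ⟨h hx, hx⟩
    let W : X.affineOpens := ⟨X.basicOpen b, V.2.basicOpen b⟩
    have hWV : (W : X.Opens) ≤ V := X.basicOpen_le b
    rw [hab] at hxa
    refine ⟨b, W, hWV, rfl, hxa, ?_⟩
    rw [extend_extend, F.extend_cartierSpan_of_eq_basicOpen hreg hfin hF (hWV.trans h) a hab.symm,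
      F.extend_cartierSpan_of_eq_basicOpen hreg hfin hF hWV b rfl, extend_extend]
  apply le_antisymm
  · refine le_of_locally 𝓜 V.2 fun x hx => ?_
    obtain ⟨g, W, hW, hWg, hxW, hEq⟩ := key x hx
    exact ⟨g, W, hW, hWg, hxW, hEq.le⟩
  · refine le_of_locally 𝓜 V.2 fun x hx => ?_
    obtain ⟨g, W, hW, hWg, hxW, hEq⟩ := key x hx
    exact ⟨g, W, hW, hWg, hxW, hEq.ge⟩

theorem extend_iterate_cartierSpan [IsLocallyNoetherian X] (hreg : RegularScheme X)
    (hfin : FFiniteScheme p X) [𝓜.IsQuasicoherent] (F : FrobeniusModule p e 𝓜) (hF : F.IsUnit)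
    {U V : X.affineOpens} (h : (V : X.Opens) ≤ U) (n : ℕ) (N : Submodule Γ(X, U) Γ(𝓜, U)) :
    extend Γ(X, V) (resModule 𝓜 h) (((F.frob U).cartierSpan (hF U))^[n] N)
      = ((F.frob V).cartierSpan (hF V))^[n] (extend Γ(X, V) (resModule 𝓜 h) N) := by
  induction n generalizing N with
  | zero => rfl
  | succ n ih => rw [Function.iterate_succ_apply, Function.iterate_succ_apply, ih,
      F.extend_cartierSpan hreg hfin hF]

/-- The coherent submodule whose sections over affine open subsets are given by `cartierSpan`. It is
the smallest one whose Frobenius pullback contains `M`. -/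
noncomputable def cartier [IsLocallyNoetherian X] (hreg : RegularScheme X)
    (hfin : FFiniteScheme p X) [𝓜.IsQuasicoherent] (F : FrobeniusModule p e 𝓜) (hF : F.IsUnit)
    (M : CoherentSubmodule 𝓜) : CoherentSubmodule 𝓜 where
  sections U := (F.frob U).cartierSpan (hF U) (M.sections U)
  fg U := by
    have := finite_frobTwist_sections hfin U e
    have := projective_frobTwist_sections hreg hfin U e
    exact (F.frob U).cartierSpan_fg (hF U) (M.fg U)
  span_res {U V} h := by
    refine (F.extend_cartierSpan hreg hfin hF h _).trans ?_
    congr 1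
    exact M.span_res h

theorem pullback_eq (F : FrobeniusModule p e 𝓜) (M : CoherentSubmodule 𝓜) (n : ℕ)
    (U : X.affineOpens) : F.pullback M n U = (F.frob U).pull^[n] (M.sections U) :=
  congrFun ((F.frob U).pull_iter n) (M.sections U)

theorem IsRoot.cartierSpan_le [IsLocallyNoetherian X] (hreg : RegularScheme X)
    (hfin : FFiniteScheme p X) {F : FrobeniusModule p e 𝓜} (hF : F.IsUnit)
    {M : CoherentSubmodule 𝓜} (hM : F.IsRoot M) (U : X.affineOpens) :
    (F.frob U).cartierSpan (hF U) (M.sections U) ≤ M.sections U := by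
  have := finite_frobTwist_sections hfin U e
  have := projective_frobTwist_sections hreg hfin U e
  refine ((F.frob U).gc_cartierSpan (hF U)).l_le ?_
  have := hM.1 U
  rwa [F.pullback_eq] at this

/-- If `M` is a root, so is the submodule `C M` of `M`, since `C M ⊆ M ⊆ F ^ * (C M)`. -/
theorem IsRoot.cartier [IsLocallyNoetherian X] (hreg : RegularScheme X)
    (hfin : FFiniteScheme p X) [𝓜.IsQuasicoherent] {F : FrobeniusModule p e 𝓜} (hF : F.IsUnit)
    {M : CoherentSubmodule 𝓜} (hM : F.IsRoot M) : F.IsRoot (F.cartier hreg hfin hF M) := by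
  have hle : ∀ U, M.sections U ≤ (F.frob U).pull ((F.cartier hreg hfin hF M).sections U) :=
    fun U => by
      have := finite_frobTwist_sections hfin U e
      have := projective_frobTwist_sections hreg hfin U e
      exact ((F.frob U).gc_cartierSpan (hF U)).le_u_l _
  refine ⟨fun U => ?_, fun U x => ?_⟩
  · rw [F.pullback_eq]
    exact (hM.cartierSpan_le hreg hfin hF U).trans (hle U)
  · obtain ⟨n, hn⟩ := hM.2 U x
    refine ⟨n + 1, ?_⟩
    rw [F.pullback_eq] at hn ⊢
    rw [Function.iterate_succ_apply]
    exact (F.frob U).pull_mono.iterate n (hle U) hn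

/-- The minimal root `M` satisfies `C M = M`. -/
theorem IsMinimalRoot.cartierSpan_eq [IsLocallyNoetherian X] (hreg : RegularScheme X)
    (hfin : FFiniteScheme p X) [𝓜.IsQuasicoherent] {F : FrobeniusModule p e 𝓜} (hF : F.IsUnit)
    {M : CoherentSubmodule 𝓜} (hM : F.IsMinimalRoot M) (U : X.affineOpens) :
    (F.frob U).cartierSpan (hF U) (M.sections U) = M.sections U :=
  le_antisymm (hM.1.cartierSpan_le hreg hfin hF U) (hM.2 _ (hM.1.cartier hreg hfin hF) U)

/-- The jumps of `M` over the affine open subset `U`. -/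
noncomputable def jumpsOn (F : FrobeniusModule p e 𝓜) (hF : F.IsUnit) (M : CoherentSubmodule 𝓜)
    (f : Γ(X, ⊤)) (m : ℕ) (U : X.affineOpens) : Set ℕ :=
  jumps ((F.frob U).cartierSpan (hF U)) (resRing (le_top : (U : X.Opens) ≤ ⊤) f) m (M.sections U)

theorem levelBSR_eq [NeZero e] [IsLocallyNoetherian X] (hreg : RegularScheme X)
    (hfin : FFiniteScheme p X) (F : FrobeniusModule p e 𝓜) (hF : F.IsUnit)
    (M : CoherentSubmodule 𝓜) (f : Γ(X, ⊤)) (m : ℕ) :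
    F.levelBSR hF M f (e * m) = ⋃ U, F.jumpsOn hF M f m U := by
  ext n
  have hfin' := fun U => finite_frobTwist_sections hfin U
  have hproj' := fun U => projective_frobTwist_sections hreg hfin U
  rw [Set.mem_iUnion]
  refine exists_congr fun U => ?_
  have h1 := ((F.frob U).levelSpan_le_iff (hF U) (hfin' U) (hproj' U) m
    (resRing (le_top : (U : X.Opens) ≤ ⊤) f ^ n • M.sections U)
    (resRing (le_top : (U : X.Opens) ≤ ⊤) f ^ (n + 1) • M.sections U))
  have h2 := ((F.frob U).levelSpan_le_iff (hF U) (hfin' U) (hproj' U) m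
    (resRing (le_top : (U : X.Opens) ≤ ⊤) f ^ (n + 1) • M.sections U)
    (resRing (le_top : (U : X.Opens) ≤ ⊤) f ^ n • M.sections U)).2
    (((F.frob U).cartierSpan_mono (hF U)).iterate m (pow_smul_anti _ _ (Nat.le_succ n)))
  exact lt_iff_le_not_ge.trans ((and_iff_right h2).trans (not_congr h1))

/-- A Bernstein--Sato root is a limit of jumps over some affine open subset. -/
theorem BSR_subset [NeZero e] [IsLocallyNoetherian X] (hreg : RegularScheme X)
    (hfin : FFiniteScheme p X) (F : FrobeniusModule p e 𝓜) (hF : F.IsUnit)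
    (M : CoherentSubmodule 𝓜) (f : Γ(X, ⊤)) {α : ℤ_[p]} (hα : α ∈ F.BSR hF M f) :
    ∃ U : X.affineOpens, α ∈ limitJumps p e ((F.frob U).cartierSpan (hF U))
      (resRing (le_top : (U : X.Opens) ≤ ⊤) f) (M.sections U) := by
  obtain ⟨U, hU⟩ := hα
  exact ⟨U, (F.frob U).mem_limitJumps_of_not_surjective (hF U) (finite_frob (hfin U))
    (projective_frobTwist_sections hreg hfin U) _ _ hU⟩

theorem extend_iterate_pow_smul [IsLocallyNoetherian X] (hreg : RegularScheme X)
    (hfin : FFiniteScheme p X) [𝓜.IsQuasicoherent] (F : FrobeniusModule p e 𝓜) (hF : F.IsUnit)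
    (M : CoherentSubmodule 𝓜) (f : Γ(X, ⊤)) (m n : ℕ) {U V : X.affineOpens}
    (h : (V : X.Opens) ≤ U) :
    extend Γ(X, V) (resModule 𝓜 h) (((F.frob U).cartierSpan (hF U))^[m]
        (resRing (le_top : (U : X.Opens) ≤ ⊤) f ^ n • M.sections U))
      = ((F.frob V).cartierSpan (hF V))^[m]
        (resRing (le_top : (V : X.Opens) ≤ ⊤) f ^ n • M.sections V) := by
  rw [F.extend_iterate_cartierSpan hreg hfin hF, extend_smul (resModule_smul 𝓜 h), map_pow,
    resRing_resRing]
  congr 2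
  exact M.span_res h

/-- Jumps over an affine open subset are jumps over some member of a given affine open covering. -/
theorem jumpsOn_subset [IsLocallyNoetherian X] (hreg : RegularScheme X)
    (hfin : FFiniteScheme p X) [𝓜.IsQuasicoherent] (F : FrobeniusModule p e 𝓜) (hF : F.IsUnit)
    (M : CoherentSubmodule 𝓜) (f : Γ(X, ⊤)) (m : ℕ) {ι : Type*} (W : ι → X.affineOpens)
    (hW : ∀ x : X, ∃ i, x ∈ (W i : X.Opens)) (U : X.affineOpens) :
    F.jumpsOn hF M f m U ⊆ ⋃ i, F.jumpsOn hF M f m (W i) := by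
  intro n hn
  by_contra hnot
  refine hn (le_of_locally 𝓜 U.2 fun x hx => ?_)
  obtain ⟨i, hi⟩ := hW x
  have hni : ((F.frob (W i)).cartierSpan (hF (W i)))^[m]
        (resRing (le_top : (W i : X.Opens) ≤ ⊤) f ^ n • M.sections (W i))
      ≤ ((F.frob (W i)).cartierSpan (hF (W i)))^[m]
        (resRing (le_top : (W i : X.Opens) ≤ ⊤) f ^ (n + 1) • M.sections (W i)) := by
    by_contra h
    exact hnot (Set.mem_iUnion.2 ⟨i, h⟩)
  obtain ⟨a, b, hab, hxa⟩ := exists_basicOpen_le_affine_inter U.2 (W i).2 x ⟨hx, hi⟩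
  let V : X.affineOpens := ⟨X.basicOpen a, U.2.basicOpen a⟩
  have hVU : (V : X.Opens) ≤ U := X.basicOpen_le a
  have hVW : (V : X.Opens) ≤ W i := hab.le.trans (X.basicOpen_le b)
  refine ⟨a, V, hVU, rfl, hxa, ?_⟩
  have h1 := extend_mono (R' := Γ(X, V)) (resModule 𝓜 hVW) hni
  rw [F.extend_iterate_pow_smul hreg hfin hF, F.extend_iterate_pow_smul hreg hfin hF] at h1
  rwa [F.extend_iterate_pow_smul hreg hfin hF, F.extend_iterate_pow_smul hreg hfin hF]

/-- Every point of a scheme covered by schemes of finite type over `F`-finite fields has an affine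
neighbourhood on which the number of jumps is bounded. -/
theorem exists_encard_jumpsOn_le [NeZero e] [IsLocallyNoetherian X] (hreg : RegularScheme X)
    (hfin : FFiniteScheme p X) [𝓜.IsQuasicoherent] {F : FrobeniusModule p e 𝓜} (hF : F.IsUnit)
    (hlfg : F.IsLocallyFG) (hcov : CoveredByFiniteType p X)
    (M : CoherentSubmodule 𝓜) (f : Γ(X, ⊤)) (x : X) :
    ∃ W : X.affineOpens, x ∈ (W : X.Opens) ∧ ∃ L : ℕ, ∀ m,
      (F.jumpsOn hF M f m W ∩ Set.Iio (p ^ (e * m))).encard ≤ L := by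
  obtain ⟨U, hxU, S, hS, hgen⟩ := hlfg x
  obtain ⟨O, hxO, K, _, _, π, hK, _, _⟩ := hcov x
  obtain ⟨g, hgO, hxg⟩ := U.2.exists_basicOpen_le (V := O) ⟨x, hxO⟩ hxU
  let W : X.affineOpens := ⟨X.basicOpen g, U.2.basicOpen g⟩
  have hWU : (W : X.Opens) ≤ U := X.basicOpen_le g
  refine ⟨W, hxg, ?_⟩
  have : IsAffine (W : X.Opens) := W.2
  let ψ : (W : X.Opens).toScheme ⟶ Spec (.of K) := X.homOfLE hgO ≫ π
  have hψ : ψ.appTop.hom.FiniteType :=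
    HasRingHomProperty.appTop @LocallyOfFiniteType ψ inferInstance
  let σ : K →+* Γ(X, W) :=
    ((W : X.Opens).topIso.hom.hom.comp ψ.appTop.hom).comp (Scheme.ΓSpecIso (.of K)).inv.hom
  have hσ : σ.FiniteType := by
    refine ((RingHom.FiniteType.of_surjective _ ?_).comp hψ).comp
      (RingHom.FiniteType.of_surjective _ ?_)
    · exact (ConcreteCategory.bijective_of_isIso (W : X.Opens).topIso.hom).2
    · exact (ConcreteCategory.bijective_of_isIso (Scheme.ΓSpecIso (.of K)).inv).2
  let _ : Algebra K Γ(X, W) := σ.toAlgebra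
  let _ : Module K Γ(𝓜, W) := Module.compHom _ σ
  have : IsScalarTower K Γ(X, W) Γ(𝓜, W) := ⟨fun a b y => mul_smul (σ a) b y⟩
  have : Algebra.FiniteType K Γ(X, W) := hσ
  have := finite_frobTwist_sections hfin W e
  have := projective_frobTwist_sections hreg hfin W e
  refine exists_encard_jumps_le K hK (NeZero.ne e) (F.frob W) (hF W)
    (hS.image (resModule 𝓜 hWU)) (fun Q hSQ hQ => ?_) _ (M.fg W)
  exact (isAwayMap_res 𝓜 U.2 g hWU rfl).generates (F.frob U) (F.frob W) (F.map_frob hWU) hgen Q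
    hSQ hQ

theorem boundedLevelBSR_of_coveredByFiniteType [NeZero e] [AlgebraicGeometry.IsNoetherian X]
    (hreg : RegularScheme X) (hfin : FFiniteScheme p X) [𝓜.IsQuasicoherent]
    {F : FrobeniusModule p e 𝓜} (hF : F.IsUnit) (hlfg : F.IsLocallyFG)
    (hcov : CoveredByFiniteType p X) (M : CoherentSubmodule 𝓜) (f : Γ(X, ⊤)) :
    F.BoundedLevelBSR hF M f := by
  choose W hxW L hL using fun x => exists_encard_jumpsOn_le hreg hfin hF hlfg hcov M f x
  obtain ⟨t, -, ht⟩ := isCompact_univ.elim_nhds_subcover (fun x => ((W x : X.Opens) : Set X))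
    fun x _ => (W x : X.Opens).isOpen.mem_nhds (hxW x)
  refine ⟨∑ x ∈ t, L x, fun m _ => ?_⟩
  have hsub : F.levelBSR hF M f (e * m) ∩ Set.Iio (p ^ (e * m))
      ⊆ ⋃ x ∈ t, F.jumpsOn hF M f m (W x) ∩ Set.Iio (p ^ (e * m)) := by
    rintro n ⟨hn, hn'⟩
    rw [F.levelBSR_eq hreg hfin hF] at hn
    obtain ⟨U, hU⟩ := Set.mem_iUnion.1 hn
    obtain ⟨⟨x, hx⟩, hnx⟩ := Set.mem_iUnion.1
      (F.jumpsOn_subset hreg hfin hF M f m (fun x : t => W x) (fun x => by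
        obtain ⟨y, hy, hxy⟩ := Set.mem_iUnion₂.1 (ht (Set.mem_univ x))
        exact ⟨⟨y, hy⟩, hxy⟩) U hU)
    exact Set.mem_iUnion₂.2 ⟨x, hx, hnx, hn'⟩
  refine (Set.encard_le_encard hsub).trans ((t.set_encard_biUnion_le _).trans ?_)
  rw [Nat.cast_sum]
  exact Finset.sum_le_sum fun x _ => hL x m

end FrobeniusModule

end FrobeniusModules

end BSRoots

open BSRoots in
theorem theorem4p22 (p : ℕ) [Fact p.Prime] (e : ℕ) [NeZero e]
    (X : Scheme.{u}) [AlgebraicGeometry.IsNoetherian X] [BSRoots.IsFpScheme p X]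
    (hreg : BSRoots.RegularScheme X) (hfin : BSRoots.FFiniteScheme p X)
    (𝓜 : X.Modules) [𝓜.IsQuasicoherent]
    (F : BSRoots.FrobeniusModule p e 𝓜) (hunit : F.IsUnit) (hlfg : F.IsLocallyFG)
    (M : BSRoots.CoherentSubmodule 𝓜) (f : Γ(X, ⊤)) :
    (BSRoots.CoveredByFiniteType p X → F.BoundedLevelBSR hunit M f) ∧
    (F.BoundedLevelBSR hunit M f →
      (F.BSR hunit M f).Finite ∧
      (F.IsRoot M → ∀ α ∈ F.BSR hunit M f, ∃ r : ℚ, (α : ℚ_[p]) = r) ∧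
      (F.IsMinimalRoot M →
        ∀ α ∈ F.BSR hunit M f, ∃ r : ℚ, (α : ℚ_[p]) = r ∧ -1 ≤ r ∧ r ≤ 0)) := by
  have he : 0 < e := NeZero.pos e
  refine ⟨fun hcov => F.boundedLevelBSR_of_coveredByFiniteType hreg hfin hunit hlfg hcov M f, ?_⟩
  rintro ⟨L, hL⟩
  have hjumps : ∀ (U : X.affineOpens) m, F.jumpsOn hunit M f m U ⊆ F.levelBSR hunit M f (e * m) :=
    fun U m => by
      rw [F.levelBSR_eq hreg hfin hunit]
      exact Set.subset_iUnion (fun U => F.jumpsOn hunit M f m U) U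
  have hLU : ∀ (U : X.affineOpens) m, 1 ≤ m →
      (F.jumpsOn hunit M f m U ∩ Set.Iio (p ^ (e * m))).encard ≤ L := fun U m hm =>
    (Set.encard_le_encard (Set.inter_subset_inter_left _ (hjumps U m))).trans (hL m hm)
  refine ⟨finite_of_encard_le he (fun α hα m => ?_) hL, fun hM α hα => ?_, fun hM α hα => ?_⟩
  · obtain ⟨U, hU⟩ := F.BSR_subset hreg hfin hunit M f hα
    exact hjumps U m (hU m)
  · obtain ⟨U, hU⟩ := F.BSR_subset hreg hfin hunit M f hα
    have := finite_frobTwist_sections hfin U e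
    have := projective_frobTwist_sections hreg hfin U e
    have := isRegularRing_sections hreg U
    refine rational_of_mem_limitJumps_of_le he ((F.frob U).cartierSpan_mono (hunit U))
      ((F.frob U).cartierSpan_pow_smul (hunit U)) (fun n => ?_)
      (hM.cartierSpan_le hreg hfin hunit U) (hLU U) hU
    induction n with
    | zero => exact M.fg U
    | succ n ih =>
      rw [Function.iterate_succ_apply']
      exact (F.frob U).cartierSpan_fg (hunit U) ih
  · obtain ⟨U, hU⟩ := F.BSR_subset hreg hfin hunit M f hα
    have := finite_frobTwist_sections hfin U e
    have := projective_frobTwist_sections hreg hfin U e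
    exact rational_of_mem_limitJumps he ((F.frob U).cartierSpan_mono (hunit U))
      ((F.frob U).cartierSpan_pow_smul (hunit U)) (hM.cartierSpan_eq hreg hfin hunit U)
      (finite_of_encard_le he (fun β hβ m => hβ m) (hLU U)) hU
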